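/- Let $M$ be a closed (compact, boundaryless, not necessarily connected) $C^\infty$ Riemannian manifold with distance $d$ (distinct components are at infinite distance), and let $f:M\to M$ be a partially hyperbolic $C^1$ diffeomorphism: $TM=E^s\oplus E^c\oplus E^u$ with continuous $Df$-invariant subbundles (possibly zero) such that at each $x\in M$, for unit vectors $v^\sigma\in E^\sigma_x$, $|D_xfv^s|<|D_xfv^c|$, $|D_xfv^c|<|D_xfv^u|$, $|D_xfv^s|<1$ and $|D_xfv^u|>1$. A map $g$ is *Lyapunov stable in the direction $E^c$* if for every $\epsilon>0$ there is $\delta>0$ such that for every $C^1$ path $\gamma$ tangent to $E^c$, $\mathrm{length}(\gamma)<\delta$ implies $\mathrm{length}(g^k\gamma)<\epsilon$ for all $k\ge 0$. A *lamination* tangent to $E^c$ is a partition $W$ of $M$ into path connected leaves such that every point of $M$ lies in the domain $U$ of a homeomorphism $\varphi:U\to B^k\times B^m$ onto a product of open unit balls for which the sets $\varphi^{-1}(B^k\times\{y\})$ are exactly the path components of the sets $L\cap U$, $L$ a leaf, and the maps $u\mapsto\varphi^{-1}(u,y)$ are $C^1$ immersions tangent to $E^c$ (the image of the derivative is $E^c$)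 whose derivatives depend continuously on $(u,y)$. Write $W_r(x)$ for the set of points that can be joined to $x$ by a $C^1$ path of length less than $r$ inside the leaf of $x$. An *$\epsilon$-pseudo-orbit respecting the plaques of $W$* is a sequence $(x_n)_{n\in\mathbb Z}$ in $M$ with $f(x_n)\in W_\epsilon(x_{n+1})$ for all $n$. $W$ is *plaque expansive* if for every $\eta>0$ there is $\epsilon>0$ such that, whenever $(x_n)$ and $(y_n)$ are $\epsilon$-pseudo-orbits respecting the plaques of $W$ with $d(x_n,y_n)<\epsilon$ for all $n\in\mathbb Z$, one has $x_0\in W_\eta(y_0)$. Then: 1. If both $f$ and $f^{-1}$ are Lyapunov stable in the direction $E^c$, then $E^c$ is tangent to a unique lamination $W^c$, and $W^c$ is plaque expansive. 2. The same conclusion holds if there is a constant $C>0$ with $1/C\le |D_xf^k v|\le C$ for all $k\ge 0$, all $x\in M$ and all unit vectors $v\in E^c_x$ (that is, $1/C\le m(Df^k|_{E^c})\le |Df^k|_{E^c}|\le C$). 3. If $Df|_{E^c}$ is an isometry, i.e. $|D_xfv|=|v|$ for all $x\in M$ and $v\in E^c_x$, then the bound in (2) holds for some constant $C>0$; in particular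 the same conclusion holds. -/

import Mathlib

open Set Topology Manifold Bundle
open scoped ContDiff ENNReal

/-- A field `E` of linear subspaces of the tangent spaces of `M` is a continuous subbundle of `TM`
if it is locally spanned by finitely many continuous, pointwise linearly independent vector
fields. -/
def IsContinuousSubbundle {n : ℕ} {M : Type*} [TopologicalSpace M]
    [ChartedSpace (EuclideanSpace ℝ (Fin n)) M] [IsManifold (𝓡 n) ∞ M]
    (E : (x : M) → Submodule ℝ (TangentSpace (𝓡 n) x)) : Prop :=
  ∀ p : M, ∃ U ∈ 𝓝 p, ∃ (k : ℕ) (X : Fin k → (x : M) → TangentSpace (𝓡 n) x),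
    (∀ i, ContinuousOn (fun x => (⟨x, X i x⟩ : TangentBundle (𝓡 n) M)) U) ∧
    ∀ x ∈ U, LinearIndependent ℝ (fun i => X i x) ∧
      Submodule.span ℝ (Set.range fun i => X i x) = E x

/-- `f` is partially hyperbolic with invariant splitting `TM = Es ⊕ Ec ⊕ Eu`. -/
structure IsPartiallyHyperbolic {n : ℕ} {M : Type*} [TopologicalSpace M]
    [ChartedSpace (EuclideanSpace ℝ (Fin n)) M] [IsManifold (𝓡 n) ∞ M]
    [RiemannianBundle (fun x : M => TangentSpace (𝓡 n) x)]
    (f : M ≃ₘ^1⟮𝓡 n, 𝓡 n⟯ M)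
    (Es Ec Eu : (x : M) → Submodule ℝ (TangentSpace (𝓡 n) x)) : Prop where
  continuous_s : IsContinuousSubbundle Es
  continuous_c : IsContinuousSubbundle Ec
  continuous_u : IsContinuousSubbundle Eu
  splitting : ∀ x, DirectSum.IsInternal ![Es x, Ec x, Eu x]
  invariant_s : ∀ x, (Es x).map (mfderiv (𝓡 n) (𝓡 n) f x).toLinearMap = Es (f x)
  invariant_c : ∀ x, (Ec x).map (mfderiv (𝓡 n) (𝓡 n) f x).toLinearMap = Ec (f x)
  invariant_u : ∀ x, (Eu x).map (mfderiv (𝓡 n) (𝓡 n) f x).toLinearMap = Eu (f x)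
  lt_sc : ∀ x, ∀ v ∈ Es x, ∀ w ∈ Ec x, ‖v‖ = 1 → ‖w‖ = 1 →
    ‖mfderiv (𝓡 n) (𝓡 n) f x v‖ < ‖mfderiv (𝓡 n) (𝓡 n) f x w‖
  lt_cu : ∀ x, ∀ v ∈ Ec x, ∀ w ∈ Eu x, ‖v‖ = 1 → ‖w‖ = 1 →
    ‖mfderiv (𝓡 n) (𝓡 n) f x v‖ < ‖mfderiv (𝓡 n) (𝓡 n) f x w‖
  contracting_s : ∀ x, ∀ v ∈ Es x, ‖v‖ = 1 → ‖mfderiv (𝓡 n) (𝓡 n) f x v‖ < 1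
  expanding_u : ∀ x, ∀ v ∈ Eu x, ‖v‖ = 1 → 1 < ‖mfderiv (𝓡 n) (𝓡 n) f x v‖

/-- `f` is Lyapunov stable in the direction `E`. -/
def LyapunovStable {n : ℕ} {M : Type*} [TopologicalSpace M]
    [ChartedSpace (EuclideanSpace ℝ (Fin n)) M]
    [IsManifold (𝓡 n) ∞ M]
    [RiemannianBundle (fun x : M => TangentSpace (𝓡 n) x)]
    (f : M → M) (E : (x : M) → Submodule ℝ (TangentSpace (𝓡 n) x)) : Prop :=
  ∀ ε : ℝ, 0 < ε → ∃ δ : ℝ, 0 < δ ∧ ∀ γ : ℝ → M,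
    ContMDiffOn 𝓘(ℝ, ℝ) (𝓡 n) 1 γ (Icc 0 1) →
    (∀ t ∈ Icc (0 : ℝ) 1, mfderivWithin 𝓘(ℝ, ℝ) (𝓡 n) γ (Icc 0 1) t (1 : ℝ) ∈ E (γ t)) →
    pathELength (𝓡 n) γ 0 1 < ENNReal.ofReal δ →
    ∀ k : ℕ, pathELength (𝓡 n) (f^[k] ∘ γ) 0 1 < ENNReal.ofReal ε

/-- The leaf through `x` of the partition of `M` given by the equivalence relation `W`. -/
def leaf {M : Type*} (W : Setoid M) (x : M) : Set M := {y | W.r y x}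

/-- `φ` is a flow box for the partition `W`, with plaques tangent to `E`: it is a homeomorphism
from an open subset `U` of `M` onto a product of two open unit balls; the plaques
`{q ∈ U | (φ q).2 = y}` are the path components of the sets `L ∩ U`, `L` a leaf; and
`u ↦ φ⁻¹ (u, y)` is a `C^1` immersion tangent to `E` whose derivative is continuous
in `(u, y)`. -/
structure IsFlowBox {n k m : ℕ} {M : Type*} [TopologicalSpace M]
    [ChartedSpace (EuclideanSpace ℝ (Fin n)) M] [IsManifold (𝓡 n) ∞ M]
    (E : (x : M) → Submodule ℝ (TangentSpace (𝓡 n) x)) (W : Setoid M)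
    (φ : OpenPartialHomeomorph M (EuclideanSpace ℝ (Fin k) × EuclideanSpace ℝ (Fin m))) :
    Prop where
  target_eq : φ.target = Metric.ball 0 1 ×ˢ Metric.ball 0 1
  plaque : ∀ q ∈ φ.source, ∀ q' ∈ φ.source,
    JoinedIn (leaf W q ∩ φ.source) q q' ↔ (φ q).2 = (φ q').2
  contMDiffOn : ∀ y ∈ Metric.ball (0 : EuclideanSpace ℝ (Fin m)) 1,
    ContMDiffOn (𝓡 k) (𝓡 n) 1 (fun u => φ.symm (u, y)) (Metric.ball 0 1)
  injective : ∀ z ∈ φ.target,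
    Function.Injective (mfderiv (𝓡 k) (𝓡 n) (fun u => φ.symm (u, z.2)) z.1)
  tangent : ∀ z ∈ φ.target,
    LinearMap.range (mfderiv (𝓡 k) (𝓡 n) (fun u => φ.symm (u, z.2)) z.1).toLinearMap
      = E (φ.symm z)
  continuousOn_deriv : ∀ v : EuclideanSpace ℝ (Fin k), ContinuousOn
    (fun z : EuclideanSpace ℝ (Fin k) × EuclideanSpace ℝ (Fin m) =>
      (⟨φ.symm z, mfderiv (𝓡 k) (𝓡 n) (fun u => φ.symm (u, z.2)) z.1 v⟩ :
        TangentBundle (𝓡 n) M)) φ.target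

/-- The partition `W` of `M` is a lamination of `M` (a continuous foliation with `C^1` leaves whose
tangent spaces vary continuously) tangent to `E`: leaves are path connected, and every point lies
in a flow box. -/
def IsLaminationTangentTo {n : ℕ} {M : Type*} [TopologicalSpace M]
    [ChartedSpace (EuclideanSpace ℝ (Fin n)) M] [IsManifold (𝓡 n) ∞ M]
    (E : (x : M) → Submodule ℝ (TangentSpace (𝓡 n) x)) (W : Setoid M) : Prop :=
  (∀ x, IsPathConnected (leaf W x)) ∧
  ∀ p : M, ∃ (k m : ℕ)
    (φ : OpenPartialHomeomorph M (EuclideanSpace ℝ (Fin k) × EuclideanSpace ℝ (Fin m))),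
    p ∈ φ.source ∧ IsFlowBox E W φ

/-- `W_r(x)`, the ball of centre `x` and radius `r` in the leaf through `x`, for the distance
given by the lengths of `C^1` paths in the leaf. -/
def leafBall {n : ℕ} {M : Type*} [TopologicalSpace M]
    [ChartedSpace (EuclideanSpace ℝ (Fin n)) M]
    [IsManifold (𝓡 n) ∞ M]
    [RiemannianBundle (fun x : M => TangentSpace (𝓡 n) x)]
    (W : Setoid M) (x : M) (r : ℝ) : Set M :=
  {y | ∃ γ : ℝ → M, ContMDiffOn 𝓘(ℝ, ℝ) (𝓡 n) 1 γ (Icc 0 1) ∧ γ 0 = x ∧ γ 1 = y ∧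
    (∀ t ∈ Icc (0 : ℝ) 1, γ t ∈ leaf W x) ∧ pathELength (𝓡 n) γ 0 1 < ENNReal.ofReal r}

/-- An `ε`-pseudo-orbit of `f` respecting the plaques of `W`. -/
def IsPlaquePseudoOrbit {n : ℕ} {M : Type*} [TopologicalSpace M]
    [ChartedSpace (EuclideanSpace ℝ (Fin n)) M]
    [IsManifold (𝓡 n) ∞ M]
    [RiemannianBundle (fun x : M => TangentSpace (𝓡 n) x)]
    (f : M → M) (W : Setoid M) (ε : ℝ) (x : ℤ → M) : Prop :=
  ∀ i : ℤ, f (x i) ∈ leafBall (n := n) W (x (i + 1)) ε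

/-- `f` is plaque expansive at `W`: for every plaque size `η` there is `ε` such that two
`ε`-pseudo-orbits respecting plaques that stay `ε`-close start in a common plaque of size `η`. -/
def PlaqueExpansive {n : ℕ} {M : Type*} [EMetricSpace M]
    [ChartedSpace (EuclideanSpace ℝ (Fin n)) M]
    [IsManifold (𝓡 n) ∞ M]
    [RiemannianBundle (fun x : M => TangentSpace (𝓡 n) x)]
    (f : M → M) (W : Setoid M) : Prop :=
  ∀ η : ℝ, 0 < η → ∃ ε : ℝ, 0 < ε ∧ ∀ x y : ℤ → M,
    IsPlaquePseudoOrbit (n := n) f W ε x → IsPlaquePseudoOrbit (n := n) f W ε y →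
    (∀ i, edist (x i) (y i) < ENNReal.ofReal ε) → x 0 ∈ leafBall (n := n) W (y 0) η

/-- `E` is tangent to a unique lamination, and `f` is plaque expansive at that lamination. -/
def UniqueLaminationPlaqueExpansive {n : ℕ} {M : Type*} [EMetricSpace M]
    [ChartedSpace (EuclideanSpace ℝ (Fin n)) M]
    [IsManifold (𝓡 n) ∞ M]
    [RiemannianBundle (fun x : M => TangentSpace (𝓡 n) x)]
    (f : M → M) (E : (x : M) → Submodule ℝ (TangentSpace (𝓡 n) x)) : Prop :=
  (∃! W : Setoid M, IsLaminationTangentTo E W) ∧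
  ∀ W : Setoid M, IsLaminationTangentTo E W → PlaqueExpansive (n := n) f W

/-- `1/C ≤ m(Df^k|E) ≤ |Df^k|E| ≤ C` for all `k ≥ 0` and some constant `C > 0`. -/
def HasBoundedIterates {n : ℕ} {M : Type*} [TopologicalSpace M]
    [ChartedSpace (EuclideanSpace ℝ (Fin n)) M]
    [IsManifold (𝓡 n) ∞ M]
    [RiemannianBundle (fun x : M => TangentSpace (𝓡 n) x)]
    (f : M → M) (E : (x : M) → Submodule ℝ (TangentSpace (𝓡 n) x)) : Prop :=
  ∃ C : ℝ, 0 < C ∧ ∀ (k : ℕ) (x : M), ∀ v ∈ E x, ‖v‖ = 1 →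
    1 / C ≤ ‖mfderiv (𝓡 n) (𝓡 n) f^[k] x v‖ ∧ ‖mfderiv (𝓡 n) (𝓡 n) f^[k] x v‖ ≤ C

/-- `Df|E` is an isometry. -/
def IsIsometryAlong {n : ℕ} {M : Type*} [TopologicalSpace M]
    [ChartedSpace (EuclideanSpace ℝ (Fin n)) M]
    [IsManifold (𝓡 n) ∞ M]
    [RiemannianBundle (fun x : M => TangentSpace (𝓡 n) x)]
    (f : M → M) (E : (x : M) → Submodule ℝ (TangentSpace (𝓡 n) x)) : Prop :=
  ∀ x, ∀ v ∈ E x, ‖mfderiv (𝓡 n) (𝓡 n) f x v‖ = ‖v‖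

/-! Embed `M` in a Euclidean space by `e`. A difference `e z - e y`, seen from a third point `x`,
becomes a tangent vector at `x` and splits into stable, central and unstable parts. By compactness
the pointwise domination is uniform, so near `x` a mostly unstable difference stays mostly unstable
and expands under `f`, and a mostly stable one does the same under `f⁻¹`
(`IsPartiallyHyperbolic.exists_coneSystem`). Since `M` is bounded, two points whose whole orbits
stay close to that of `x` must differ mainly in the central direction (`ConeSystem.cone_c`), and
they coincide when the central part of their difference is small (`ConeSystem.eq_of_c_small`).

Existence. Peano's theorem gives curves tangent to the continuous bundle `E^c` over every small
central displacement. Lyapunov stability of `f` and `f⁻¹` makes the endpoints of a short such curve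
close along the whole orbit. So, although integral curves need not be unique, the endpoint depends
only on the starting point and the central displacement. This uniqueness makes sliding along `E^c`
continuous (`IsPlaqueBall.continuousOn_slide`) and yields coordinates that straighten the plaques
(`IsPlaqueBall.exists_isChartBox`). Leaves are the classes of points joined by chains of tangent
curves. Each leaf meets a box in countably many plaques, so a path in the leaf that stays in the box
cannot change plaque (`IsChartBox.isFlowBox`).

Uniqueness. A plaque of any other lamination tangent to `E^c` covers all small central displacements
and consists of orbit-close points, so it fills the same local plaque (`IsFlowBox.eventually_rel`,
`IsCentralSystem.eq_tangentSetoid`).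

Plaque expansiveness. Jumps inside short plaques remain small under all iterates. If `x` and `y`
start very close and stay `a`-close up to a time slightly after `N`, then they are `a / 2`-close at
time `N` (`PlaqueSystem.exists_halving`). This gain absorbs the jumps of two pseudo-orbits, so `x 0`
and `y 0` have close orbits in both time directions (`PlaqueSystem.forward_close`) and hence lie in
one plaque (`PlaqueSystem.expansive`).

Bounded iterates along `E^c` bound lengths of images of central curves under `f ^ k` and `f ^ (-k)`,
which is Lyapunov stability of both maps; an isometry has the bound with constant `1`. -/

set_option linter.unusedSectionVars false

/-! ### Abstract dynamics: cones, orbit-closeness and expansiveness. -/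

/-- An abstract model of a partially hyperbolic homeomorphism `F`: the functions `s`, `c`, `u`
measure the stable, central and unstable components of the difference of two points, seen from
a third one. -/
structure ConeSystem {M : Type*} (F : Equiv.Perm M) (ρ : M → M → ℝ) (s c u : M → M → M → ℝ)
    (r κ C : ℝ) : Prop where
  r_pos : 0 < r
  κ_pos : 0 < κ
  κ_lt_one : κ < 1
  one_le_C : 1 ≤ C
  ρ_comm : ∀ a b, ρ a b = ρ b a
  ρ_triangle : ∀ a b d, ρ a b ≤ ρ a d + ρ d b
  ρ_le : ∀ a b, ρ a b ≤ C
  ρ_self : ∀ a, ρ a a = 0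
  eq_of_ρ : ∀ a b, ρ a b ≤ 0 → a = b
  s_nonneg : ∀ x a b, 0 ≤ s x a b
  c_nonneg : ∀ x a b, 0 ≤ c x a b
  u_nonneg : ∀ x a b, 0 ≤ u x a b
  s_comm : ∀ x a b, s x a b = s x b a
  c_comm : ∀ x a b, c x a b = c x b a
  u_comm : ∀ x a b, u x a b = u x b a
  s_triangle : ∀ x a b d, s x a b ≤ s x a d + s x d b
  c_triangle : ∀ x a b d, c x a b ≤ c x a d + c x d b
  u_triangle : ∀ x a b d, u x a b ≤ u x a d + u x d b
  s_le : ∀ x a b, s x a b ≤ C * ρ a b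
  c_le : ∀ x a b, c x a b ≤ C * ρ a b
  u_le : ∀ x a b, u x a b ≤ C * ρ a b
  ρ_le_max : ∀ x a b, ρ x a ≤ r → ρ x b ≤ r → ρ a b ≤ C * max (max (s x a b) (c x a b)) (u x a b)
  cone_u : ∀ x a b, ρ x a ≤ r → ρ x b ≤ r → s x a b ≤ u x a b → c x a b ≤ u x a b →
    s (F x) (F a) (F b) ≤ κ * u (F x) (F a) (F b) ∧ c (F x) (F a) (F b) ≤ κ * u (F x) (F a) (F b) ∧
      u x a b ≤ κ * u (F x) (F a) (F b)
  cone_s : ∀ x a b, ρ x a ≤ r → ρ x b ≤ r → u x a b ≤ s x a b → c x a b ≤ s x a b →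
    u (F⁻¹ x) (F⁻¹ a) (F⁻¹ b) ≤ κ * s (F⁻¹ x) (F⁻¹ a) (F⁻¹ b) ∧
      c (F⁻¹ x) (F⁻¹ a) (F⁻¹ b) ≤ κ * s (F⁻¹ x) (F⁻¹ a) (F⁻¹ b) ∧
      s x a b ≤ κ * s (F⁻¹ x) (F⁻¹ a) (F⁻¹ b)

/-- The whole orbits of `x` and `y` stay `β`-close. -/
def OrbitClose {M : Type*} (F : Equiv.Perm M) (ρ : M → M → ℝ) (β : ℝ) (x y : M) : Prop :=
  ∀ k : ℤ, ρ ((F ^ k) x) ((F ^ k) y) ≤ β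

/-- `P η x y` means that `x` and `y` are joined by a central plaque of size `η`: plaques are
Lyapunov stable for `F` and `F⁻¹`, and the central component of a short difference can be
cancelled by moving along a plaque. -/
structure PlaqueSystem {M : Type*} (F : Equiv.Perm M) (ρ : M → M → ℝ) (s c u : M → M → M → ℝ)
    (P : ℝ → M → M → Prop) : Prop where
  mono : ∀ η η' x y, η ≤ η' → P η x y → P η' x y
  stable : ∀ β > 0, ∃ δ > 0, ∀ x y, P δ x y → OrbitClose F ρ β x y
  slide : ∀ η > 0, ∃ δ > 0, ∀ x y, ρ x y ≤ δ → ∃ x', P η x x' ∧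
    c x x' y ≤ 1 / 2 * max (s x x' y) (u x x' y)
  uniform : ∀ β > 0, ∃ δ > 0, ∀ x y, ρ x y ≤ δ → ρ (F x) (F y) ≤ β
  uniform_inv : ∀ β > 0, ∃ δ > 0, ∀ x y, ρ x y ≤ δ → ρ (F⁻¹ x) (F⁻¹ y) ≤ β

section dynamics
variable {M : Type*} {F : Equiv.Perm M} {ρ : M → M → ℝ} {s c u : M → M → M → ℝ} {r κ C : ℝ}
  {P : ℝ → M → M → Prop}

theorem OrbitClose.zpow {β : ℝ} {x y : M} (h : OrbitClose F ρ β x y) (k : ℤ) :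
    OrbitClose F ρ β ((F ^ k) x) ((F ^ k) y) := fun j => by
  simpa only [← Equiv.Perm.mul_apply, ← zpow_add] using h (j + k)

theorem OrbitClose.of_zpow {β : ℝ} {x y : M} (k : ℤ)
    (h : OrbitClose F ρ β ((F ^ k) x) ((F ^ k) y)) : OrbitClose F ρ β x y := by
  have := h.zpow (-k)
  simpa only [← Equiv.Perm.mul_apply, ← zpow_add, neg_add_cancel, zpow_zero,
    Equiv.Perm.one_apply] using this

theorem OrbitClose.inv {β : ℝ} {x y : M} (h : OrbitClose F ρ β x y) :
    OrbitClose F⁻¹ ρ β x y := fun k => by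
  simpa only [inv_zpow'] using h (-k)

theorem OrbitClose.mono {β β' : ℝ} {x y : M} (h : OrbitClose F ρ β x y) (hb : β ≤ β') :
    OrbitClose F ρ β' x y := fun k => (h k).trans hb

namespace ConeSystem

/-- Time reversal exchanges stable and unstable components, so each statement below about `u` and
the future also gives one about `s` and the past. -/
theorem symm (h : ConeSystem F ρ s c u r κ C) : ConeSystem F⁻¹ ρ u c s r κ C where
  r_pos := h.r_pos
  κ_pos := h.κ_pos
  κ_lt_one := h.κ_lt_one
  one_le_C := h.one_le_C
  ρ_comm := h.ρ_comm
  ρ_triangle := h.ρ_triangle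
  ρ_le := h.ρ_le
  ρ_self := h.ρ_self
  eq_of_ρ := h.eq_of_ρ
  s_nonneg := h.u_nonneg
  c_nonneg := h.c_nonneg
  u_nonneg := h.s_nonneg
  s_comm := h.u_comm
  c_comm := h.c_comm
  u_comm := h.s_comm
  s_triangle := h.u_triangle
  c_triangle := h.c_triangle
  u_triangle := h.s_triangle
  s_le := h.u_le
  c_le := h.c_le
  u_le := h.s_le
  ρ_le_max x a b ha hb := by
    have := h.ρ_le_max x a b ha hb
    rwa [max_comm, ← max_assoc, max_right_comm] at this
  cone_u := h.cone_s
  cone_s := by simpa only [inv_inv] using h.cone_u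

theorem u_self (h : ConeSystem F ρ s c u r κ C) (x a : M) : u x a a = 0 :=
  le_antisymm ((h.u_le x a a).trans (by rw [h.ρ_self, mul_zero])) (h.u_nonneg _ _ _)

theorem s_self (h : ConeSystem F ρ s c u r κ C) (x a : M) : s x a a = 0 := h.symm.u_self x a

theorem C_pos (h : ConeSystem F ρ s c u r κ C) : 0 < C := one_pos.trans_le h.one_le_C

theorem ρ_nonneg (h : ConeSystem F ρ s c u r κ C) (a b : M) : 0 ≤ ρ a b :=
  nonneg_of_mul_nonneg_right ((h.s_nonneg a a b).trans (h.s_le a a b)) h.C_pos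

/-- The cone condition reproduces itself, so it can be iterated. The strict factor `κ` on the other
two components needs at least one step, hence the clause guarded by `0 < m`. -/
theorem cone_u_iterate (h : ConeSystem F ρ s c u r κ C) {x a b : M} (hs : s x a b ≤ u x a b)
    (hc : c x a b ≤ u x a b) (m : ℕ)
    (hm : ∀ i < m, ρ ((F ^ i) x) ((F ^ i) a) ≤ r ∧ ρ ((F ^ i) x) ((F ^ i) b) ≤ r) :
    u x a b ≤ κ ^ m * u ((F ^ m) x) ((F ^ m) a) ((F ^ m) b) ∧
      s ((F ^ m) x) ((F ^ m) a) ((F ^ m) b) ≤ u ((F ^ m) x) ((F ^ m) a) ((F ^ m) b) ∧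
      c ((F ^ m) x) ((F ^ m) a) ((F ^ m) b) ≤ u ((F ^ m) x) ((F ^ m) a) ((F ^ m) b) ∧
      (0 < m → s ((F ^ m) x) ((F ^ m) a) ((F ^ m) b) ≤ κ * u ((F ^ m) x) ((F ^ m) a) ((F ^ m) b) ∧
        c ((F ^ m) x) ((F ^ m) a) ((F ^ m) b) ≤ κ * u ((F ^ m) x) ((F ^ m) a) ((F ^ m) b)) := by
  induction m with
  | zero => simpa using ⟨hs, hc⟩
  | succ m ih =>
    obtain ⟨h1, h2, h3, -⟩ := ih fun i hi => hm i (hi.trans (Nat.lt_succ_self m))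
    obtain ⟨h4, h5, h6⟩ := h.cone_u _ _ _ (hm m (Nat.lt_succ_self m)).1
      (hm m (Nat.lt_succ_self m)).2 h2 h3
    simp only [← Equiv.Perm.mul_apply, ← pow_succ'] at h4 h5 h6
    have hle : ∀ t, t ≤ κ * u ((F ^ (m + 1)) x) ((F ^ (m + 1)) a) ((F ^ (m + 1)) b) →
        t ≤ u ((F ^ (m + 1)) x) ((F ^ (m + 1)) a) ((F ^ (m + 1)) b) := fun t ht =>
      ht.trans (mul_le_of_le_one_left (h.u_nonneg _ _ _) h.κ_lt_one.le)
    refine ⟨h1.trans ?_, hle _ h4, hle _ h5, fun _ => ⟨h4, h5⟩⟩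
    rw [pow_succ, mul_assoc]
    exact mul_le_mul_of_nonneg_left h6 (pow_nonneg h.κ_pos.le _)

/-- An unstable difference would grow like `κ ^ (-m)` while `ρ ≤ C` keeps it bounded; so it
vanishes. -/
theorem eq_of_cone_u (h : ConeSystem F ρ s c u r κ C) {x a b : M} (ha : OrbitClose F ρ r x a)
    (hb : OrbitClose F ρ r x b) (hs : s x a b ≤ u x a b) (hc : c x a b ≤ u x a b) : a = b := by
  have h0 : u x a b ≤ 0 := by
    refine ge_of_tendsto' (x := Filter.atTop) (f := fun m : ℕ => κ ^ m * (C * C)) ?_ fun m => ?_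
    · simpa using (tendsto_pow_atTop_nhds_zero_of_lt_one h.κ_pos.le h.κ_lt_one).mul_const (C * C)
    · refine ((h.cone_u_iterate hs hc m fun i _ => ⟨?_, ?_⟩).1).trans ?_
      · simpa using ha i
      · simpa using hb i
      · exact mul_le_mul_of_nonneg_left ((h.u_le _ _ _).trans
          (mul_le_mul_of_nonneg_left (h.ρ_le _ _) h.C_pos.le)) (pow_nonneg h.κ_pos.le _)
  refine h.eq_of_ρ _ _ ((h.ρ_le_max x a b (by simpa using ha 0) (by simpa using hb 0)).trans ?_)
  exact mul_nonpos_of_nonneg_of_nonpos h.C_pos.le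
    (max_le (max_le (hs.trans h0) (hc.trans h0)) h0)

/-- If the stable or the unstable part were dominant, expansion under `F⁻¹` or `F` would force `a =
b`. -/
theorem cone_c (h : ConeSystem F ρ s c u r κ C) {x a b : M} (ha : OrbitClose F ρ r x a)
    (hb : OrbitClose F ρ r x b) : s x a b ≤ c x a b ∧ u x a b ≤ c x a b := by
  by_cases hab : a = b
  · subst hab
    rw [h.s_self, h.u_self]
    exact ⟨h.c_nonneg _ _ _, h.c_nonneg _ _ _⟩
  · have h1 : ¬ (s x a b ≤ u x a b ∧ c x a b ≤ u x a b) := fun hh =>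
      hab (h.eq_of_cone_u ha hb hh.1 hh.2)
    have h2 : ¬ (u x a b ≤ s x a b ∧ c x a b ≤ s x a b) := fun hh =>
      hab (h.symm.eq_of_cone_u ha.inv hb.inv hh.1 hh.2)
    grind

/-- Local uniqueness of plaques: among points shadowing `x`, the central position determines the
point. All later uniqueness and continuity arguments rest on this. -/
theorem eq_of_c_small (h : ConeSystem F ρ s c u r κ C) {x a b : M} (ha : OrbitClose F ρ r x a)
    (hb : OrbitClose F ρ r x b) (hc : c x a b ≤ 1 / 2 * max (s x a b) (u x a b)) : a = b := by
  rcases le_total (s x a b) (u x a b) with hsu | hsu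
  · refine h.eq_of_cone_u ha hb hsu (hc.trans ?_)
    rw [max_eq_right hsu]
    linarith [h.u_nonneg x a b]
  · refine h.symm.eq_of_cone_u ha.inv hb.inv hsu (hc.trans ?_)
    rw [max_eq_left hsu]
    linarith [h.s_nonneg x a b]

end ConeSystem

namespace PlaqueSystem

theorem symm (h : PlaqueSystem F ρ s c u P) : PlaqueSystem F⁻¹ ρ u c s P where
  mono := h.mono
  stable β hβ := by
    obtain ⟨δ, hδ, H⟩ := h.stable β hβ
    exact ⟨δ, hδ, fun x y hxy => (H x y hxy).inv⟩
  slide η hη := by simpa only [max_comm] using h.slide η hη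
  uniform := h.uniform_inv
  uniform_inv := by simpa only [inv_inv] using h.uniform

/-- Slide from `x` until the central part of the difference with `y` cancels. The point reached
shadows `x` by stability, so it is `y`. -/
theorem plaque_of_orbitClose (h : ConeSystem F ρ s c u r κ C) (hP : PlaqueSystem F ρ s c u P)
    {η : ℝ} (hη : 0 < η) : ∃ δ > 0, ∀ x y, OrbitClose F ρ r x y → ρ x y ≤ δ → P η x y := by
  obtain ⟨δ, hδ, hst⟩ := hP.stable r h.r_pos
  obtain ⟨δ', hδ', hsl⟩ := hP.slide (min η δ) (lt_min hη hδ)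
  refine ⟨δ', hδ', fun x y hxy hd => ?_⟩
  obtain ⟨x', hx', hc⟩ := hsl x y hd
  have : x' = y := h.eq_of_c_small (hst x x' (hP.mono _ _ _ _ (min_le_right _ _) hx')) hxy hc
  exact this ▸ hP.mono _ _ _ _ (min_le_left _ _) hx'

/-- A bootstrap: orbit-closeness at the fixed scale `r`, together with closeness at a single time,
improves to any scale, since the two points then lie in a short plaque. -/
theorem orbitClose_of_orbitClose (h : ConeSystem F ρ s c u r κ C)
    (hP : PlaqueSystem F ρ s c u P) {β : ℝ} (hβ : 0 < β) :
    ∃ δ > 0, ∀ x y, OrbitClose F ρ r x y → ρ x y ≤ δ → OrbitClose F ρ β x y := by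
  obtain ⟨η, hη, hst⟩ := hP.stable β hβ
  obtain ⟨δ, hδ, H⟩ := hP.plaque_of_orbitClose h hη
  exact ⟨δ, hδ, fun x y hxy hd => hst x y (H x y hxy hd)⟩

/-- Moving along the plaque of `x` so that the central component vanishes at a given time, the
difference with `y` becomes either stable, so that it was small at all times up to then
(in comparison with the initial distance), or unstable. -/
theorem exists_slide (h : ConeSystem F ρ s c u r κ C) (hP : PlaqueSystem F ρ s c u P) :
    ∃ a₀ > 0, a₀ ≤ r ∧ ∀ x y : M, ∀ j m : ℕ,
      (∀ i ≤ j + m, ρ ((F ^ i) x) ((F ^ i) y) ≤ a₀) → ∃ z, OrbitClose F ρ r x z ∧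
        ((∀ i ≤ m, ρ ((F ^ (j + i)) z) ((F ^ (j + i)) y) ≤ C ^ 3 * κ ^ (m - i)) ∨
         (0 < j → ρ x z ≤ 3 * C ^ 2 / (1 - κ) * ρ x y ∧
          ρ ((F ^ j) z) ((F ^ j) y) ≤ 3 * C ^ 2 / (1 - κ) * ρ x y)) := by
  obtain ⟨η, hη, hst⟩ := hP.stable r h.r_pos
  obtain ⟨δ, hδ, hsl⟩ := hP.slide η hη
  refine ⟨min δ r, lt_min hδ h.r_pos, min_le_right _ _, fun x y j m hxy => ?_⟩
  obtain ⟨w, hw, hc⟩ := hsl ((F ^ j) x) ((F ^ j) y)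
    ((hxy j (Nat.le_add_right _ _)).trans (min_le_left _ _))
  obtain ⟨z, rfl⟩ := (F ^ j).surjective w
  have hz : OrbitClose F ρ r x z := OrbitClose.of_zpow (j : ℤ) (by simpa using hst _ _ hw)
  have hyr : ∀ i ≤ j + m, ρ ((F ^ i) x) ((F ^ i) y) ≤ r := fun i hi =>
    (hxy i hi).trans (min_le_right _ _)
  have hzr : ∀ i : ℕ, ρ ((F ^ i) x) ((F ^ i) z) ≤ r := fun i => by simpa using hz i
  have hC := h.C_pos
  have hκ := h.κ_pos
  have hκ' : 0 < 1 - κ := sub_pos.2 h.κ_lt_one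
  refine ⟨z, hz, ?_⟩
  rcases le_total (s ((F ^ j) x) ((F ^ j) z) ((F ^ j) y)) (u ((F ^ j) x) ((F ^ j) z) ((F ^ j) y))
    with hsu | hsu
  -- Unstable case: the difference expands up to time `j + m`, where its unstable part is at most `C
  -- * C`; one more `C` compares it with `ρ`.
  · left
    rw [max_eq_right hsu] at hc
    have hc' : c ((F ^ j) x) ((F ^ j) z) ((F ^ j) y) ≤ u ((F ^ j) x) ((F ^ j) z) ((F ^ j) y) := by
      linarith [h.u_nonneg ((F ^ j) x) ((F ^ j) z) ((F ^ j) y)]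
    intro i hi
    have e : ∀ (i : ℕ) (p : M), (F ^ i) ((F ^ j) p) = (F ^ (j + i)) p := fun i p => by
      rw [← Equiv.Perm.mul_apply, ← pow_add, add_comm]
    obtain ⟨-, h2, h3, -⟩ := h.cone_u_iterate hsu hc' i fun l hl => by
      rw [e, e, e]; exact ⟨hzr _, hyr _ (by omega)⟩
    have e' : ∀ p : M, (F ^ (m - i)) ((F ^ i) ((F ^ j) p)) = (F ^ (j + m)) p := fun p => by
      rw [← Equiv.Perm.mul_apply, ← Equiv.Perm.mul_apply, ← pow_add, ← pow_add]; congr 2; omega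
    obtain ⟨h4, -⟩ := h.cone_u_iterate h2 h3 (m - i) fun l hl => by
      have e'' : ∀ p : M, (F ^ l) ((F ^ i) ((F ^ j) p)) = (F ^ (j + (i + l))) p := fun p => by
        rw [e, ← Equiv.Perm.mul_apply, ← pow_add]; congr 2; omega
      rw [e'', e'', e'']; exact ⟨hzr _, hyr _ (by omega)⟩
    simp only [e'] at h4
    simp only [e] at h2 h3 h4
    have h5 := h.ρ_le_max _ _ _ (hzr (j + i)) (hyr (j + i) (by omega))
    rw [max_eq_right (max_le h2 h3)] at h5
    calc _ ≤ C * _ := h5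
      _ ≤ C * (κ ^ (m - i) * (C * C)) := mul_le_mul_of_nonneg_left (h4.trans
          (mul_le_mul_of_nonneg_left ((h.u_le _ _ _).trans
            (mul_le_mul_of_nonneg_left (h.ρ_le _ _) hC.le)) (pow_nonneg hκ.le _))) hC.le
      _ = _ := by ring
  -- Stable case: going back to time `0`, the difference of `z` and `y` gains the strict cone
  -- condition `c ≤ κ * s`, provided `0 < j`.
  · right
    intro hj
    rw [max_eq_left hsu] at hc
    have hc' : c ((F ^ j) x) ((F ^ j) z) ((F ^ j) y) ≤ s ((F ^ j) x) ((F ^ j) z) ((F ^ j) y) := by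
      linarith [h.s_nonneg ((F ^ j) x) ((F ^ j) z) ((F ^ j) y)]
    have e : ∀ i ≤ j, ∀ p : M, (F⁻¹ ^ i) ((F ^ j) p) = (F ^ (j - i)) p := fun i hi p => by
      rw [← Equiv.Perm.mul_apply]
      congr 1
      rw [inv_pow, inv_mul_eq_iff_eq_mul, ← pow_add]
      congr 1; omega
    have := h.symm.cone_u_iterate hsu hc' j fun l hl => by
      rw [e l hl.le, e l hl.le, e l hl.le]; exact ⟨hzr _, hyr _ (by omega)⟩
    simp only [e j le_rfl, Nat.sub_self, pow_zero, Equiv.Perm.one_apply] at this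
    obtain ⟨h1, -, -, h2⟩ := this
    obtain ⟨h3, h4⟩ := h2 hj
    have h5 := (h.cone_c (x := x) (a := x) (b := z)
      (fun k => by rw [h.ρ_self]; exact h.r_pos.le) hz)
    have hs1 : s x z y ≤ s x x z + C * ρ x y := by
      have := h.s_triangle x z y x
      rw [h.s_comm x z x] at this
      linarith [h.s_le x x y]
    have hc1 : c x x z ≤ c x z y + C * ρ x y := by
      have := h.c_triangle x x z y
      rw [h.c_comm x y z] at this
      linarith [h.c_le x x y]
    -- As `x` and `z` differ centrally, `s x z y ≤ c x x z + C * ρ x y ≤ c x z y + 2 * C * ρ x y ≤ κ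
    -- * s x z y + 2 * C * ρ x y`, and `κ < 1` closes the loop.
    have hs0 : s x z y ≤ 2 * C * ρ x y / (1 - κ) := by
      rw [le_div_iff₀ hκ']
      linarith [h5.1]
    have hρ := h.ρ_nonneg x y
    have hle : κ ^ j ≤ 1 := pow_le_one₀ hκ.le h.κ_lt_one.le
    constructor
    · have h6 := h.ρ_le_max x x z (by rw [h.ρ_self]; exact h.r_pos.le) (by simpa using hz 0)
      rw [max_eq_right h5.1, max_eq_left h5.2] at h6
      have : c x x z ≤ 3 * C * ρ x y / (1 - κ) := by
        rw [le_div_iff₀ hκ'] at hs0 ⊢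
        have := h.s_nonneg x z y
        have := mul_nonneg hC.le hρ
        nlinarith
      calc _ ≤ C * c x x z := h6
        _ ≤ C * (3 * C * ρ x y / (1 - κ)) := mul_le_mul_of_nonneg_left this hC.le
        _ = _ := by ring
    · have h6 := h.ρ_le_max _ _ _ (hzr j) (hyr j (Nat.le_add_right _ _))
      rw [max_right_comm, max_eq_left hsu, max_eq_left hc'] at h6
      calc _ ≤ C * _ := h6
        _ ≤ C * (1 * s x z y) := mul_le_mul_of_nonneg_left (h1.trans
          (mul_le_mul_of_nonneg_right hle (h.s_nonneg _ _ _))) hC.le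
        _ ≤ C * (1 * (2 * C * ρ x y / (1 - κ))) := by gcongr
        _ = 2 * (C ^ 2 / (1 - κ) * ρ x y) := by ring
        _ ≤ 3 * (C ^ 2 / (1 - κ) * ρ x y) := by
          have : 0 ≤ C ^ 2 / (1 - κ) * ρ x y := by positivity
          linarith
        _ = _ := by ring

/-- At each time `j ≤ N` apply `exists_slide`. The unstable alternative gives a point shadowing `x`
that is close to `y` on the whole interval from `j` to `N`; the stable one keeps `x` and `y` close
at time `j`. Comparing at the first time when the unstable alternative holds gives the result. The
extra `K` times are the room needed for expansion. -/
theorem exists_halving (h : ConeSystem F ρ s c u r κ C) (hP : PlaqueSystem F ρ s c u P) :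
    ∃ a₀ > 0, a₀ ≤ r ∧ ∀ a > 0, a ≤ a₀ → ∃ K : ℕ, ∃ δ > 0, ∀ x y : M, ∀ N : ℕ, ρ x y ≤ δ →
      (∀ i ≤ N + K, ρ ((F ^ i) x) ((F ^ i) y) ≤ a) → ρ ((F ^ N) x) ((F ^ N) y) ≤ a / 2 := by
  obtain ⟨a₀, ha₀, ha₀r, H⟩ := hP.exists_slide h
  refine ⟨a₀, ha₀, ha₀r, fun a ha haa => ?_⟩
  have hC := h.C_pos
  have hκ := h.κ_pos
  have hκ' : 0 < 1 - κ := sub_pos.2 h.κ_lt_one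
  obtain ⟨r₂, hr₂, H₂⟩ := hP.orbitClose_of_orbitClose h (β := a / 4) (by linarith)
  obtain ⟨δ₃, hδ₃, H₃⟩ := hP.uniform (r₂ / 2) (by linarith)
  -- After `K` steps of expansion inside a bounded region, the earlier difference was at most this
  -- small.
  obtain ⟨K, hK⟩ : ∃ K : ℕ, C ^ 3 * κ ^ K ≤ min (r₂ / 2) (a / 4) := by
    have := (tendsto_pow_atTop_nhds_zero_of_lt_one hκ.le h.κ_lt_one).const_mul (C ^ 3)
    rw [mul_zero] at this
    have hm : 0 < min (r₂ / 2) (a / 4) := lt_min (by linarith) (by linarith)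
    exact ((this.eventually (gt_mem_nhds hm)).exists).imp fun _ hh => hh.le
  -- `2 * β` is at most `a / 2`, the desired conclusion, and at most `δ₃`, so that one further
  -- iterate stays below `r₂ / 2`.
  set β := min (δ₃ / 2) (a / 4) with hβd
  have hβ : 0 < β := lt_min (by linarith) (by linarith)
  obtain ⟨r₁, hr₁, H₁⟩ := hP.orbitClose_of_orbitClose h hβ
  set A := 3 * C ^ 2 / (1 - κ) with hA
  have hA0 : 0 < A := by positivity
  refine ⟨K, min (min r₁ β / A) (min (r₂ / 2) β), by positivity, fun x y N hd hxy => ?_⟩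
  have hd1 : A * ρ x y ≤ min r₁ β := by
    rw [mul_comm, ← le_div_iff₀ hA0]; exact hd.trans (min_le_left _ _)
  have hd2 : ρ x y ≤ r₂ / 2 := hd.trans ((min_le_right _ _).trans (min_le_left _ _))
  have hd3 : ρ x y ≤ β := hd.trans ((min_le_right _ _).trans (min_le_right _ _))
  have hβ1 : β ≤ δ₃ / 2 := min_le_left _ _
  have hβ2 : β ≤ a / 4 := min_le_right _ _
  have key : ∀ j ≤ N, (∃ z, OrbitClose F ρ r x z ∧
      ∀ i, j ≤ i → i ≤ N → ρ ((F ^ i) z) ((F ^ i) y) ≤ C ^ 3 * κ ^ K) ∨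
      ρ ((F ^ j) x) ((F ^ j) y) ≤ 2 * β := by
    intro j hj
    obtain ⟨z, hz, hB | hA⟩ := H x y j (N - j + K) fun i hi => (hxy i (by omega)).trans haa
    · left
      refine ⟨z, hz, fun i hji hiN => ?_⟩
      have := hB (i - j) (by omega)
      rw [Nat.add_sub_cancel' hji] at this
      exact this.trans (mul_le_mul_of_nonneg_left
        (pow_le_pow_of_le_one hκ.le h.κ_lt_one.le (by omega)) (by positivity))
    · right
      rcases Nat.eq_zero_or_pos j with rfl | hj0
      · simpa using by linarith
      · obtain ⟨h1, h2⟩ := hA hj0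
        have h3 := H₁ x z hz (h1.trans (hd1.trans (min_le_left _ _))) j
        have h4 := h.ρ_triangle ((F ^ j) x) ((F ^ j) y) ((F ^ j) z)
        have h5 := h2.trans (hd1.trans (min_le_right _ _))
        simp only [zpow_natCast] at h3
        linarith
  rcases key N le_rfl with hN | hN
  swap
  · linarith
  classical
  -- `p j`: some point shadowing `x` follows `y` from time `j` up to time `N`. The least such `j` is
  -- used.
  let p : ℕ → Prop := fun j => ∃ z, OrbitClose F ρ r x z ∧
      ∀ i, j ≤ i → i ≤ N → ρ ((F ^ i) z) ((F ^ i) y) ≤ C ^ 3 * κ ^ K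
  have hp : ∃ j, p j := ⟨N, hN⟩
  obtain ⟨z, hz, hzB⟩ := Nat.find_spec hp
  have hjN : Nat.find hp ≤ N := Nat.find_min' hp hN
  have hmin : ∀ j < Nat.find hp, ¬ p j := fun j => Nat.find_min hp
  set j := Nat.find hp
  have hν1 : C ^ 3 * κ ^ K ≤ r₂ / 2 := hK.trans (min_le_left _ _)
  have hν2 : C ^ 3 * κ ^ K ≤ a / 4 := hK.trans (min_le_right _ _)
  have hxyj : ρ ((F ^ j) x) ((F ^ j) y) ≤ r₂ / 2 := by
    rcases Nat.eq_zero_or_pos j with hj | hj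
    · rw [hj]; simpa using hd2
    -- By minimality the other alternative holds at time `j - 1`, so `x` and `y` are `2 * β`-close
    -- there, and uniform continuity carries this to time `j`.
    · obtain ⟨i, hi⟩ : ∃ i, j = i + 1 := ⟨j - 1, by omega⟩
      have := (key i (by omega)).resolve_left (hmin i (by omega))
      rw [hi, pow_succ']
      exact H₃ _ _ (by linarith)
  have hxz : ρ ((F ^ j) x) ((F ^ j) z) ≤ r₂ := by
    have h1 := h.ρ_triangle ((F ^ j) x) ((F ^ j) z) ((F ^ j) y)
    have h2 := hzB j le_rfl hjN
    rw [h.ρ_comm] at h2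
    linarith
  have hcl : OrbitClose F ρ (a / 4) x z := OrbitClose.of_zpow (j : ℤ)
    (H₂ _ _ (hz.zpow j) (by simpa using hxz))
  have h1 := hcl N
  have h2 := hzB N hjN le_rfl
  have h3 := h.ρ_triangle ((F ^ N) x) ((F ^ N) y) ((F ^ N) z)
  simp only [zpow_natCast] at h1
  linarith

/-- Two sequences whose jumps stay small under all iterates, and which stay close to each other,
start at points whose forward orbits are close. -/
theorem forward_close (h : ConeSystem F ρ s c u r κ C) {a δ : ℝ} {K : ℕ} (ha : 0 < a)
    (hδ : 0 < δ) (H : ∀ x y : M, ∀ N : ℕ, ρ x y ≤ δ →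
      (∀ i ≤ N + K, ρ ((F ^ i) x) ((F ^ i) y) ≤ a) → ρ ((F ^ N) x) ((F ^ N) y) ≤ a / 2) :
    ∃ ε > 0, ∀ x y : ℤ → M, (∀ (m : ℤ) (k : ℕ), ρ ((F ^ (k + 1)) (x m)) ((F ^ k) (x (m + 1))) ≤ ε) →
      (∀ (m : ℤ) (k : ℕ), ρ ((F ^ (k + 1)) (y m)) ((F ^ k) (y (m + 1))) ≤ ε) →
      (∀ m, ρ (x m) (y m) ≤ ε) → ∀ i : ℕ, ρ ((F ^ i) (x 0)) ((F ^ i) (y 0)) ≤ a := by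
  refine ⟨min δ (a / (8 * (K + 1))), by positivity, fun x y hx hy hxy => ?_⟩
  set ε := min δ (a / (8 * (K + 1))) with hε
  have hε0 : 0 < ε := by positivity
  have hεa : 8 * ((K + 1) * ε) ≤ a := by
    have : ε ≤ a / (8 * (K + 1)) := min_le_right _ _
    rw [le_div_iff₀ (by positivity)] at this
    linarith
  -- Telescoping: `J` jumps, each seen after some iterates, cost at most `J * ε`.
  have tel : ∀ x : ℤ → M,
      (∀ (m : ℤ) (k : ℕ), ρ ((F ^ (k + 1)) (x m)) ((F ^ k) (x (m + 1))) ≤ ε) →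
      ∀ (J : ℕ) (m : ℤ) (k : ℕ), ρ ((F ^ (k + J)) (x m)) ((F ^ k) (x (m + J))) ≤ J * ε := by
    intro x hx J
    induction J with
    | zero => intro m k; simp [h.ρ_self]
    | succ J ih =>
      intro m k
      have h1 := ih m (k + 1)
      have h2 := hx (m + J) k
      have h3 := h.ρ_triangle ((F ^ (k + (J + 1))) (x m)) ((F ^ k) (x (m + (J + 1 : ℕ))))
        ((F ^ (k + 1)) (x (m + J)))
      rw [show k + (J + 1) = k + 1 + J by ring] at h3 ⊢
      rw [Nat.cast_add, Nat.cast_one, ← add_assoc] at h3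
      rw [Nat.cast_add (R := ℤ), Nat.cast_one, ← add_assoc, Nat.cast_succ (R := ℝ)]
      linarith
  have tri : ∀ (J : ℕ), J ≤ K + 1 → ∀ (m : ℤ) (k : ℕ),
      |ρ ((F ^ (k + J)) (x m)) ((F ^ (k + J)) (y m)) -
        ρ ((F ^ k) (x (m + J))) ((F ^ k) (y (m + J)))| ≤ a / 4 := by
    intro J hJ m k
    have h1 := tel x hx J m k
    have h2 := tel y hy J m k
    have h3 : (J : ℝ) * ε ≤ (K + 1) * ε :=
      mul_le_mul_of_nonneg_right (by exact_mod_cast hJ) hε0.le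
    have t := h.ρ_triangle
    have e := h.ρ_comm
    rw [abs_le]
    constructor
    · have := t ((F ^ k) (x (m + J))) ((F ^ k) (y (m + J))) ((F ^ (k + J)) (x m))
      have := t ((F ^ (k + J)) (x m)) ((F ^ k) (y (m + J))) ((F ^ (k + J)) (y m))
      rw [e] at h1
      linarith
    · have := t ((F ^ (k + J)) (x m)) ((F ^ (k + J)) (y m)) ((F ^ k) (x (m + J)))
      have := t ((F ^ k) (x (m + J))) ((F ^ (k + J)) (y m)) ((F ^ k) (y (m + J)))
      rw [e] at h2
      linarith
  suffices hmain : ∀ (N : ℕ) (m : ℤ), ρ ((F ^ N) (x m)) ((F ^ N) (y m)) ≤ a from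
    fun i => hmain i 0
  intro N
  induction N using Nat.strong_induction_on with
  | _ N ih =>
    intro m
    rcases le_or_gt N (K + 1) with hN | hN
    · have := tri N hN m 0
      have h1 : ρ (x (m + N)) (y (m + N)) ≤ ε := hxy _
      have h2 : (0 : ℝ) ≤ K * ε := by positivity
      simp only [zero_add, pow_zero, Equiv.Perm.one_apply] at this
      linarith [(abs_le.1 this).2]
    -- Move the start `K + 1` places along the sequences, at a cost of `a / 4`. Closeness up to time
    -- `i + K < N` is the induction hypothesis, and the halving hypothesis `H` then gives `a / 2` at
    -- time `i`.
    · obtain ⟨i, rfl⟩ : ∃ i, N = i + (K + 1) := ⟨N - (K + 1), by omega⟩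
      have h1 := tri (K + 1) le_rfl m i
      have h2 := H (x (m + (K + 1 : ℕ))) (y (m + (K + 1 : ℕ))) i
        ((hxy _).trans (min_le_left _ _)) fun l hl => ih l (by omega) _
      linarith [(abs_le.1 h1).2]

/-- Plaque expansiveness for a Lyapunov stable plaque system. -/
theorem expansive (h : ConeSystem F ρ s c u r κ C) (hP : PlaqueSystem F ρ s c u P) {η : ℝ}
    (hη : 0 < η) : ∃ ε > 0, ∀ x y : ℤ → M,
      (∀ m, OrbitClose F ρ ε (F (x m)) (x (m + 1))) →
      (∀ m, OrbitClose F ρ ε (F (y m)) (y (m + 1))) →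
      (∀ m, ρ (x m) (y m) ≤ ε) → P η (y 0) (x 0) := by
  obtain ⟨a₁, ha₁, har₁, H₁⟩ := hP.exists_halving h
  obtain ⟨a₂, ha₂, har₂, H₂⟩ := hP.symm.exists_halving h.symm
  obtain ⟨K₁, δ₁, hδ₁, H₁⟩ := H₁ _ (lt_min ha₁ ha₂) (min_le_left _ _)
  obtain ⟨K₂, δ₂, hδ₂, H₂⟩ := H₂ _ (lt_min ha₁ ha₂) (min_le_right _ _)
  obtain ⟨ε₁, hε₁, E₁⟩ := forward_close h (lt_min ha₁ ha₂) hδ₁ H₁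
  obtain ⟨ε₂, hε₂, E₂⟩ := forward_close h.symm (lt_min ha₁ ha₂) hδ₂ H₂
  obtain ⟨δ, hδ, L⟩ := hP.plaque_of_orbitClose h hη
  refine ⟨min δ (min ε₁ ε₂), by positivity, fun x y hx hy hxy => ?_⟩
  have le1 : min δ (min ε₁ ε₂) ≤ ε₁ := (min_le_right _ _).trans (min_le_left _ _)
  have le2 : min δ (min ε₁ ε₂) ≤ ε₂ := (min_le_right _ _).trans (min_le_right _ _)
  have fwd : ∀ x : ℤ → M, (∀ m, OrbitClose F ρ (min δ (min ε₁ ε₂)) (F (x m)) (x (m + 1))) →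
      ∀ (m : ℤ) (k : ℕ), ρ ((F ^ (k + 1)) (x m)) ((F ^ k) (x (m + 1))) ≤ ε₁ := by
    intro x hx m k
    have := (hx m k).trans le1
    rwa [zpow_natCast, ← Equiv.Perm.mul_apply, ← pow_succ] at this
  -- For the past the sequences are read backwards: the jump from index `-(m + 1)` to `-m`, iterated
  -- `-(k + 1)` times, is a jump for `F⁻¹`.
  have bwd : ∀ x : ℤ → M, (∀ m, OrbitClose F ρ (min δ (min ε₁ ε₂)) (F (x m)) (x (m + 1))) →
      ∀ (m : ℤ) (k : ℕ), ρ ((F⁻¹ ^ (k + 1)) (x (-m))) ((F⁻¹ ^ k) (x (-(m + 1)))) ≤ ε₂ := by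
    intro x hx m k
    have := (hx (-(m + 1)) (-(k + 1))).trans le2
    rw [h.ρ_comm, ← Equiv.Perm.mul_apply, show -(m + 1) + 1 = -m by ring, ← zpow_add_one,
      show (-((k : ℤ) + 1) + 1) = -k by ring, zpow_neg, zpow_neg, zpow_natCast] at this
    rw [inv_pow, inv_pow]
    exact_mod_cast this
  have hf := E₁ x y (fwd x hx) (fwd y hy) fun m => (hxy m).trans le1
  have hb := E₂ (fun m => x (-m)) (fun m => y (-m)) (bwd x hx) (bwd y hy)
    fun m => (hxy (-m)).trans le2
  refine L _ _ (fun k => ?_) ?_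
  · rw [h.ρ_comm]
    refine le_trans ?_ ((min_le_left a₁ a₂).trans har₁)
    obtain ⟨i, rfl | rfl⟩ := k.eq_nat_or_neg
    · simpa using hf i
    · simpa [inv_pow] using hb i
  · rw [h.ρ_comm]
    exact (hxy 0).trans (min_le_left _ _)

end PlaqueSystem
end dynamics

/-! ### Peano existence theorem. -/

open Filter Metric in
/-- **Peano existence theorem**: a continuous vector field on a closed ball, of norm less than
the radius, has an integral curve on `[0, 1]` starting at the centre. -/
theorem exists_integralCurve_of_continuousOn {E : Type*} [NormedAddCommGroup E] [NormedSpace ℝ E]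
    [FiniteDimensional ℝ E] {X : E → E} {y₀ : E} {R C : ℝ} (hX : ContinuousOn X (closedBall y₀ R))
    (hC : ∀ y ∈ closedBall y₀ R, ‖X y‖ ≤ C) (hC0 : 0 ≤ C) (hCR : C < R) :
    ∃ c v : ℝ → E, Continuous v ∧ (∀ t, HasDerivAt c (v t) t) ∧ c 0 = y₀ ∧
      ∀ t ∈ Icc (0 : ℝ) 1, c t ∈ closedBall y₀ R ∧ v t = X (c t) := by
  obtain ⟨X', hX'⟩ := ContinuousMap.exists_restrict_eq (isClosed_closedBall (x := y₀) (ε := R))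
    ⟨_, hX.domRestrict⟩
  have hXX : ∀ y ∈ closedBall y₀ R, X' y = X y := fun y hy =>
    DFunLike.congr_fun hX' (⟨y, hy⟩ : closedBall y₀ R)
  have hR : 0 < R := hC0.trans_lt hCR
  -- Approximate a continuous extension of `X` by `C¹` fields with error at most `R - C`. They have
  -- norm at most `R` on the ball, so Picard-Lindelöf solves them up to time `1`, and Arzelà-Ascoli
  -- yields a limit.
  have happ : ∀ n : ℕ, ∃ g : E → E, ContDiff ℝ 1 g ∧
      ∀ y, dist (g y) (X' y) < (R - C) * (1 / ((n : ℝ) + 1)) := by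
    intro n
    obtain ⟨g, hg, hd, -⟩ := X'.continuous.exists_contDiff_approx 1
      (continuous_const (y := (R - C) * (1 / ((n : ℝ) + 1))))
      fun _ => mul_pos (sub_pos.2 hCR) Nat.one_div_pos_of_nat
    exact ⟨g, hg, hd⟩
  choose g hg hgd using happ
  have hgR : ∀ n, ∀ y ∈ closedBall y₀ R, ‖g n y‖ ≤ R := by
    intro n y hy
    have h1 := (hgd n y).le
    have h2 : (R - C) * (1 / ((n : ℝ) + 1)) ≤ (R - C) * 1 := by
      refine mul_le_mul_of_nonneg_left ?_ (sub_pos.2 hCR).le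
      rw [div_le_one (by positivity)]
      linarith [Nat.cast_nonneg (α := ℝ) n]
    have h3 := hC y hy
    rw [← hXX y hy] at h3
    rw [dist_eq_norm] at h1
    linarith [norm_sub_norm_le (g n y) (X' y)]
  let t₀ : Icc (0 : ℝ) 1 := ⟨0, by simp⟩
  have hy₀ : y₀ ∈ closedBall y₀ ((0 : NNReal) : ℝ) := by simp
  have hsol : ∀ n, ∃ α : ODE.FunSpace t₀ y₀ 0 ⟨R, hR.le⟩,
      (∀ t, α.toFun t ∈ closedBall y₀ R) ∧
      ∀ t : Icc (0 : ℝ) 1, α.toFun t = y₀ + ∫ τ in (0 : ℝ)..t, g n (α.compProj τ) := by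
    intro n
    obtain ⟨K, hK⟩ := ((hg n).contDiffOn (s := closedBall y₀ R)).exists_lipschitzOnWith one_ne_zero
      (convex_closedBall _ _) (isCompact_closedBall _ _)
    have hPL : IsPicardLindelof (fun _ => g n) t₀ y₀ ⟨R, hR.le⟩ 0 ⟨R, hR.le⟩ K :=
      .of_time_independent (hgR n) hK (by simp [t₀])
    obtain ⟨α, hα⟩ := ODE.FunSpace.exists_isFixedPt_next hPL hy₀
    exact ⟨α, fun t => α.mem_closedBall hPL.mul_max_le,
      fun t => (ODE.FunSpace.isFixedPt_next_iff hPL hy₀).1 hα t⟩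
  choose α hαR hα using hsol
  let b : ℕ → BoundedContinuousFunction (Icc (0 : ℝ) 1) E := fun n =>
    BoundedContinuousFunction.mkOfCompact (α n).toContinuousMap
  have hcomp : IsCompact (closure (range b)) := by
    refine BoundedContinuousFunction.arzela_ascoli (closedBall y₀ R) (isCompact_closedBall _ _) _
      ?_ ?_
    · rintro _ t ⟨n, rfl⟩
      exact hαR n t
    · refine LipschitzWith.uniformEquicontinuous _ ⟨R, hR.le⟩ ?_ |>.equicontinuous
      rintro ⟨_, n, rfl⟩
      exact (α n).lipschitzWith
  obtain ⟨β, -, ψ, hψ, hlim⟩ := hcomp.tendsto_subseq fun n => subset_closure (mem_range_self n)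
  have hpt : ∀ t, Tendsto (fun n => (α (ψ n)).toFun t) atTop (𝓝 (β t)) := fun t =>
    ((BoundedContinuousFunction.tendsto_iff_tendstoUniformly.1 hlim).tendsto_at t)
  have hβR : ∀ t, β t ∈ closedBall y₀ R := fun t =>
    isClosed_closedBall.mem_of_tendsto (hpt t) (Eventually.of_forall fun n => hαR _ t)
  -- Extending by constants outside `[0, 1]` makes the integral below differentiable on both sides
  -- at every time, endpoints included.
  let β' : ℝ → E := fun t => β (projIcc 0 1 zero_le_one t)
  have hβ' : Continuous β' := β.continuous.comp continuous_projIcc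
  have hint : ∀ t : Icc (0 : ℝ) 1, β t = y₀ + ∫ τ in (0 : ℝ)..t, X' (β' τ) := by
    intro t
    have h1 : Tendsto (fun n => y₀ + ∫ τ in (0 : ℝ)..t, g (ψ n) ((α (ψ n)).compProj τ)) atTop
        (𝓝 (y₀ + ∫ τ in (0 : ℝ)..t, X' (β' τ))) := by
      refine Tendsto.const_add _ ?_
      refine intervalIntegral.tendsto_integral_filter_of_dominated_convergence (fun _ => R) ?_ ?_
        intervalIntegrable_const ?_
      · exact Eventually.of_forall fun n => ((hg (ψ n)).continuous.comp
          (α (ψ n)).continuous_compProj).aestronglyMeasurable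
      · exact Eventually.of_forall fun n => Eventually.of_forall fun τ _ => hgR _ _ (hαR _ _)
      · refine Eventually.of_forall fun τ _ => ?_
        have h2 : Tendsto (fun n => X' ((α (ψ n)).compProj τ)) atTop (𝓝 (X' (β' τ))) :=
          (X'.continuous.tendsto _).comp (hpt _)
        have h3 : Tendsto (fun n => dist (X' ((α (ψ n)).compProj τ))
            (g (ψ n) ((α (ψ n)).compProj τ))) atTop (𝓝 0) := by
          have h4 : Tendsto (fun n => (R - C) * (1 / (((ψ n : ℕ) : ℝ) + 1))) atTop (𝓝 0) := by
            simpa using (tendsto_one_div_add_atTop_nhds_zero_nat.comp hψ.tendsto_atTop).const_mul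
              (R - C)
          refine squeeze_zero (fun _ => dist_nonneg) (fun n => ?_) h4
          rw [dist_comm]
          exact (hgd _ _).le
        exact (tendsto_iff_of_dist h3).1 h2
    refine tendsto_nhds_unique (hpt t) (h1.congr fun n => ?_)
    exact (hα (ψ n) t).symm
  have hv : Continuous fun t => X' (β' t) := X'.continuous.comp hβ'
  have hc : ∀ t ∈ Icc (0 : ℝ) 1, y₀ + ∫ τ in (0 : ℝ)..t, X' (β' τ) = β' t := fun t ht => by
    rw [← hint ⟨t, ht⟩]
    simp only [β', projIcc_of_mem zero_le_one ht]
  refine ⟨fun t => y₀ + ∫ τ in (0 : ℝ)..t, X' (β' τ), fun t => X' (β' t), hv, fun t => ?_, ?_,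
    fun t ht => ?_⟩
  · exact (intervalIntegral.integral_hasDerivAt_right (hv.intervalIntegrable _ _)
      (hv.stronglyMeasurableAtFilter _ _) hv.continuousAt).const_add _
  · simp
  · simp only [hc t ht]
    exact ⟨hβR _, hXX _ (hβR _)⟩

/-! ### Derivatives of charts and norms in charts. -/

section charts
open Filter
variable {n : ℕ} {M : Type*} [TopologicalSpace M] [ChartedSpace (EuclideanSpace ℝ (Fin n)) M]
  [IsManifold (𝓡 n) ∞ M]

/-- The derivative at `x` of the chart at `p`. -/
noncomputable def chartTo (p x : M) : TangentSpace (𝓡 n) x →L[ℝ] EuclideanSpace ℝ (Fin n) :=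
  (trivializationAt (EuclideanSpace ℝ (Fin n)) (TangentSpace (𝓡 n)) p).continuousLinearMapAt ℝ x

/-- The inverse of the derivative at `x` of the chart at `p`. -/
noncomputable def chartFrom (p x : M) : EuclideanSpace ℝ (Fin n) →L[ℝ] TangentSpace (𝓡 n) x :=
  (trivializationAt (EuclideanSpace ℝ (Fin n)) (TangentSpace (𝓡 n)) p).symmL ℝ x

theorem chartFrom_chartTo {p x : M} (hx : x ∈ (extChartAt (𝓡 n) p).source)
    (v : TangentSpace (𝓡 n) x) : chartFrom p x (chartTo p x v) = v := by
  rw [extChartAt_source] at hx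
  exact Trivialization.symmL_continuousLinearMapAt _ (by simpa using hx) v

theorem chartTo_chartFrom {p x : M} (hx : x ∈ (extChartAt (𝓡 n) p).source)
    (v : EuclideanSpace ℝ (Fin n)) : chartTo p x (chartFrom p x v) = v := by
  rw [extChartAt_source] at hx
  exact Trivialization.continuousLinearMapAt_symmL _ (by simpa using hx) v

theorem hasMFDerivAt_chart {p x : M} (hx : x ∈ (extChartAt (𝓡 n) p).source) :
    HasMFDerivAt (𝓡 n) 𝓘(ℝ, EuclideanSpace ℝ (Fin n)) (extChartAt (𝓡 n) p) x (chartTo p x) := by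
  rw [extChartAt_source] at hx
  rw [chartTo, TangentBundle.continuousLinearMapAt_trivializationAt hx]
  exact (mdifferentiableAt_extChartAt hx).hasMFDerivAt

theorem hasMFDerivAt_chart_symm {p : M} {z : EuclideanSpace ℝ (Fin n)}
    (hz : z ∈ (extChartAt (𝓡 n) p).target) :
    HasMFDerivAt 𝓘(ℝ, EuclideanSpace ℝ (Fin n)) (𝓡 n) (extChartAt (𝓡 n) p).symm z
      (chartFrom p ((extChartAt (𝓡 n) p).symm z)) := by
  have hx := (extChartAt (𝓡 n) p).map_target hz
  rw [extChartAt_source] at hx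
  rw [chartFrom, TangentBundle.symmL_trivializationAt hx, (extChartAt (𝓡 n) p).right_inv hz]
  have h := (mdifferentiableWithinAt_extChartAt_symm hz).hasMFDerivWithinAt
  rw [ModelWithCorners.range_eq_univ] at h ⊢
  rwa [hasMFDerivWithinAt_univ] at h

theorem hasMFDerivAt_chart_symm_comp {p : M} {c : ℝ → EuclideanSpace ℝ (Fin n)}
    {v : EuclideanSpace ℝ (Fin n)} {t : ℝ} (hc : HasDerivAt c v t)
    (ht : c t ∈ (extChartAt (𝓡 n) p).target) :
    HasMFDerivAt 𝓘(ℝ, ℝ) (𝓡 n) (fun s => (extChartAt (𝓡 n) p).symm (c s)) t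
      ((chartFrom p ((extChartAt (𝓡 n) p).symm (c t))) ∘L
        (ContinuousLinearMap.toSpanSingleton ℝ v)) :=
  HasMFDerivAt.comp t (hasMFDerivAt_chart_symm ht) hc.hasFDerivAt.hasMFDerivAt

/-- A `C¹` curve of `M` defined on `[0, 1]` and tangent to `E`. -/
def IsTangentCurve (E : (x : M) → Submodule ℝ (TangentSpace (𝓡 n) x)) (γ : ℝ → M) : Prop :=
  ContMDiffOn 𝓘(ℝ, ℝ) (𝓡 n) 1 γ (Icc 0 1) ∧
    ∀ t ∈ Icc (0 : ℝ) 1, mfderivWithin 𝓘(ℝ, ℝ) (𝓡 n) γ (Icc 0 1) t (1 : ℝ) ∈ E (γ t)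

theorem mfderivWithin_chart_symm_comp {p : M} {c : ℝ → EuclideanSpace ℝ (Fin n)}
    {v : EuclideanSpace ℝ (Fin n)} {t : ℝ} (ht : t ∈ Icc (0 : ℝ) 1) (hc : HasDerivAt c v t)
    (hct : c t ∈ (extChartAt (𝓡 n) p).target) :
    mfderivWithin 𝓘(ℝ, ℝ) (𝓡 n) (fun s => (extChartAt (𝓡 n) p).symm (c s)) (Icc 0 1) t (1 : ℝ) =
      chartFrom p ((extChartAt (𝓡 n) p).symm (c t)) v := by
  rw [((hasMFDerivAt_chart_symm_comp hc hct).hasMFDerivWithinAt).mfderivWithin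
    ((uniqueMDiffWithinAt_iff_uniqueDiffWithinAt).2 (uniqueDiffOn_Icc zero_lt_one t ht))]
  exact congrArg (chartFrom p _) (one_smul ℝ v)

theorem contMDiffOn_chart_symm_comp {p : M} {c v : ℝ → EuclideanSpace ℝ (Fin n)}
    (hv : Continuous v) (hc : ∀ t, HasDerivAt c (v t) t)
    (hct : ∀ t ∈ Icc (0 : ℝ) 1, c t ∈ (extChartAt (𝓡 n) p).target) :
    ContMDiffOn 𝓘(ℝ, ℝ) (𝓡 n) 1 (fun s => (extChartAt (𝓡 n) p).symm (c s)) (Icc 0 1) := by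
  have h1 : ContDiff ℝ 1 c := contDiff_one_iff_deriv.2
    ⟨fun t => (hc t).differentiableAt, by simpa [funext fun t => (hc t).deriv] using hv⟩
  exact (contMDiffOn_extChartAt_symm (n := 1) p).comp h1.contMDiff.contMDiffOn hct

end charts

section norm
open Filter
variable {n : ℕ} {M : Type*} [TopologicalSpace M] [ChartedSpace (EuclideanSpace ℝ (Fin n)) M]
  [IsManifold (𝓡 n) ∞ M] [RiemannianBundle (fun x : M => TangentSpace (𝓡 n) x)]

theorem isContinuousRiemannianBundle_of_contMDiff
    [h : IsContMDiffRiemannianBundle (𝓡 n) ∞ (EuclideanSpace ℝ (Fin n))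
      (fun x : M => TangentSpace (𝓡 n) x)] :
    IsContinuousRiemannianBundle (EuclideanSpace ℝ (Fin n))
      (fun x : M => TangentSpace (𝓡 n) x) := by
  obtain ⟨g, hg, hgi⟩ := h.exists_contMDiff
  exact ⟨g, hg.continuous, hgi⟩

variable [IsContinuousRiemannianBundle (EuclideanSpace ℝ (Fin n))
  (fun x : M => TangentSpace (𝓡 n) x)]

theorem continuous_norm_tangentBundle :
    Continuous fun v : TangentBundle (𝓡 n) M => ‖v.2‖ := by
  have h : Continuous fun v : TangentBundle (𝓡 n) M => inner ℝ v.2 v.2 :=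
    Continuous.inner_bundle (F := EuclideanSpace ℝ (Fin n))
      (E := fun x : M => TangentSpace (𝓡 n) x) (b := fun v : TangentBundle (𝓡 n) M => v.1)
      (v := fun v => v.2) (w := fun v => v.2) continuous_id continuous_id
  simpa only [norm_eq_sqrt_real_inner] using h.sqrt

theorem eventually_norm_chart_le (p : M) : ∃ C > 0, ∀ᶠ x in 𝓝 p,
    (∀ v : TangentSpace (𝓡 n) x, ‖chartTo p x v‖ ≤ C * ‖v‖) ∧
    ∀ w : EuclideanSpace ℝ (Fin n), ‖chartFrom p x w‖ ≤ C * ‖w‖ := by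
  obtain ⟨C, hC, h⟩ := eventually_norm_trivializationAt_lt (EuclideanSpace ℝ (Fin n))
    (fun x : M => TangentSpace (𝓡 n) x) p
  obtain ⟨C', hC', h'⟩ := eventually_norm_symmL_trivializationAt_lt (EuclideanSpace ℝ (Fin n))
    (fun x : M => TangentSpace (𝓡 n) x) p
  refine ⟨max C C', lt_max_of_lt_left hC, ?_⟩
  filter_upwards [h, h'] with x hx hx'
  exact ⟨fun v => ContinuousLinearMap.le_of_opNorm_le _ (hx.le.trans (le_max_left _ _)) v,
    fun v => ContinuousLinearMap.le_of_opNorm_le _ (hx'.le.trans (le_max_right _ _)) v⟩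

end norm

/-! ### Uniform first-order approximation on a compact manifold. -/

section approx
open Filter
variable {n : ℕ} {M : Type*} [TopologicalSpace M] [ChartedSpace (EuclideanSpace ℝ (Fin n)) M]
  [IsManifold (𝓡 n) ∞ M] {V : Type*} [NormedAddCommGroup V] [NormedSpace ℝ V]

/-- The derivative of a map from `M` to a vector space. -/
noncomputable def vderiv (h : M → V) (x : M) : TangentSpace (𝓡 n) x →L[ℝ] V :=
  mfderiv (𝓡 n) 𝓘(ℝ, V) h x

theorem hasFDerivAt_comp_chart_symm {h : M → V} (hh : ContMDiff (𝓡 n) 𝓘(ℝ, V) 1 h) {p : M}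
    {z : EuclideanSpace ℝ (Fin n)} (hz : z ∈ (extChartAt (𝓡 n) p).target) :
    HasFDerivAt (fun z => h ((extChartAt (𝓡 n) p).symm z))
      ((vderiv (n := n) h ((extChartAt (𝓡 n) p).symm z)) ∘L
        (chartFrom p ((extChartAt (𝓡 n) p).symm z))) z := by
  have h1 := ((hh ((extChartAt (𝓡 n) p).symm z)).mdifferentiableAt one_ne_zero).hasMFDerivAt
  exact (HasMFDerivAt.comp z h1 (hasMFDerivAt_chart_symm hz)).hasFDerivAt

theorem contDiffOn_comp_chart_symm {h : M → V} (hh : ContMDiff (𝓡 n) 𝓘(ℝ, V) 1 h) (p : M) :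
    ContDiffOn ℝ 1 (fun z => h ((extChartAt (𝓡 n) p).symm z)) (extChartAt (𝓡 n) p).target :=
  contMDiffOn_iff_contDiffOn.1 (hh.comp_contMDiffOn (contMDiffOn_extChartAt_symm (n := 1) p))

theorem continuousOn_vderiv_comp_chartFrom {h : M → V} (hh : ContMDiff (𝓡 n) 𝓘(ℝ, V) 1 h)
    (p : M) : ContinuousOn (fun x => (vderiv (n := n) h x) ∘L (chartFrom p x))
      (extChartAt (𝓡 n) p).source := by
  have h1 : ContinuousOn (fun z => fderiv ℝ (fun z => h ((extChartAt (𝓡 n) p).symm z)) z)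
      (extChartAt (𝓡 n) p).target :=
    (contDiffOn_comp_chart_symm hh p).continuousOn_fderiv_of_isOpen (isOpen_extChartAt_target p)
      le_rfl
  refine (h1.comp (continuousOn_extChartAt p) (extChartAt (𝓡 n) p).mapsTo).congr fun x hx => ?_
  have := (hasFDerivAt_comp_chart_symm hh ((extChartAt (𝓡 n) p).map_source hx)).fderiv
  rw [Function.comp_apply, this]
  have e := (extChartAt (𝓡 n) p).left_inv hx
  exact (congrArg (fun x => (vderiv (n := n) h x) ∘L (chartFrom p x)) e).symm

/-- The difference of two values of a `C¹` map is approximated by its derivative at any third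
point, locally uniformly. -/
theorem eventually_approx {h : M → V} (hh : ContMDiff (𝓡 n) 𝓘(ℝ, V) 1 h) (p : M) {ε : ℝ}
    (hε : 0 < ε) : ∀ᶠ q : M × M × M in 𝓝 (p, p, p),
      ‖h q.2.2 - h q.2.1 - vderiv h q.1 (chartFrom p q.1
        (extChartAt (𝓡 n) p q.2.2 - extChartAt (𝓡 n) p q.2.1))‖ ≤
      ε * ‖extChartAt (𝓡 n) p q.2.2 - extChartAt (𝓡 n) p q.2.1‖ := by
  set φ := extChartAt (𝓡 n) p
  have hsrc : φ.source ∈ 𝓝 p := extChartAt_source_mem_nhds p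
  -- Half of the error comes from strict differentiability at the centre, the other half from moving
  -- the derivative from `p` to `x`.
  have hstrict := ((contDiffOn_comp_chart_symm hh p).contDiffAt
    (extChartAt_target_mem_nhds p)).hasStrictFDerivAt one_ne_zero
  have h1 := hstrict.isLittleO.bound (half_pos hε)
  have hφ : ContinuousAt φ p := continuousAt_extChartAt p
  have h2 : Tendsto (fun q : M × M × M => (φ q.2.2, φ q.2.1)) (𝓝 (p, p, p)) (𝓝 (φ p, φ p)) := by
    have a : Tendsto (fun q : M × M × M => q.2.2) (𝓝 (p, p, p)) (𝓝 p) :=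
      (continuous_snd.comp continuous_snd).tendsto _
    have b : Tendsto (fun q : M × M × M => q.2.1) (𝓝 (p, p, p)) (𝓝 p) :=
      (continuous_fst.comp continuous_snd).tendsto _
    exact (hφ.tendsto.comp a).prodMk_nhds (hφ.tendsto.comp b)
  have h3 := ((continuousOn_vderiv_comp_chartFrom hh p).continuousAt hsrc).tendsto.eventually
    (Metric.ball_mem_nhds _ (half_pos hε))
  have e1 : Tendsto (fun q : M × M × M => q.1) (𝓝 (p, p, p)) (𝓝 p) := continuous_fst.tendsto _
  have e2 : Tendsto (fun q : M × M × M => q.2.1) (𝓝 (p, p, p)) (𝓝 p) :=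
    (continuous_fst.comp continuous_snd).tendsto _
  have e3 : Tendsto (fun q : M × M × M => q.2.2) (𝓝 (p, p, p)) (𝓝 p) :=
    (continuous_snd.comp continuous_snd).tendsto _
  filter_upwards [h2.eventually h1, e1.eventually h3, e2.eventually hsrc, e3.eventually hsrc]
    with ⟨x, y, z⟩ H1 H2 hy hz
  simp only at H1 H2 ⊢
  rw [φ.left_inv hy, φ.left_inv hz, (hasFDerivAt_comp_chart_symm hh
    (mem_extChartAt_target p)).fderiv] at H1
  have e : (vderiv (n := n) h (φ.symm (φ p))) ∘L (chartFrom p (φ.symm (φ p))) =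
      (vderiv (n := n) h p) ∘L (chartFrom p p) :=
    congrArg (fun x => (vderiv (n := n) h x) ∘L (chartFrom p x)) (extChartAt_to_inv p)
  rw [e] at H1
  rw [dist_eq_norm] at H2
  have H3 := ContinuousLinearMap.le_of_opNorm_le _ H2.le (φ z - φ y)
  simp only [sub_apply, ContinuousLinearMap.comp_apply] at H1 H3
  calc _ = ‖(h z - h y - vderiv h p (chartFrom p p (φ z - φ y))) -
        (vderiv h x (chartFrom p x (φ z - φ y)) - vderiv h p (chartFrom p p (φ z - φ y)))‖ := by
        congr 1; abel
    _ ≤ _ := (norm_sub_le _ _).trans (add_le_add H1 H3)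
    _ = _ := by ring

/-- A property that holds near every point of the diagonal holds for all triples of close points. -/
theorem exists_forall_of_eventually_diagonal [CompactSpace M] {e : M → V} (he : Continuous e)
    (hinj : Function.Injective e) {P : M → M → M → Prop}
    (hP : ∀ p, ∀ᶠ q : M × M × M in 𝓝 (p, p, p), P q.1 q.2.1 q.2.2) :
    ∃ δ > 0, ∀ x y z, ‖e y - e x‖ ≤ δ → ‖e z - e x‖ ≤ δ → P x y z := by
  -- With `δ` as a variable near `0`, compactness of the set of triples suffices: away from the
  -- diagonal a premise fails because `e` is injective.
  have key : ∀ᶠ δ : ℝ in 𝓝 0, ∀ q ∈ (univ : Set (M × M × M)),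
      ‖e q.2.1 - e q.1‖ ≤ δ → ‖e q.2.2 - e q.1‖ ≤ δ → P q.1 q.2.1 q.2.2 := by
    refine isCompact_univ.eventually_forall_of_forall_eventually ?_
    rintro ⟨x, y, z⟩ -
    by_cases hxy : y = x
    · by_cases hxz : z = x
      · subst hxy hxz
        have : Tendsto (fun q : ℝ × M × M × M => q.2) (𝓝 (0, z, z, z)) (𝓝 (z, z, z)) :=
          continuous_snd.tendsto _
        filter_upwards [this.eventually (hP z)] with q hq _ _ using hq
      · have h1 : Continuous fun q : ℝ × M × M × M => ‖e q.2.2.2 - e q.2.1‖ - q.1 := by fun_prop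
        have h2 : (0 : ℝ) < ‖e z - e x‖ - 0 := by
          rw [sub_zero]; exact norm_pos_iff.2 (sub_ne_zero.2 fun h => hxz (hinj h))
        filter_upwards [h1.continuousAt.eventually (lt_mem_nhds h2)] with q hq _ hq2
        linarith
    · have h1 : Continuous fun q : ℝ × M × M × M => ‖e q.2.2.1 - e q.2.1‖ - q.1 := by fun_prop
      have h2 : (0 : ℝ) < ‖e y - e x‖ - 0 := by
        rw [sub_zero]; exact norm_pos_iff.2 (sub_ne_zero.2 fun h => hxy (hinj h))
      filter_upwards [h1.continuousAt.eventually (lt_mem_nhds h2)] with q hq hq2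
      linarith
  obtain ⟨δ, hδ, H⟩ := Metric.eventually_nhds_iff.1 key
  refine ⟨δ / 2, half_pos hδ, fun x y z hy hz => H ?_ (x, y, z) trivial hy hz⟩
  rw [Real.dist_eq, sub_zero, abs_of_pos (half_pos hδ)]
  exact half_lt_self hδ

/-- Locally uniform bounds on a compact space are uniform. -/
theorem exists_forall_of_eventually [CompactSpace M] {P : ℝ → M → Prop}
    (hmono : ∀ x C C', C ≤ C' → P C x → P C' x) (hP : ∀ p, ∃ C, ∀ᶠ x in 𝓝 p, P C x) :
    ∃ C > 0, ∀ x, P C x := by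
  obtain ⟨C, hC⟩ := isCompact_univ.induction_on (p := fun s : Set M => ∃ C, ∀ x ∈ s, P C x)
    ⟨0, by simp⟩ (fun s t hst ⟨C, hC⟩ => ⟨C, fun x hx => hC x (hst hx)⟩)
    (fun s t ⟨C, hC⟩ ⟨C', hC'⟩ => ⟨max C C', fun x hx => hx.elim
      (fun h => hmono _ _ _ (le_max_left _ _) (hC x h))
      fun h => hmono _ _ _ (le_max_right _ _) (hC' x h)⟩)
    (fun p _ => (hP p).elim fun C hC => ⟨{x | P C x}, mem_nhdsWithin_of_mem_nhds hC, C,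
      fun _ hx => hx⟩)
  exact ⟨max C 1, by positivity, fun x => hmono _ _ _ (le_max_left _ _) (hC x trivial)⟩

end approx

/-! ### Linearising differences of points through a Euclidean embedding. -/

section embedding
open Filter
variable {n : ℕ} {M : Type*} [TopologicalSpace M] [ChartedSpace (EuclideanSpace ℝ (Fin n)) M]
  [IsManifold (𝓡 n) ∞ M] [RiemannianBundle (fun x : M => TangentSpace (𝓡 n) x)]
  [IsContinuousRiemannianBundle (EuclideanSpace ℝ (Fin n)) (fun x : M => TangentSpace (𝓡 n) x)]
  {V V' : Type*} [NormedAddCommGroup V] [InnerProductSpace ℝ V] [FiniteDimensional ℝ V]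
  [NormedAddCommGroup V'] [NormedSpace ℝ V']

theorem exists_norm_vderiv_le [CompactSpace M] {h : M → V'}
    (hh : ContMDiff (𝓡 n) 𝓘(ℝ, V') 1 h) :
    ∃ C > 0, ∀ (x : M) (v : TangentSpace (𝓡 n) x), ‖vderiv h x v‖ ≤ C * ‖v‖ := by
  refine exists_forall_of_eventually
    (P := fun C (x : M) => ∀ v : TangentSpace (𝓡 n) x, ‖vderiv h x v‖ ≤ C * ‖v‖)
    (fun x C C' hC H v => (H v).trans (mul_le_mul_of_nonneg_right hC (norm_nonneg v))) fun p => ?_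
  have hsrc : (extChartAt (𝓡 n) p).source ∈ 𝓝 p := extChartAt_source_mem_nhds p
  obtain ⟨C, hC, hCe⟩ := eventually_norm_chart_le (n := n) p
  have h1 := ((continuousOn_vderiv_comp_chartFrom hh p).continuousAt hsrc).norm.eventually
    (gt_mem_nhds (lt_add_one _))
  refine ⟨(‖(vderiv (n := n) h p) ∘L (chartFrom p p)‖ + 1) * C, ?_⟩
  filter_upwards [hsrc, hCe, h1] with x hx hCx h1x v
  have h2 := ContinuousLinearMap.le_of_opNorm_le _ h1x.le (chartTo p x v)
  rw [ContinuousLinearMap.comp_apply, chartFrom_chartTo hx] at h2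
  refine h2.trans ?_
  rw [mul_assoc]
  exact mul_le_mul_of_nonneg_left (hCx.1 v) (by positivity)

/-- A left inverse of the derivative at `p`, kept fixed in the chart, remains an approximate left
inverse nearby; the error `1 / 2` is absorbed. -/
theorem exists_norm_le_vderiv [CompactSpace M] {e : M → V}
    (he : ContMDiff (𝓡 n) 𝓘(ℝ, V) 1 e)
    (hinj : ∀ x, Function.Injective (mfderiv (𝓡 n) 𝓘(ℝ, V) e x)) :
    ∃ C > 0, ∀ (x : M) (v : TangentSpace (𝓡 n) x), ‖v‖ ≤ C * ‖vderiv e x v‖ := by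
  refine exists_forall_of_eventually
    (P := fun C (x : M) => ∀ v : TangentSpace (𝓡 n) x, ‖v‖ ≤ C * ‖vderiv e x v‖)
    (fun x C C' hC H v => (H v).trans (mul_le_mul_of_nonneg_right hC (norm_nonneg _))) fun p => ?_
  have hsrc : (extChartAt (𝓡 n) p).source ∈ 𝓝 p := extChartAt_source_mem_nhds p
  obtain ⟨C, hC, hCe⟩ := eventually_norm_chart_le (n := n) p
  set B : M → EuclideanSpace ℝ (Fin n) →L[ℝ] V := fun x => (vderiv (n := n) e x) ∘L (chartFrom p x)
    with hB
  have hBinj : Function.Injective (B p) := by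
    have : Function.Injective (chartFrom (n := n) p p) := fun a b hab => by
      rw [← chartTo_chartFrom (mem_extChartAt_source p) a, hab,
        chartTo_chartFrom (mem_extChartAt_source p) b]
    exact (hinj p).comp this
  obtain ⟨G, hG⟩ := (B p).toLinearMap.exists_leftInverse_of_injective
    (LinearMap.ker_eq_bot.2 hBinj)
  let G' : V →L[ℝ] EuclideanSpace ℝ (Fin n) := G.toContinuousLinearMap
  have hcont : ContinuousAt (fun x => G' ∘L (B x)) p :=
    continuousAt_const.clm_comp ((continuousOn_vderiv_comp_chartFrom he p).continuousAt hsrc)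
  have h1 := hcont.tendsto.eventually (Metric.ball_mem_nhds _ (half_pos one_pos))
  refine ⟨C * (2 * ‖G'‖), ?_⟩
  filter_upwards [hsrc, hCe, h1] with x hx hCx h1x v
  have h2 : ∀ w : EuclideanSpace ℝ (Fin n), G' (B p w) = w := fun w => LinearMap.congr_fun hG w
  set w := chartTo p x v with hw
  have h3 : B x w = vderiv e x v := by
    rw [hB, ContinuousLinearMap.comp_apply, chartFrom_chartTo hx]
  rw [dist_eq_norm] at h1x
  have h4 : ‖G' (B x w) - G' (B p w)‖ ≤ 1 / 2 * ‖w‖ :=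
    ContinuousLinearMap.le_of_opNorm_le _ h1x.le w
  rw [h2, h3] at h4
  have h5 : ‖w‖ ≤ 2 * ‖G'‖ * ‖vderiv e x v‖ := by
    have := norm_sub_norm_le w (G' (vderiv e x v))
    rw [norm_sub_rev] at this
    have := G'.le_opNorm (vderiv e x v)
    linarith
  calc ‖v‖ = ‖chartFrom p x w‖ := by rw [hw, chartFrom_chartTo hx]
    _ ≤ C * ‖w‖ := hCx.2 w
    _ ≤ C * (2 * ‖G'‖ * ‖vderiv e x v‖) := mul_le_mul_of_nonneg_left h5 hC.le
    _ = _ := by ring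

/-- `L` is a uniformly bounded family of left inverses of the derivatives of `e`. -/
structure IsLeftInverseFamily (e : M → V) (L : (x : M) → V →ₗ[ℝ] TangentSpace (𝓡 n) x) (C : ℝ) :
    Prop where
  pos : 0 < C
  contMDiff : ContMDiff (𝓡 n) 𝓘(ℝ, V) 1 e
  inj : Function.Injective e
  apply_vderiv : ∀ x v, L x (vderiv e x v) = v
  norm_le : ∀ x w, ‖L x w‖ ≤ C * ‖w‖
  vderiv_le : ∀ (x : M) (v : TangentSpace (𝓡 n) x), ‖vderiv e x v‖ ≤ C * ‖v‖

/-- Project orthogonally onto the image of the derivative, then invert. Uniform bounds are all that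
is used later, so continuity in the base point is not recorded. -/
theorem exists_isLeftInverseFamily [CompactSpace M] {e : M → V}
    (he : ContMDiff (𝓡 n) 𝓘(ℝ, V) 1 e) (hinj : Function.Injective e)
    (hinj' : ∀ x, Function.Injective (mfderiv (𝓡 n) 𝓘(ℝ, V) e x)) :
    ∃ (L : (x : M) → V →ₗ[ℝ] TangentSpace (𝓡 n) x) (C : ℝ), IsLeftInverseFamily e L C := by
  obtain ⟨C₁, hC₁, H₁⟩ := exists_norm_vderiv_le he
  obtain ⟨C₂, hC₂, H₂⟩ := exists_norm_le_vderiv he hinj'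
  have : ∀ x : M, ∃ L : V →ₗ[ℝ] TangentSpace (𝓡 n) x, (∀ v, L (vderiv e x v) = v) ∧
      ∀ w, ‖L w‖ ≤ C₂ * ‖w‖ := by
    intro x
    let A : TangentSpace (𝓡 n) x →ₗ[ℝ] V := (vderiv e x).toLinearMap
    let K := LinearMap.range A
    let ψ : TangentSpace (𝓡 n) x ≃ₗ[ℝ] K := LinearEquiv.ofInjective A (hinj' x)
    have hψ : ∀ v, (ψ v : V) = vderiv e x v := fun v => rfl
    refine ⟨ψ.symm.toLinearMap ∘ₗ K.orthogonalProjectionOnto.toLinearMap, fun v => ?_, fun w => ?_⟩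
    · change ψ.symm (K.orthogonalProjectionOnto (vderiv e x v)) = v
      rw [← hψ, Submodule.orthogonalProjectionOnto_mem_subspace_eq_self, ψ.symm_apply_apply]
    · change ‖ψ.symm (K.orthogonalProjectionOnto w)‖ ≤ _
      refine (H₂ x _).trans (mul_le_mul_of_nonneg_left ?_ hC₂.le)
      rw [← hψ, ψ.apply_symm_apply]
      exact K.norm_orthogonalProjectionOnto_apply_le w
  choose L hL1 hL2 using this
  exact ⟨L, max C₁ C₂, lt_max_of_lt_left hC₁, he, hinj, hL1,
    fun x w => (hL2 x w).trans (mul_le_mul_of_nonneg_right (le_max_right _ _) (norm_nonneg _)),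
    fun x v => (H₁ x v).trans (mul_le_mul_of_nonneg_right (le_max_left _ _) (norm_nonneg _))⟩

namespace IsLeftInverseFamily
variable {e : M → V} {L : (x : M) → V →ₗ[ℝ] TangentSpace (𝓡 n) x} {C : ℝ}

/-- The derivative of `e` is bounded below, and the first-order error is small enough to be absorbed
in half of the left-hand side. -/
theorem eventually_chart_le (hL : IsLeftInverseFamily e L C) (p : M) :
    ∃ C' > 0, ∀ᶠ q : M × M × M in 𝓝 (p, p, p),
      ‖extChartAt (𝓡 n) p q.2.2 - extChartAt (𝓡 n) p q.2.1‖ ≤ C' * ‖e q.2.2 - e q.2.1‖ := by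
  obtain ⟨C₁, hC₁, H₁⟩ := eventually_norm_chart_le (n := n) p
  have hC := hL.pos
  have hsrc : (extChartAt (𝓡 n) p).source ∈ 𝓝 p := extChartAt_source_mem_nhds p
  have e1 : Tendsto (fun q : M × M × M => q.1) (𝓝 (p, p, p)) (𝓝 p) := continuous_fst.tendsto _
  refine ⟨2 * (C₁ * C), by positivity, ?_⟩
  filter_upwards [eventually_approx hL.contMDiff p (ε := 1 / (2 * (C₁ * C))) (by positivity),
    e1.eventually H₁, e1.eventually hsrc] with ⟨x, y, z⟩ h1 h2 h3
  simp only at h1 h2 ⊢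
  set w := extChartAt (𝓡 n) p z - extChartAt (𝓡 n) p y
  have h4 : ‖w‖ ≤ C₁ * C * ‖vderiv e x (chartFrom p x w)‖ := by
    calc ‖w‖ = ‖chartTo p x (chartFrom p x w)‖ := by rw [chartTo_chartFrom h3]
      _ ≤ C₁ * ‖chartFrom p x w‖ := h2.1 _
      _ = C₁ * ‖L x (vderiv e x (chartFrom p x w))‖ := by rw [hL.apply_vderiv]
      _ ≤ C₁ * (C * ‖vderiv e x (chartFrom p x w)‖) :=
        mul_le_mul_of_nonneg_left (hL.norm_le _ _) hC₁.le
      _ = _ := by ring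
  have h5 := norm_sub_norm_le (vderiv e x (chartFrom p x w)) (e z - e y)
  rw [norm_sub_rev _ (e z - e y)] at h5
  have h6 : C₁ * C * ‖vderiv e x (chartFrom p x w)‖ ≤
      C₁ * C * (‖e z - e y‖ + 1 / (2 * (C₁ * C)) * ‖w‖) :=
    mul_le_mul_of_nonneg_left (by linarith) (by positivity)
  have h7 : C₁ * C * (1 / (2 * (C₁ * C)) * ‖w‖) = ‖w‖ / 2 := by field_simp
  rw [mul_add, h7] at h6
  linarith

/-- In the chart at `p`, the vectors `L x (e z - e y)` are differences of coordinates, up to a small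
relative error. -/
theorem eventually_sub_chartFrom_le (hL : IsLeftInverseFamily e L C) (p : M) {ε : ℝ}
    (hε : 0 < ε) : ∀ᶠ q : M × M × M in 𝓝 (p, p, p),
      ‖L q.1 (e q.2.2 - e q.2.1) - chartFrom p q.1
        (extChartAt (𝓡 n) p q.2.2 - extChartAt (𝓡 n) p q.2.1)‖ ≤
      ε * ‖extChartAt (𝓡 n) p q.2.2 - extChartAt (𝓡 n) p q.2.1‖ := by
  have hC := hL.pos
  filter_upwards [eventually_approx hL.contMDiff p (ε := ε / C) (by positivity)]
    with ⟨x, y, z⟩ h1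
  simp only at h1 ⊢
  set w := extChartAt (𝓡 n) p z - extChartAt (𝓡 n) p y
  have h2 : L x (e z - e y) - chartFrom p x w =
      L x (e z - e y - vderiv e x (chartFrom p x w)) := by
    rw [map_sub (L x) (e z - e y) _, hL.apply_vderiv]
  rw [h2]
  calc _ ≤ C * _ := hL.norm_le _ _
    _ ≤ C * (ε / C * ‖w‖) := mul_le_mul_of_nonneg_left h1 hC.le
    _ = ε * ‖w‖ := by field_simp

/-- A Taylor estimate free of charts, with the displacement between `y` and `z` represented by a
vector at the third point `x`. Near each point both the increment of `h` and the vector `L x (e z -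
e y)` are compared with the difference of coordinates. -/
theorem exists_approx [CompactSpace M] (hL : IsLeftInverseFamily e L C) {h : M → V'}
    (hh : ContMDiff (𝓡 n) 𝓘(ℝ, V') 1 h) {ε : ℝ} (hε : 0 < ε) :
    ∃ δ > 0, ∀ x y z, ‖e y - e x‖ ≤ δ → ‖e z - e x‖ ≤ δ →
      ‖h z - h y - vderiv h x (L x (e z - e y))‖ ≤ ε * ‖e z - e y‖ := by
  refine exists_forall_of_eventually_diagonal hL.contMDiff.continuous hL.inj
    (P := fun x y z => ‖h z - h y - vderiv h x (L x (e z - e y))‖ ≤ ε * ‖e z - e y‖) fun p => ?_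
  have hC := hL.pos
  obtain ⟨C₁, hC₁, H₁⟩ := exists_norm_vderiv_le hh
  obtain ⟨C₂, hC₂, H₂⟩ := hL.eventually_chart_le p
  filter_upwards [H₂, hL.eventually_sub_chartFrom_le p (ε := ε / (2 * (C₁ * C₂))) (by positivity),
    eventually_approx hh p (ε := ε / (2 * C₂)) (by positivity)] with ⟨x, y, z⟩ h1 h2 h3
  simp only at h1 h2 h3 ⊢
  set w := extChartAt (𝓡 n) p z - extChartAt (𝓡 n) p y
  have h4 : h z - h y - vderiv h x (L x (e z - e y)) =
      (h z - h y - vderiv h x (chartFrom p x w)) -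
        vderiv h x (L x (e z - e y) - chartFrom p x w) := by
    rw [map_sub (vderiv h x) (L x (e z - e y)) _]; abel
  rw [h4]
  calc _ ≤ _ := norm_sub_le _ _
    _ ≤ ε / (2 * C₂) * ‖w‖ + C₁ * (ε / (2 * (C₁ * C₂)) * ‖w‖) :=
      add_le_add h3 ((H₁ _ _).trans (mul_le_mul_of_nonneg_left h2 hC₁.le))
    _ = ε / C₂ * ‖w‖ := by field_simp; ring
    _ ≤ ε / C₂ * (C₂ * ‖e z - e y‖) := mul_le_mul_of_nonneg_left h1 (by positivity)
    _ = _ := by field_simp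

theorem exists_le_norm [CompactSpace M] (hL : IsLeftInverseFamily e L C) :
    ∃ δ > 0, ∀ x y z, ‖e y - e x‖ ≤ δ → ‖e z - e x‖ ≤ δ →
      ‖e z - e y‖ ≤ 2 * C * ‖L x (e z - e y)‖ := by
  obtain ⟨δ, hδ, H⟩ := hL.exists_approx hL.contMDiff (half_pos one_pos)
  refine ⟨δ, hδ, fun x y z hy hz => ?_⟩
  have h1 := H x y z hy hz
  have h2 := hL.vderiv_le x (L x (e z - e y))
  have h3 := norm_sub_norm_le (e z - e y) (vderiv e x (L x (e z - e y)))
  linarith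

/-- The action of a `C¹` map on differences. -/
theorem exists_map_approx [CompactSpace M] (hL : IsLeftInverseFamily e L C) {f : M → M}
    (hf : ContMDiff (𝓡 n) (𝓡 n) 1 f) {ε : ℝ} (hε : 0 < ε) :
    ∃ δ > 0, ∀ x y z, ‖e y - e x‖ ≤ δ → ‖e z - e x‖ ≤ δ →
      ‖L (f x) (e (f z) - e (f y)) - mfderiv (𝓡 n) (𝓡 n) f x (L x (e z - e y))‖ ≤
        ε * ‖e z - e y‖ := by
  have hC := hL.pos
  obtain ⟨δ, hδ, H⟩ := hL.exists_approx (hL.contMDiff.comp hf) (ε := ε / C) (by positivity)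
  refine ⟨δ, hδ, fun x y z hy hz => ?_⟩
  have h1 : ∀ v, vderiv (e ∘ f) x v = vderiv e (f x) (mfderiv (𝓡 n) (𝓡 n) f x v) := fun v => by
    have := mfderiv_comp x ((hL.contMDiff (f x)).mdifferentiableAt one_ne_zero)
      ((hf x).mdifferentiableAt one_ne_zero)
    exact congrArg (fun A => A v) this
  have h2 := H x y z hy hz
  rw [h1] at h2
  have h3 := hL.norm_le (f x) (e (f z) - e (f y) -
    vderiv e (f x) (mfderiv (𝓡 n) (𝓡 n) f x (L x (e z - e y))))
  rw [map_sub (L (f x)) (e (f z) - e (f y)) _, hL.apply_vderiv] at h3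
  calc _ ≤ _ := h3
    _ ≤ C * (ε / C * ‖e z - e y‖) := mul_le_mul_of_nonneg_left h2 hC.le
    _ = _ := by field_simp

end IsLeftInverseFamily
end embedding

/-! ### Continuous projections onto the subbundles, and compactness. -/

section projections
open Filter
variable {n : ℕ} {M : Type*} [TopologicalSpace M] [ChartedSpace (EuclideanSpace ℝ (Fin n)) M]
  [IsManifold (𝓡 n) ∞ M] {ι : Type*} [Fintype ι] [DecidableEq ι]

/-- The projections of the tangent spaces onto the summands of a splitting into continuous
subbundles. -/
structure IsProjectionFamily (E : ι → (x : M) → Submodule ℝ (TangentSpace (𝓡 n) x))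
    (pr : ι → (x : M) → TangentSpace (𝓡 n) x →L[ℝ] TangentSpace (𝓡 n) x) : Prop where
  mem : ∀ i x v, pr i x v ∈ E i x
  apply_of_mem : ∀ i x, ∀ v ∈ E i x, pr i x v = v
  apply_of_mem_ne : ∀ i j x, i ≠ j → ∀ v ∈ E j x, pr i x v = 0
  sum_apply : ∀ x v, ∑ i, pr i x v = v
  continuousOn : ∀ i p, ContinuousOn (fun x => (chartTo p x) ∘L (pr i x) ∘L (chartFrom p x))
    (extChartAt (𝓡 n) p).source

theorem continuousWithinAt_chartTo {X : (x : M) → TangentSpace (𝓡 n) x} {U : Set M} {p q : M}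
    (hX : ContinuousWithinAt (fun x => (⟨x, X x⟩ : TangentBundle (𝓡 n) M)) U q)
    (hq : q ∈ (extChartAt (𝓡 n) p).source) :
    ContinuousWithinAt (fun x => chartTo p x (X x)) U q := by
  set T := trivializationAt (EuclideanSpace ℝ (Fin n)) (TangentSpace (𝓡 n)) p
  have hb : T.baseSet = (extChartAt (𝓡 n) p).source := by
    rw [extChartAt_source]; exact TangentBundle.trivializationAt_baseSet p
  have h1 : ContinuousAt T ⟨q, X q⟩ := by
    refine T.continuousOn_toFun.continuousAt (T.open_source.mem_nhds ?_)
    rw [T.mem_source]; rwa [hb]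
  have h2 : ContinuousWithinAt (fun x => (T ⟨x, X x⟩).2) U q :=
    (ContinuousAt.comp_continuousWithinAt (f := fun x => (⟨x, X x⟩ : TangentBundle (𝓡 n) M))
      h1 hX).snd
  refine h2.congr_of_eventuallyEq ?_ ?_
  · filter_upwards [mem_nhdsWithin_of_mem_nhds ((isOpen_extChartAt_source p).mem_nhds hq)]
      with x hx
    exact (T.continuousLinearMapAt_apply_of_mem (R := ℝ) (hb ▸ hx) (X x))
  · exact (T.continuousLinearMapAt_apply_of_mem (R := ℝ) (hb ▸ hq) (X q))

theorem continuousOn_chartFrom (p : M) : ContinuousOn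
    (fun q : M × EuclideanSpace ℝ (Fin n) => (⟨q.1, chartFrom p q.1 q.2⟩ : TangentBundle (𝓡 n) M))
    ((extChartAt (𝓡 n) p).source ×ˢ univ) := by
  set T := trivializationAt (EuclideanSpace ℝ (Fin n)) (TangentSpace (𝓡 n)) p
  have hb : T.baseSet = (extChartAt (𝓡 n) p).source := by
    rw [extChartAt_source]; exact TangentBundle.trivializationAt_baseSet p
  have h1 := T.continuousOn_symm
  rw [hb] at h1
  exact h1.congr fun q hq => congrArg (TotalSpace.mk q.1) (T.symmL_apply (hb ▸ hq.1) q.2)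

/-- Local frames of the summands combine into a frame of the tangent bundle. In it each projection
is a constant coordinate projection `P`, so in a chart it equals `B ∘ P ∘ B⁻¹` with `B` continuous;
inversion of linear maps is continuous. -/
theorem exists_isProjectionFamily {E : ι → (x : M) → Submodule ℝ (TangentSpace (𝓡 n) x)}
    (hE : ∀ x, DirectSum.IsInternal fun i => E i x) (hc : ∀ i, IsContinuousSubbundle (E i)) :
    ∃ pr : ι → (x : M) → TangentSpace (𝓡 n) x →L[ℝ] TangentSpace (𝓡 n) x,
      IsProjectionFamily E pr := by
  have : ∀ x : M, ∃ pr : ι → TangentSpace (𝓡 n) x →L[ℝ] TangentSpace (𝓡 n) x,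
      (∀ i v, pr i v ∈ E i x) ∧ (∀ i, ∀ v ∈ E i x, pr i v = v) ∧
      (∀ i j, i ≠ j → ∀ v ∈ E j x, pr i v = 0) ∧ ∀ v, ∑ i, pr i v = v := by
    intro x
    have : FiniteDimensional ℝ (TangentSpace (𝓡 n) x) :=
      inferInstanceAs (FiniteDimensional ℝ (EuclideanSpace ℝ (Fin n)))
    have : T2Space (TangentSpace (𝓡 n) x) := inferInstanceAs (T2Space (EuclideanSpace ℝ (Fin n)))
    let A : (DirectSum ι fun i => E i x) ≃ₗ[ℝ] TangentSpace (𝓡 n) x :=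
      LinearEquiv.ofBijective (DirectSum.coeLinearMap fun i => E i x) (hE x)
    have hA : ∀ i (v : E i x), A.symm v = DirectSum.lof ℝ ι (fun i => E i x) i v := fun i v => by
      rw [LinearEquiv.symm_apply_eq]
      exact (DirectSum.coeLinearMap_lof (fun i => E i x) i v).symm
    refine ⟨fun i => ((E i x).subtype ∘ₗ DirectSum.component ℝ ι (fun i => E i x) i ∘ₗ
      A.symm.toLinearMap).toContinuousLinearMap, fun i v => ?_, fun i v hv => ?_,
      fun i j hij v hv => ?_, fun v => ?_⟩
    · exact Subtype.mem _
    · change ((DirectSum.component ℝ ι (fun i => E i x) i (A.symm v) : E i x) :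
        TangentSpace (𝓡 n) x) = v
      rw [hA i ⟨v, hv⟩, DirectSum.component.lof_self]
    · change ((DirectSum.component ℝ ι (fun i => E i x) i (A.symm v) : E i x) :
        TangentSpace (𝓡 n) x) = 0
      rw [hA j ⟨v, hv⟩, DirectSum.component.of, dif_neg hij.symm, ZeroMemClass.coe_zero]
    · change ∑ i, ((DirectSum.component ℝ ι (fun i => E i x) i (A.symm v) : E i x) :
        TangentSpace (𝓡 n) x) = v
      conv_rhs => rw [← A.apply_symm_apply v]
      classical
      change _ = DirectSum.coeLinearMap (fun i => E i x) (A.symm v)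
      rw [DirectSum.coeLinearMap_eq_dfinsuppSum, DFinsupp.sum_eq_sum_fintype _ fun i => rfl]
      rfl
  choose pr h1 h2 h3 h4 using this
  refine ⟨fun i x => pr x i, fun i x => h1 x i, fun i x => h2 x i, fun i j x => h3 x i j, h4,
    fun i p q hq => ContinuousAt.continuousWithinAt ?_⟩
  choose U hU k X hX hX' using fun i => hc i q
  have hsrc := (isOpen_extChartAt_source (I := 𝓡 n) p).mem_nhds hq
  let b : Module.Basis (Σ i, Fin (k i)) ℝ (TangentSpace (𝓡 n) q) :=
    (hE q).collectedBasis fun i => (Module.Basis.span (hX' i q (mem_of_mem_nhds (hU i))).1).map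
      (LinearEquiv.ofEq _ _ (hX' i q (mem_of_mem_nhds (hU i))).2)
  have hb : ∀ a, b a = X a.1 a.2 q := fun a => by
    simp only [b, DirectSum.IsInternal.collectedBasis_coe, Module.Basis.map_apply,
      LinearEquiv.coe_ofEq_apply, Module.Basis.span_apply]
  let B : M → ((Σ i, Fin (k i)) → ℝ) →L[ℝ] EuclideanSpace ℝ (Fin n) := fun x =>
    ∑ a, (ContinuousLinearMap.proj a).smulRight (chartTo p x (X a.1 a.2 x))
  have hBapp : ∀ x c, B x c = ∑ a, c a • chartTo p x (X a.1 a.2 x) := fun x c => by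
    simp [B]
  have hBc : ContinuousAt B q := by
    refine tendsto_finsetSum _ fun a _ => ?_
    have : ContinuousAt (fun x => chartTo p x (X a.1 a.2 x)) q := by
      have := continuousWithinAt_chartTo ((hX a.1 a.2) q (mem_of_mem_nhds (hU a.1))) hq
      exact this.continuousAt (hU a.1)
    exact (ContinuousLinearMap.smulRightL ℝ ((Σ i, Fin (k i)) → ℝ) (EuclideanSpace ℝ (Fin n))
      (ContinuousLinearMap.proj a)).continuous.continuousAt.comp this
  have hBq : ∃ e : ((Σ i, Fin (k i)) → ℝ) ≃L[ℝ] EuclideanSpace ℝ (Fin n), ↑e = B q := by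
    let e₁ : TangentSpace (𝓡 n) q ≃ₗ[ℝ] EuclideanSpace ℝ (Fin n) :=
      { (chartTo p q).toLinearMap with
        invFun := chartFrom p q
        left_inv := fun v => chartFrom_chartTo hq v
        right_inv := fun v => chartTo_chartFrom hq v }
    refine ⟨(b.equivFun.symm.trans e₁).toContinuousLinearEquiv, ?_⟩
    ext1 c
    change chartTo p q (b.equivFun.symm c) = _
    rw [hBapp, Module.Basis.equivFun_symm_apply, map_sum]
    exact Finset.sum_congr rfl fun a _ => by rw [map_smul, hb]
  obtain ⟨e, he⟩ := hBq
  let P : ((Σ i, Fin (k i)) → ℝ) →L[ℝ] ((Σ i, Fin (k i)) → ℝ) :=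
    ContinuousLinearMap.pi fun a => if a.1 = i then ContinuousLinearMap.proj a else 0
  have hP : ∀ c a, P c a = if a.1 = i then c a else 0 := fun c a => by
    simp only [P, ContinuousLinearMap.pi_apply]; split_ifs <;> rfl
  have hinv : ContinuousAt (fun x => (B x) ∘L P ∘L (B x).inverse) q := by
    refine hBc.clm_comp (continuousAt_const.clm_comp ?_)
    have h5 : ContinuousAt ContinuousLinearMap.inverse (B q) := by
      rw [← he]; exact (contDiffAt_map_inverse (n := 0) e).continuousAt
    exact ContinuousAt.comp (f := B) h5 hBc
  refine hinv.congr ?_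
  have hnear : ∀ᶠ x in 𝓝 q, B x ∈ range ((↑) : (((Σ i, Fin (k i)) → ℝ) ≃L[ℝ]
      EuclideanSpace ℝ (Fin n)) → _) :=
    hBc.eventually (by rw [← he]; exact ContinuousLinearEquiv.nhds e)
  filter_upwards [hnear, hsrc, Filter.eventually_all.2 hU] with x ⟨e', he'⟩ hx hxU
  ext1 v
  obtain ⟨c, rfl⟩ : ∃ c, e' c = v := ⟨e'.symm v, e'.apply_symm_apply v⟩
  have h6 : (B x).inverse (e' c) = c := by
    rw [← he', ContinuousLinearMap.inverse_equiv]; exact e'.symm_apply_apply c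
  have h7 : e' c = B x c := by rw [← he']; rfl
  rw [ContinuousLinearMap.comp_apply, ContinuousLinearMap.comp_apply, h6, h7, hBapp, hBapp,
    ContinuousLinearMap.comp_apply, ContinuousLinearMap.comp_apply, map_sum, map_sum, map_sum]
  refine Finset.sum_congr rfl fun a _ => ?_
  have hmem : X a.1 a.2 x ∈ E a.1 x := by
    rw [← (hX' a.1 x (hxU a.1)).2]; exact Submodule.subset_span ⟨a.2, rfl⟩
  rw [map_smul, map_smul, map_smul, chartFrom_chartTo hx, hP]
  by_cases hai : a.1 = i
  · rw [if_pos hai, h2 x i _ (hai ▸ hmem)]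
  · rw [if_neg hai, h3 x i a.1 (Ne.symm hai) _ hmem, map_zero, smul_zero, zero_smul]

namespace IsProjectionFamily
variable {E : ι → (x : M) → Submodule ℝ (TangentSpace (𝓡 n) x)}
  {pr : ι → (x : M) → TangentSpace (𝓡 n) x →L[ℝ] TangentSpace (𝓡 n) x}

theorem mem_iff (h : IsProjectionFamily E pr) (i : ι) (x : M) (v : TangentSpace (𝓡 n) x) :
    v ∈ E i x ↔ pr i x v = v :=
  ⟨h.apply_of_mem i x v, fun hv => hv ▸ h.mem i x v⟩

/-- An equivariant linear map commutes with the projections. -/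
theorem map_apply (h : IsProjectionFamily E pr) {x y : M}
    {A : TangentSpace (𝓡 n) x →L[ℝ] TangentSpace (𝓡 n) y}
    (hA : ∀ i, ∀ v ∈ E i x, A v ∈ E i y) (i : ι) (v : TangentSpace (𝓡 n) x) :
    pr i y (A v) = A (pr i x v) := by
  conv_lhs => rw [← h.sum_apply x v, map_sum, map_sum]
  rw [Finset.sum_eq_single i]
  · exact h.apply_of_mem i y _ (hA i _ (h.mem i x v))
  · exact fun j _ hj => h.apply_of_mem_ne i j y hj.symm _ (hA j _ (h.mem j x v))
  · exact fun hi => absurd (Finset.mem_univ i) hi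

variable [RiemannianBundle (fun x : M => TangentSpace (𝓡 n) x)]
  [IsContinuousRiemannianBundle (EuclideanSpace ℝ (Fin n)) (fun x : M => TangentSpace (𝓡 n) x)]

theorem exists_norm_le [CompactSpace M] (h : IsProjectionFamily E pr) (i : ι) :
    ∃ C > 0, ∀ (x : M) (v : TangentSpace (𝓡 n) x), ‖pr i x v‖ ≤ C * ‖v‖ := by
  refine exists_forall_of_eventually
    (P := fun C (x : M) => ∀ v : TangentSpace (𝓡 n) x, ‖pr i x v‖ ≤ C * ‖v‖)
    (fun x C C' hC H v => (H v).trans (mul_le_mul_of_nonneg_right hC (norm_nonneg v))) fun p => ?_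
  have hsrc : (extChartAt (𝓡 n) p).source ∈ 𝓝 p := extChartAt_source_mem_nhds p
  obtain ⟨C, hC, hCe⟩ := eventually_norm_chart_le (n := n) p
  have h1 := ((h.continuousOn i p).continuousAt hsrc).norm.eventually (gt_mem_nhds (lt_add_one _))
  refine ⟨C * ((‖(chartTo p p) ∘L (pr i p) ∘L (chartFrom p p)‖ + 1) * C), ?_⟩
  filter_upwards [hsrc, hCe, h1] with x hx hCx h1x v
  have h2 := ContinuousLinearMap.le_of_opNorm_le _ h1x.le (chartTo p x v)
  rw [ContinuousLinearMap.comp_apply, ContinuousLinearMap.comp_apply, chartFrom_chartTo hx] at h2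
  calc ‖pr i x v‖ = ‖chartFrom p x (chartTo p x (pr i x v))‖ := by rw [chartFrom_chartTo hx]
    _ ≤ C * ‖chartTo p x (pr i x v)‖ := hCx.2 _
    _ ≤ C * (_ * (C * ‖v‖)) := mul_le_mul_of_nonneg_left
      (h2.trans (mul_le_mul_of_nonneg_left (hCx.1 v) (by positivity))) hC.le
    _ = _ := by ring

/-- A positive continuous function of pairs of vectors of two subbundles, homogeneous in each of
them, is bounded below by a multiple of the product of the norms. -/
theorem exists_norm_mul_norm_le [CompactSpace M] (h : IsProjectionFamily E pr) (i j : ι)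
    (G : (x : M) → TangentSpace (𝓡 n) x → TangentSpace (𝓡 n) x → ℝ)
    (hG : ∀ x v w (s t : ℝ), 0 ≤ s → 0 ≤ t → G x (s • v) (t • w) = s * t * G x v w)
    (hGc : ∀ p, ContinuousOn (fun q : M × EuclideanSpace ℝ (Fin n) × EuclideanSpace ℝ (Fin n) =>
      G q.1 (chartFrom p q.1 q.2.1) (chartFrom p q.1 q.2.2))
      ((extChartAt (𝓡 n) p).source ×ˢ univ))
    (hpos : ∀ x, ∀ v ∈ E i x, ∀ w ∈ E j x, v ≠ 0 → w ≠ 0 → 0 < G x v w) :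
    ∃ C > 0, ∀ x, ∀ v ∈ E i x, ∀ w ∈ E j x, ‖v‖ * ‖w‖ ≤ C * G x v w := by
  have hG0 : ∀ x, ∀ v ∈ E i x, ∀ w ∈ E j x, 0 ≤ G x v w := by
    intro x v hv w hw
    by_cases hv0 : v = 0
    · have := hG x 0 w 0 1 le_rfl zero_le_one
      rw [zero_smul, one_smul, zero_mul, zero_mul] at this
      rw [hv0, this]
    by_cases hw0 : w = 0
    · have := hG x v 0 1 0 zero_le_one le_rfl
      rw [smul_zero, one_smul, mul_zero, zero_mul] at this
      rw [hw0, this]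
    exact (hpos x v hv w hw hv0 hw0).le
  refine exists_forall_of_eventually
    (P := fun C x => ∀ v ∈ E i x, ∀ w ∈ E j x, ‖v‖ * ‖w‖ ≤ C * G x v w)
    (fun x C C' hC H v hv w hw => (H v hv w hw).trans
      (mul_le_mul_of_nonneg_right hC (hG0 x v hv w hw))) fun p => ?_
  set F := EuclideanSpace ℝ (Fin n)
  set K : Set (F × F) := Metric.sphere 0 1 ×ˢ Metric.sphere 0 1
  have hK : IsCompact K := (isCompact_sphere 0 1).prod (isCompact_sphere 0 1)
  have hsrc : (extChartAt (𝓡 n) p).source ∈ 𝓝 p := extChartAt_source_mem_nhds p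
  have hp := mem_extChartAt_source (I := 𝓡 n) p
  let B : ι → M → F →L[ℝ] F := fun i x => (chartTo p x) ∘L (pr i x) ∘L (chartFrom p x)
  have hB : ∀ i (a : F), ContinuousAt (fun q : M × F => B i q.1 q.2 - q.2) (p, a) := fun i a =>
    ((((h.continuousOn i p).continuousAt hsrc).comp (f := Prod.fst) (x := (p, a))
      continuousAt_fst).clm_apply continuousAt_snd).sub continuousAt_snd
  have hBE : ∀ i x (a : F), x ∈ (extChartAt (𝓡 n) p).source → (chartFrom p x a ∈ E i x ↔
      B i x a - a = 0) := by
    intro i x a hx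
    rw [h.mem_iff, sub_eq_zero]
    refine ⟨fun H => ?_, fun H => ?_⟩
    · change chartTo p x (pr i x (chartFrom p x a)) = a
      rw [H, chartTo_chartFrom hx]
    · rw [← chartFrom_chartTo hx (pr i x (chartFrom p x a))]
      exact congrArg (chartFrom p x) H
  -- Lying in a subbundle is the closed condition `B i x a - a = 0`. Compactness of the product of
  -- unit spheres then gives one positive lower bound for all `x` near `p`.
  have key : ∀ᶠ q : ℝ × M in 𝓝 (0, p), ∀ a ∈ K, B i q.2 a.1 - a.1 = 0 → B j q.2 a.2 - a.2 = 0 →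
      q.1 < G q.2 (chartFrom p q.2 a.1) (chartFrom p q.2 a.2) := by
    refine hK.eventually_forall_of_forall_eventually ?_
    rintro ⟨a, b⟩ ⟨ha, hb⟩
    by_cases h1 : B i p a - a = 0
    · by_cases h2 : B j p b - b = 0
      · have h3 := (hGc p).continuousAt (x := (p, a, b)) (by
          rw [nhds_prod_eq]; exact prod_mem_prod hsrc univ_mem)
        have e1 : Tendsto (fun q : (ℝ × M) × F × F => (q.1.2, q.2)) (𝓝 ((0, p), a, b))
            (𝓝 (p, a, b)) := Continuous.tendsto (by fun_prop) ((0, p), a, b)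
        have e2 : Tendsto (fun q : (ℝ × M) × F × F => q.1.1) (𝓝 ((0, p), a, b))
            (𝓝 0) := Continuous.tendsto (by fun_prop) ((0, p), a, b)
        have hne : ∀ c ∈ Metric.sphere (0 : F) 1, chartFrom p p c ≠ 0 := fun c hc h0 => by
          have : c = 0 := by rw [← chartTo_chartFrom hp c, h0, map_zero]
          rw [this] at hc; simp at hc
        have h4 := hpos p _ ((hBE i p a hp).2 h1) _ ((hBE j p b hp).2 h2) (hne a ha) (hne b hb)
        filter_upwards [(e2.eventually_lt (h3.tendsto.comp e1) h4)] with q hq _ _ using hq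
      · have e1 : Tendsto (fun q : (ℝ × M) × F × F => (q.1.2, q.2.2)) (𝓝 ((0, p), a, b))
            (𝓝 (p, b)) := Continuous.tendsto (by fun_prop) ((0, p), a, b)
        filter_upwards [((hB j b).tendsto.comp e1).eventually_ne h2] with q hq _ h0
        exact absurd h0 hq
    · have e1 : Tendsto (fun q : (ℝ × M) × F × F => (q.1.2, q.2.1)) (𝓝 ((0, p), a, b))
          (𝓝 (p, a)) := Continuous.tendsto (by fun_prop) ((0, p), a, b)
      filter_upwards [((hB i a).tendsto.comp e1).eventually_ne h1] with q hq h0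
      exact absurd h0 hq
  rw [nhds_prod_eq] at key
  obtain ⟨Q1, hQ1, Q2, hQ2, H⟩ := eventually_prod_iff.1 key
  obtain ⟨c, hc, hc0⟩ := (hQ1.filter_mono nhdsWithin_le_nhds |>.and
    (self_mem_nhdsWithin (a := (0 : ℝ)) (s := Ioi 0))).exists
  obtain ⟨C, hC, hCe⟩ := eventually_norm_chart_le (n := n) p
  have hc0' : 0 < c := hc0
  refine ⟨C * C / c, ?_⟩
  filter_upwards [hQ2, hsrc, hCe] with x hx hxs hCx v hv w hw
  by_cases hv0 : v = 0
  · have := hG x 0 w 0 1 le_rfl zero_le_one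
    rw [zero_smul, one_smul, zero_mul, zero_mul] at this
    rw [hv0, this, norm_zero, zero_mul, mul_zero]
  by_cases hw0 : w = 0
  · have := hG x v 0 1 0 zero_le_one le_rfl
    rw [smul_zero, one_smul, mul_zero, zero_mul] at this
    rw [hw0, this, norm_zero, mul_zero, mul_zero]
  set a := chartTo p x v with ha
  set b := chartTo p x w with hb
  have hva : chartFrom p x a = v := chartFrom_chartTo hxs v
  have hwb : chartFrom p x b = w := chartFrom_chartTo hxs w
  have ha0 : 0 < ‖a‖ := norm_pos_iff.2 fun h0 => hv0 (by rw [← hva, h0, map_zero])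
  have hb0 : 0 < ‖b‖ := norm_pos_iff.2 fun h0 => hw0 (by rw [← hwb, h0, map_zero])
  have hs : ∀ i (y : F), chartFrom p x y ∈ E i x → B i x (‖y‖⁻¹ • y) - ‖y‖⁻¹ • y = 0 :=
    fun i y hy => by
      rw [map_smul, ← smul_sub, (hBE i x y hxs).1 hy, smul_zero]
  have h5 := H hc hx (‖a‖⁻¹ • a, ‖b‖⁻¹ • b) ⟨by
      rw [mem_sphere_zero_iff_norm, norm_smul, norm_inv, norm_norm, inv_mul_cancel₀ ha0.ne'], by
      rw [mem_sphere_zero_iff_norm, norm_smul, norm_inv, norm_norm, inv_mul_cancel₀ hb0.ne']⟩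
    (hs i a (hva.symm ▸ hv)) (hs j b (hwb.symm ▸ hw))
  simp only [map_smul] at h5
  rw [hG _ _ _ _ _ (by positivity) (by positivity), hva, hwb] at h5
  have h6 : c * (‖a‖ * ‖b‖) ≤ G x v w := by
    calc c * (‖a‖ * ‖b‖) ≤ ‖a‖⁻¹ * ‖b‖⁻¹ * G x v w * (‖a‖ * ‖b‖) :=
          mul_le_mul_of_nonneg_right h5.le (by positivity)
      _ = _ := by field_simp
  have h7 : ‖v‖ ≤ C * ‖a‖ := by rw [← hva]; exact hCx.2 a
  have h8 : ‖w‖ ≤ C * ‖b‖ := by rw [← hwb]; exact hCx.2 b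
  calc ‖v‖ * ‖w‖ ≤ C * ‖a‖ * (C * ‖b‖) := mul_le_mul h7 h8 (norm_nonneg _) (by positivity)
    _ = C * C / c * (c * (‖a‖ * ‖b‖)) := by field_simp
    _ ≤ _ := mul_le_mul_of_nonneg_left h6 (by positivity)

end IsProjectionFamily
end projections

/-! ### Uniform domination and invariant cones. -/

section cones
open Filter
variable {n : ℕ} {M : Type*} [TopologicalSpace M] [ChartedSpace (EuclideanSpace ℝ (Fin n)) M]
  [IsManifold (𝓡 n) ∞ M] [RiemannianBundle (fun x : M => TangentSpace (𝓡 n) x)]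
  [IsContinuousRiemannianBundle (EuclideanSpace ℝ (Fin n)) (fun x : M => TangentSpace (𝓡 n) x)]
  {V : Type*} [NormedAddCommGroup V] [InnerProductSpace ℝ V] [FiniteDimensional ℝ V]
  {ι : Type*} [Fintype ι] [DecidableEq ι]
  {e : M → V} {L : (x : M) → V →ₗ[ℝ] TangentSpace (𝓡 n) x} {C : ℝ}
  {E : ι → (x : M) → Submodule ℝ (TangentSpace (𝓡 n) x)}
  {pr : ι → (x : M) → TangentSpace (𝓡 n) x →L[ℝ] TangentSpace (𝓡 n) x}

theorem continuousOn_norm_mfderiv_chartFrom {f : M → M} (hf : ContMDiff (𝓡 n) (𝓡 n) 1 f) (p : M) :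
    ContinuousOn (fun q : M × EuclideanSpace ℝ (Fin n) =>
      ‖mfderiv (𝓡 n) (𝓡 n) f q.1 (chartFrom p q.1 q.2)‖)
      ((extChartAt (𝓡 n) p).source ×ˢ univ) := by
  have h1 : Continuous fun v : TangentBundle (𝓡 n) M => ‖(tangentMap (𝓡 n) (𝓡 n) f v).2‖ :=
    continuous_norm_tangentBundle.comp (hf.continuous_tangentMap le_rfl)
  have h2 := h1.comp_continuousOn (continuousOn_chartFrom p)
  exact h2

theorem continuousOn_norm_chartFrom (p : M) :
    ContinuousOn (fun q : M × EuclideanSpace ℝ (Fin n) => ‖chartFrom p q.1 q.2‖)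
      ((extChartAt (𝓡 n) p).source ×ˢ univ) := by
  have h1 : Continuous fun v : TangentBundle (𝓡 n) M => ‖v.2‖ := continuous_norm_tangentBundle
  have h2 := h1.comp_continuousOn (continuousOn_chartFrom p)
  exact h2

theorem IsLeftInverseFamily.exists_norm_mfderiv_le [CompactSpace M]
    (hL : IsLeftInverseFamily e L C) {f : M → M} (hf : ContMDiff (𝓡 n) (𝓡 n) 1 f) :
    ∃ K > 0, ∀ (x : M) (v : TangentSpace (𝓡 n) x), ‖mfderiv (𝓡 n) (𝓡 n) f x v‖ ≤ K * ‖v‖ := by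
  obtain ⟨K, hK, H⟩ := exists_norm_vderiv_le (hL.contMDiff.comp hf)
  have hC := hL.pos
  refine ⟨C * K, by positivity, fun x v => ?_⟩
  have h1 : vderiv (e ∘ f) x v = vderiv e (f x) (mfderiv (𝓡 n) (𝓡 n) f x v) := by
    have := mfderiv_comp x ((hL.contMDiff (f x)).mdifferentiableAt one_ne_zero)
      ((hf x).mdifferentiableAt one_ne_zero)
    exact congrArg (fun A => A v) this
  calc _ = ‖L (f x) (vderiv (e ∘ f) x v)‖ := by rw [h1, hL.apply_vderiv]
    _ ≤ C * (K * ‖v‖) := (hL.norm_le _ _).trans (mul_le_mul_of_nonneg_left (H x v) hC.le)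
    _ = _ := by ring

set_option maxHeartbeats 1000000 in
/-- Pointwise domination is uniform. -/
theorem IsProjectionFamily.exists_domination [CompactSpace M] (h : IsProjectionFamily E pr)
    (hL : IsLeftInverseFamily e L C) {f g : M → M} (hf : ContMDiff (𝓡 n) (𝓡 n) 1 f)
    (hg : ContMDiff (𝓡 n) (𝓡 n) 1 g) (i j : ι)
    (hlt : ∀ x, ∀ v ∈ E i x, ∀ w ∈ E j x, ‖v‖ = 1 → ‖w‖ = 1 →
      ‖mfderiv (𝓡 n) (𝓡 n) f x v‖ < ‖mfderiv (𝓡 n) (𝓡 n) g x w‖) :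
    ∃ κ > 0, κ < 1 ∧ ∀ x, ∀ v ∈ E i x, ∀ w ∈ E j x,
      ‖mfderiv (𝓡 n) (𝓡 n) f x v‖ * ‖w‖ ≤ κ * (‖mfderiv (𝓡 n) (𝓡 n) g x w‖ * ‖v‖) := by
  obtain ⟨K, hK, HK⟩ := hL.exists_norm_mfderiv_le hf
  obtain ⟨C₁, hC₁, H⟩ := h.exists_norm_mul_norm_le i j
    (fun x v w => ‖mfderiv (𝓡 n) (𝓡 n) g x w‖ * ‖v‖ - ‖mfderiv (𝓡 n) (𝓡 n) f x v‖ * ‖w‖)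
    (fun x v w s t hs ht => by
      simp only [map_smul, norm_smul, Real.norm_eq_abs, abs_of_nonneg hs, abs_of_nonneg ht]; ring)
    (fun p => by
      have m1 : MapsTo (fun q : M × EuclideanSpace ℝ (Fin n) × EuclideanSpace ℝ (Fin n) =>
          (q.1, q.2.1)) ((extChartAt (𝓡 n) p).source ×ˢ univ)
          ((extChartAt (𝓡 n) p).source ×ˢ univ) := fun q hq => ⟨hq.1, trivial⟩
      have m2 : MapsTo (fun q : M × EuclideanSpace ℝ (Fin n) × EuclideanSpace ℝ (Fin n) =>
          (q.1, q.2.2)) ((extChartAt (𝓡 n) p).source ×ˢ univ)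
          ((extChartAt (𝓡 n) p).source ×ˢ univ) := fun q hq => ⟨hq.1, trivial⟩
      have c1 : ContinuousOn (fun q : M × EuclideanSpace ℝ (Fin n) × EuclideanSpace ℝ (Fin n) =>
          (q.1, q.2.1)) ((extChartAt (𝓡 n) p).source ×ˢ univ) := by fun_prop
      have c2 : ContinuousOn (fun q : M × EuclideanSpace ℝ (Fin n) × EuclideanSpace ℝ (Fin n) =>
          (q.1, q.2.2)) ((extChartAt (𝓡 n) p).source ×ˢ univ) := by fun_prop
      have d1 := (continuousOn_norm_mfderiv_chartFrom hg p).comp c2 m2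
      have d2 := (continuousOn_norm_chartFrom p).comp c1 m1
      have d3 := (continuousOn_norm_mfderiv_chartFrom hf p).comp c1 m1
      have d4 := (continuousOn_norm_chartFrom p).comp c2 m2
      exact (d1.mul d2).sub (d3.mul d4))
    (fun x v hv w hw hv0 hw0 => by
      have hv1 := norm_pos_iff.2 hv0
      have hw1 := norm_pos_iff.2 hw0
      have := hlt x (‖v‖⁻¹ • v) ((E i x).smul_mem _ hv) (‖w‖⁻¹ • w) ((E j x).smul_mem _ hw)
        (by rw [norm_smul, norm_inv, norm_norm, inv_mul_cancel₀ hv1.ne'])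
        (by rw [norm_smul, norm_inv, norm_norm, inv_mul_cancel₀ hw1.ne'])
      rw [map_smul, map_smul, norm_smul, norm_smul, norm_inv, norm_norm, norm_inv, norm_norm,
        inv_mul_eq_div, inv_mul_eq_div, div_lt_div_iff₀ hv1 hw1] at this
      exact sub_pos.2 this)
  -- With `t` the left side and `g` the product on the right, `t ≤ K * ‖v‖ * ‖w‖ ≤ K * C₁ * (g -
  -- t)`; solving for `t` gives this ratio.
  refine ⟨K * C₁ / (1 + K * C₁), by positivity, (div_lt_one (by positivity)).2 (lt_one_add _),
    fun x v hv w hw => ?_⟩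
  have h1 := H x v hv w hw
  have h2 : ‖mfderiv (𝓡 n) (𝓡 n) f x v‖ * ‖w‖ ≤ K * (‖v‖ * ‖w‖) :=
    (mul_le_mul_of_nonneg_right (HK x v) (norm_nonneg _)).trans_eq (by ring)
  have h3 := h2.trans (mul_le_mul_of_nonneg_left h1 hK.le)
  rw [div_mul_eq_mul_div, le_div_iff₀ (by positivity)]
  linarith

/-- The size of the `i`-th component of the difference of two points, seen from a third one. -/
noncomputable def splitDist (e : M → V) (L : (x : M) → V →ₗ[ℝ] TangentSpace (𝓡 n) x)
    (pr : ι → (x : M) → TangentSpace (𝓡 n) x →L[ℝ] TangentSpace (𝓡 n) x) (i : ι) (x y z : M) : ℝ :=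
  ‖pr i x (L x (e z - e y))‖

theorem IsProjectionFamily.norm_le_card_mul (h : IsProjectionFamily E pr) {x : M}
    {v : TangentSpace (𝓡 n) x} {m : ℝ} (hm : ∀ i, ‖pr i x v‖ ≤ m) :
    ‖v‖ ≤ Fintype.card ι * m := by
  conv_lhs => rw [← h.sum_apply x v]
  refine (norm_sum_le _ _).trans ((Finset.sum_le_sum fun i _ => hm i).trans_eq ?_)
  rw [Finset.sum_const, nsmul_eq_mul, Finset.card_univ]

/-- Cone invariance and expansion along a dominating direction. -/
theorem IsProjectionFamily.exists_cone [CompactSpace M] (h : IsProjectionFamily E pr)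
    (hL : IsLeftInverseFamily e L C) {f : M → M} (hf : ContMDiff (𝓡 n) (𝓡 n) 1 f)
    (hinv : ∀ i x, ∀ v ∈ E i x, mfderiv (𝓡 n) (𝓡 n) f x v ∈ E i (f x)) (u : ι) {κ₀ κ : ℝ}
    (hκ₀ : 0 < κ₀) (hκ : κ₀ < κ) (hκ1 : κ < 1)
    (hdom : ∀ j, j ≠ u → ∀ x, ∀ v ∈ E j x, ∀ w ∈ E u x,
      ‖mfderiv (𝓡 n) (𝓡 n) f x v‖ * ‖w‖ ≤ κ₀ * (‖mfderiv (𝓡 n) (𝓡 n) f x w‖ * ‖v‖))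
    (hexp : ∀ x, ∀ w ∈ E u x, ‖w‖ ≤ κ₀ * ‖mfderiv (𝓡 n) (𝓡 n) f x w‖) :
    ∃ r > 0, ∀ x a b, ‖e a - e x‖ ≤ r → ‖e b - e x‖ ≤ r →
      (∀ j, j ≠ u → splitDist e L pr j x a b ≤ splitDist e L pr u x a b) →
      (∀ j, j ≠ u → splitDist e L pr j (f x) (f a) (f b) ≤
        κ * splitDist e L pr u (f x) (f a) (f b)) ∧
      splitDist e L pr u x a b ≤ κ * splitDist e L pr u (f x) (f a) (f b) := by
  obtain ⟨Cp, hCp, HCp⟩ : ∃ Cp > 0, ∀ i (x : M) (v : TangentSpace (𝓡 n) x),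
      ‖pr i x v‖ ≤ Cp * ‖v‖ := by
    choose D hD HD using fun i => h.exists_norm_le i
    refine ⟨1 + ∑ i, D i, by have := Finset.sum_nonneg fun i (_ : i ∈ Finset.univ) => (hD i).le
                             linarith, fun i x v => (HD i x v).trans ?_⟩
    refine mul_le_mul_of_nonneg_right ?_ (norm_nonneg _)
    have := Finset.single_le_sum (fun i _ => (hD i).le) (Finset.mem_univ i)
    linarith
  have hC := hL.pos
  have hcard : (0 : ℝ) < Fintype.card ι := by
    have : 0 < Fintype.card ι := Fintype.card_pos_iff.2 ⟨u⟩
    exact_mod_cast this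
  -- This choice gives `κ₀ + ε' ≤ κ * (1 - ε')`, which leaves room for the linearisation error in
  -- every component.
  set ε' := (κ - κ₀) / 2 with hε'
  have hε'0 : 0 < ε' := by linarith
  set D : ℝ := Cp * (2 * C * Fintype.card ι)
  have hD : 0 < D := by positivity
  obtain ⟨δ₁, hδ₁, H₁⟩ := hL.exists_le_norm
  obtain ⟨δ₂, hδ₂, H₂⟩ := hL.exists_map_approx hf (ε := ε' / D) (by positivity)
  refine ⟨min δ₁ δ₂, lt_min hδ₁ hδ₂, fun x a b ha hb hcone => ?_⟩
  unfold splitDist at hcone ⊢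
  have h1 := H₁ x a b (ha.trans (min_le_left _ _)) (hb.trans (min_le_left _ _))
  have h2 := H₂ x a b (ha.trans (min_le_right _ _)) (hb.trans (min_le_right _ _))
  set w := L x (e b - e a)
  set w' := L (f x) (e (f b) - e (f a))
  set m := ‖pr u x w‖
  have hm : 0 ≤ m := norm_nonneg _
  -- In the cone the component along `u` controls the whole vector, so an error relative to `‖w‖` is
  -- an error relative to `m`; `D` collects the constants.
  have hw : ‖w‖ ≤ Fintype.card ι * m := h.norm_le_card_mul fun i => by
    by_cases hi : i = u
    · rw [hi]
    · exact hcone i hi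
  have h3 : ∀ i, ‖pr i (f x) w' - mfderiv (𝓡 n) (𝓡 n) f x (pr i x w)‖ ≤ ε' * m := fun i => by
    rw [← h.map_apply (fun i v hv => hinv i x v hv) i w, ← map_sub]
    calc _ ≤ Cp * (ε' / D * (2 * C * (Fintype.card ι * m))) :=
          (HCp i _ _).trans (mul_le_mul_of_nonneg_left (h2.trans (mul_le_mul_of_nonneg_left
            (h1.trans (mul_le_mul_of_nonneg_left hw (by positivity))) (by positivity))) hCp.le)
      _ = ε' * m * (D / D) := by ring
      _ = _ := by rw [div_self hD.ne', mul_one]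
  set A := ‖mfderiv (𝓡 n) (𝓡 n) f x (pr u x w)‖
  have hmA : m ≤ κ₀ * A := hexp x _ (h.mem u x w)
  have hA : 0 ≤ A := norm_nonneg _
  have hmA' : m ≤ A := hmA.trans (by nlinarith)
  have hu : A - ε' * m ≤ ‖pr u (f x) w'‖ := by
    have := (norm_sub_norm_le (mfderiv (𝓡 n) (𝓡 n) f x (pr u x w)) (pr u (f x) w')).trans
      ((norm_sub_rev _ _).trans_le (h3 u))
    linarith
  have hA' : (1 - ε') * A ≤ ‖pr u (f x) w'‖ := by nlinarith
  have hκA : (κ₀ + ε') * A ≤ κ * ‖pr u (f x) w'‖ := by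
    calc (κ₀ + ε') * A ≤ κ * ((1 - ε') * A) := by
          rw [← mul_assoc]
          exact mul_le_mul_of_nonneg_right (by nlinarith) hA
      _ ≤ _ := mul_le_mul_of_nonneg_left hA' (by linarith)
  refine ⟨fun j hj => ?_, hmA.trans ((by nlinarith : κ₀ * A ≤ (κ₀ + ε') * A).trans hκA)⟩
  have h4 : ‖mfderiv (𝓡 n) (𝓡 n) f x (pr j x w)‖ ≤ κ₀ * A := by
    have h5 := hdom j hj x _ (h.mem j x w) _ (h.mem u x w)
    have h6 := hcone j hj
    rcases hm.eq_or_lt with hm0 | hm0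
    · rw [← hm0] at h6
      have : pr j x w = 0 := norm_le_zero_iff.1 h6
      rw [this, map_zero, norm_zero]
      positivity
    · have : ‖mfderiv (𝓡 n) (𝓡 n) f x (pr j x w)‖ * m ≤ (κ₀ * A) * m :=
        h5.trans ((mul_le_mul_of_nonneg_left (mul_le_mul_of_nonneg_left h6 hA) hκ₀.le).trans_eq
          (by ring))
      exact le_of_mul_le_mul_right this hm0
  have h7 := (norm_sub_norm_le (pr j (f x) w') (mfderiv (𝓡 n) (𝓡 n) f x (pr j x w))).trans (h3 j)
  refine le_trans ?_ hκA
  nlinarith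

end cones

/-! ### The cone system of a partially hyperbolic diffeomorphism. -/

section hyperbolic
variable {n : ℕ} {M : Type*} [TopologicalSpace M] [ChartedSpace (EuclideanSpace ℝ (Fin n)) M]
  [IsManifold (𝓡 n) ∞ M] [RiemannianBundle (fun x : M => TangentSpace (𝓡 n) x)]
  {f : M ≃ₘ^1⟮𝓡 n, 𝓡 n⟯ M}

theorem norm_mfderiv_mfderiv_symm (f : M ≃ₘ^1⟮𝓡 n, 𝓡 n⟯ M) (x : M) (v : TangentSpace (𝓡 n) x) :
    ‖mfderiv (𝓡 n) (𝓡 n) f (f.symm x) (mfderiv (𝓡 n) (𝓡 n) f.symm x v)‖ = ‖v‖ := by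
  -- Working with an arbitrary `g = id` avoids transporting vectors between the tangent spaces at `f
  -- (f.symm x)` and `x`.
  have h1 : ∀ g : M → M, g = id → ‖mfderiv (𝓡 n) (𝓡 n) g x v‖ = ‖v‖ := by
    rintro _ rfl; rw [mfderiv_id]; rfl
  have h2 := h1 (f ∘ f.symm) (funext f.apply_symm_apply)
  have h3 := mfderiv_comp x ((f.contMDiff_toFun (f.symm x)).mdifferentiableAt one_ne_zero)
      ((f.symm.contMDiff_toFun x).mdifferentiableAt one_ne_zero)
  exact (congrArg (fun A : TangentSpace (𝓡 n) x →L[ℝ] TangentSpace (𝓡 n) (f (f.symm x)) =>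
    ‖A v‖) h3).symm.trans h2

theorem mfderiv_symm_mem {E : (x : M) → Submodule ℝ (TangentSpace (𝓡 n) x)}
    (hE : ∀ x, (E x).map (mfderiv (𝓡 n) (𝓡 n) f x).toLinearMap = E (f x)) (x : M)
    (v : TangentSpace (𝓡 n) x) (hv : v ∈ E x) : mfderiv (𝓡 n) (𝓡 n) f.symm x v ∈ E (f.symm x) := by
  obtain ⟨y, rfl⟩ := f.surjective x
  change v ∈ E (f y) at hv
  rw [← hE y] at hv
  obtain ⟨w, hw, rfl⟩ := hv
  have h1 : ∀ g : M → M, g = id → mfderiv (𝓡 n) (𝓡 n) g y w ∈ E (g y) := by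
    rintro _ rfl; rw [mfderiv_id]; exact hw
  have h2 := h1 (f.symm ∘ f) (funext f.symm_apply_apply)
  have h3 := mfderiv_comp y ((f.symm.contMDiff_toFun (f y)).mdifferentiableAt one_ne_zero)
      ((f.contMDiff_toFun y).mdifferentiableAt one_ne_zero)
  exact (congrArg (fun A : TangentSpace (𝓡 n) y →L[ℝ] TangentSpace (𝓡 n) (f.symm (f y)) =>
    A w ∈ E (f.symm (f y))) h3).mp h2

/-- The invariant splitting of a partially hyperbolic diffeomorphism. -/
def hyperbolicSplitting (Es Ec Eu : (x : M) → Submodule ℝ (TangentSpace (𝓡 n) x)) (i : Fin 3)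
    (x : M) : Submodule ℝ (TangentSpace (𝓡 n) x) := ![Es x, Ec x, Eu x] i

variable {Es Ec Eu : (x : M) → Submodule ℝ (TangentSpace (𝓡 n) x)}

theorem IsPartiallyHyperbolic.exists_isProjectionFamily (hf : IsPartiallyHyperbolic f Es Ec Eu) :
    ∃ pr, IsProjectionFamily (hyperbolicSplitting Es Ec Eu) pr :=
  _root_.exists_isProjectionFamily hf.splitting fun i => by
    fin_cases i
    exacts [hf.continuous_s, hf.continuous_c, hf.continuous_u]

theorem IsPartiallyHyperbolic.map_eq (hf : IsPartiallyHyperbolic f Es Ec Eu) (i : Fin 3) (x : M) :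
    (hyperbolicSplitting Es Ec Eu i x).map (mfderiv (𝓡 n) (𝓡 n) f x).toLinearMap =
      hyperbolicSplitting Es Ec Eu i (f x) := by
  fin_cases i
  exacts [hf.invariant_s x, hf.invariant_c x, hf.invariant_u x]

variable [CompactSpace M]
  [IsContinuousRiemannianBundle (EuclideanSpace ℝ (Fin n)) (fun x : M => TangentSpace (𝓡 n) x)]
  {V : Type*} [NormedAddCommGroup V] [InnerProductSpace ℝ V] [FiniteDimensional ℝ V]
  {e : M → V} {L : (x : M) → V →ₗ[ℝ] TangentSpace (𝓡 n) x} {C : ℝ}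
  {pr : Fin 3 → (x : M) → TangentSpace (𝓡 n) x →L[ℝ] TangentSpace (𝓡 n) x}

/-- Compactness makes the four pointwise inequalities uniform. The cone estimate is then applied to
`f` along the unstable index and to `f.symm` along the stable one. -/
theorem IsPartiallyHyperbolic.exists_coneSystem (hf : IsPartiallyHyperbolic f Es Ec Eu)
    (hL : IsLeftInverseFamily e L C)
    (h : IsProjectionFamily (hyperbolicSplitting Es Ec Eu) pr) :
    ∃ r κ C', ConeSystem f.toEquiv (fun x y => ‖e y - e x‖) (splitDist e L pr 0)
      (splitDist e L pr 1) (splitDist e L pr 2) r κ C' := by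
  have hf1 : ContMDiff (𝓡 n) (𝓡 n) 1 f := f.contMDiff_toFun
  have hf2 : ContMDiff (𝓡 n) (𝓡 n) 1 f.symm := f.symm.contMDiff_toFun
  have hid : ContMDiff (𝓡 n) (𝓡 n) 1 (id : M → M) := contMDiff_id
  have hide : ∀ (x : M) (v : TangentSpace (𝓡 n) x), mfderiv (𝓡 n) (𝓡 n) (id : M → M) x v = v :=
    fun x v => by rw [mfderiv_id]; rfl
  obtain ⟨κ₁, hκ₁, hκ₁', H₁⟩ := h.exists_domination hL hf1 hf1 0 1 hf.lt_sc
  obtain ⟨κ₂, hκ₂, hκ₂', H₂⟩ := h.exists_domination hL hf1 hf1 1 2 hf.lt_cu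
  -- Contraction is treated as domination of `f` by the identity on a single bundle; putting `w = v`
  -- below recovers it.
  obtain ⟨κ₃, hκ₃, hκ₃', H₃⟩ := h.exists_domination hL hf1 hid 0 0 fun x v hv w hw hv1 hw1 => by
    rw [hide]; exact (hf.contracting_s x v hv hv1).trans_eq hw1.symm
  obtain ⟨κ₄, hκ₄, hκ₄', H₄⟩ := h.exists_domination hL hid hf1 2 2 fun x v hv w hw hv1 hw1 => by
    rw [hide]; exact hv1.trans_lt (hf.expanding_u x w hw hw1)
  replace H₃ : ∀ x, ∀ v ∈ hyperbolicSplitting Es Ec Eu 0 x,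
      ‖mfderiv (𝓡 n) (𝓡 n) f x v‖ ≤ κ₃ * ‖v‖ := fun x v hv => by
    by_cases hv0 : v = 0
    · rw [hv0, map_zero, norm_zero, norm_zero, mul_zero]
    have := H₃ x v hv v hv
    rw [hide, ← mul_assoc] at this
    exact le_of_mul_le_mul_right this (norm_pos_iff.2 hv0)
  replace H₄ : ∀ x, ∀ v ∈ hyperbolicSplitting Es Ec Eu 2 x,
      ‖v‖ ≤ κ₄ * ‖mfderiv (𝓡 n) (𝓡 n) f x v‖ := fun x v hv => by
    by_cases hv0 : v = 0
    · rw [hv0, map_zero, norm_zero, norm_zero, mul_zero]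
    have := H₄ x v hv v hv
    rw [hide, ← mul_assoc] at this
    exact le_of_mul_le_mul_right this (norm_pos_iff.2 hv0)
  set κ₀ := max (max κ₁ κ₂) (max κ₃ κ₄) with hκ₀
  have l1 : κ₁ ≤ κ₀ := (le_max_left _ _).trans (le_max_left _ _)
  have l2 : κ₂ ≤ κ₀ := (le_max_right _ _).trans (le_max_left _ _)
  have l3 : κ₃ ≤ κ₀ := (le_max_left _ _).trans (le_max_right _ _)
  have l4 : κ₄ ≤ κ₀ := (le_max_right _ _).trans (le_max_right _ _)
  have h0 : 0 < κ₀ := hκ₁.trans_le l1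
  have h1 : κ₀ < 1 := max_lt (max_lt hκ₁' hκ₂') (max_lt hκ₃' hκ₄')
  -- Stable against unstable is deduced from contraction and expansion, not through `Ec`, which may
  -- be zero.
  have H₅ : ∀ x, ∀ v ∈ hyperbolicSplitting Es Ec Eu 0 x,
      ∀ w ∈ hyperbolicSplitting Es Ec Eu 2 x,
      ‖mfderiv (𝓡 n) (𝓡 n) f x v‖ * ‖w‖ ≤ κ₀ * (‖mfderiv (𝓡 n) (𝓡 n) f x w‖ * ‖v‖) :=
    fun x v hv w hw => by
      calc _ ≤ (κ₃ * ‖v‖) * (κ₄ * ‖mfderiv (𝓡 n) (𝓡 n) f x w‖) :=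
            mul_le_mul (H₃ x v hv) (H₄ x w hw) (norm_nonneg _) (by positivity)
        _ ≤ (1 * ‖v‖) * (κ₀ * ‖mfderiv (𝓡 n) (𝓡 n) f x w‖) := by gcongr
        _ = _ := by ring
  obtain ⟨r₁, hr₁, R₁⟩ := h.exists_cone hL hf1
    (fun i x v hv => hf.map_eq i x ▸ Submodule.mem_map_of_mem hv) 2 (κ₀ := κ₀)
    (κ := (1 + κ₀) / 2) h0 (by linarith) (by linarith)
    (fun j hj x v hv w hw => by
      fin_cases j
      · exact H₅ x v hv w hw
      · exact (H₂ x v hv w hw).trans (mul_le_mul_of_nonneg_right l2 (by positivity))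
      · exact absurd rfl hj)
    (fun x w hw => (H₄ x w hw).trans (mul_le_mul_of_nonneg_right l4 (norm_nonneg _)))
  have hinv := fun i => mfderiv_symm_mem (hf.map_eq i)
  obtain ⟨r₂, hr₂, R₂⟩ := h.exists_cone hL hf2 hinv 0 (κ₀ := κ₀)
    (κ := (1 + κ₀) / 2) h0 (by linarith) (by linarith)
    (fun j hj x v hv w hw => by
      have N := norm_mfderiv_mfderiv_symm f x
      fin_cases j
      · exact absurd rfl hj
      · have := H₁ (f.symm x) _ (hinv 0 x w hw) _ (hinv 1 x v hv)
        rw [N, N, mul_comm, mul_comm ‖v‖] at this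
        exact this.trans (mul_le_mul_of_nonneg_right l1 (by positivity))
      · have := H₅ (f.symm x) _ (hinv 0 x w hw) _ (hinv 2 x v hv)
        rw [N, N, mul_comm, mul_comm ‖v‖] at this
        exact this)
    (fun x w hw => by
      have := H₃ (f.symm x) _ (hinv 0 x w hw)
      rw [norm_mfderiv_mfderiv_symm] at this
      exact this.trans (mul_le_mul_of_nonneg_right l3 (norm_nonneg _)))
  obtain ⟨r₃, hr₃, R₃⟩ := hL.exists_le_norm
  obtain ⟨B, hB⟩ := (isCompact_range hL.contMDiff.continuous).isBounded.exists_norm_le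
  choose D hD HD using fun i => h.exists_norm_le i
  have hC := hL.pos
  -- The summands serve `1 ≤ C'`, the bound on `ρ`, the bounds on the components, and the lower
  -- bound by the three components.
  set C' := 1 + 2 * |B| + (D 0 + D 1 + D 2) * C + 6 * C
  have hDi : ∀ i, D i ≤ D 0 + D 1 + D 2 := fun i => by
    have := hD 0
    have := hD 1
    have := hD 2
    fin_cases i <;> simp <;> linarith
  have hDC : 0 < (D 0 + D 1 + D 2) * C :=
    mul_pos (add_pos (add_pos (hD 0) (hD 1)) (hD 2)) hC
  have hcomm : ∀ i x a b, splitDist e L pr i x a b = splitDist e L pr i x b a := fun i x a b => by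
    rw [splitDist, splitDist, ← neg_sub, map_neg, map_neg, norm_neg]
  have htri : ∀ i x a b d, splitDist e L pr i x a b ≤
      splitDist e L pr i x a d + splitDist e L pr i x d b := fun i x a b d => by
    have : e b - e a = (e d - e a) + (e b - e d) := by abel
    rw [splitDist, splitDist, splitDist, this, map_add, map_add]
    exact norm_add_le _ _
  have hle : ∀ i x a b, splitDist e L pr i x a b ≤ C' * ‖e b - e a‖ := fun i x a b => by
    calc _ ≤ D i * (C * ‖e b - e a‖) :=
          (HD i _ _).trans (mul_le_mul_of_nonneg_left (hL.norm_le _ _) (hD i).le)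
      _ ≤ (D 0 + D 1 + D 2) * (C * ‖e b - e a‖) :=
          mul_le_mul_of_nonneg_right (hDi i) (by positivity)
      _ = (D 0 + D 1 + D 2) * C * ‖e b - e a‖ := by ring
      _ ≤ _ := mul_le_mul_of_nonneg_right (by simp only [C']; linarith [abs_nonneg B])
          (norm_nonneg _)
  refine ⟨min r₁ (min r₂ r₃), (1 + κ₀) / 2, C', lt_min hr₁ (lt_min hr₂ hr₃), by linarith,
    by linarith, by simp only [C']; linarith [abs_nonneg B], fun a b => norm_sub_rev _ _,
    fun a b d => ?_, fun a b => ?_, fun a => by simp, fun a b hab => ?_,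
    fun _ _ _ => norm_nonneg _, fun _ _ _ => norm_nonneg _, fun _ _ _ => norm_nonneg _,
    hcomm 0, hcomm 1, hcomm 2, htri 0, htri 1, htri 2, hle 0, hle 1, hle 2,
    fun x a b ha hb => ?_, fun x a b ha hb hs hc => ?_, fun x a b ha hb hu hc => ?_⟩
  · have := norm_sub_le_norm_sub_add_norm_sub (e b) (e d) (e a)
    simpa only [add_comm] using this
  · have := norm_sub_le (e b) (e a)
    have := hB _ (mem_range_self a)
    have := hB _ (mem_range_self b)
    have := le_abs_self B
    simp only [C']
    linarith
  · exact (hL.inj (sub_eq_zero.1 (norm_le_zero_iff.1 hab))).symm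
  · have h2 := R₃ x a b (ha.trans ((min_le_right _ _).trans (min_le_right _ _)))
      (hb.trans ((min_le_right _ _).trans (min_le_right _ _)))
    set m := max (max (splitDist e L pr 0 x a b) (splitDist e L pr 1 x a b))
      (splitDist e L pr 2 x a b) with hm
    have h3 : ‖L x (e b - e a)‖ ≤ Fintype.card (Fin 3) * m := h.norm_le_card_mul fun i => by
      fin_cases i
      · exact (le_max_left _ _).trans (le_max_left _ _)
      · exact (le_max_right _ _).trans (le_max_left _ _)
      · exact le_max_right _ _
    have hm0 : 0 ≤ m := le_max_of_le_right (norm_nonneg _)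
    rw [Fintype.card_fin, Nat.cast_ofNat] at h3
    calc ‖e b - e a‖ ≤ 2 * C * (3 * m) := h2.trans (mul_le_mul_of_nonneg_left h3 (by positivity))
      _ = 6 * C * m := by ring
      _ ≤ C' * m := mul_le_mul_of_nonneg_right (by simp only [C']; linarith [abs_nonneg B]) hm0
  · have := R₁ x a b (ha.trans (min_le_left _ _)) (hb.trans (min_le_left _ _)) fun j hj => by
      fin_cases j
      exacts [hs, hc, absurd rfl hj]
    exact ⟨this.1 0 (by decide), this.1 1 (by decide), this.2⟩
  · have := R₂ x a b (ha.trans ((min_le_right _ _).trans (min_le_left _ _)))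
      (hb.trans ((min_le_right _ _).trans (min_le_left _ _))) fun j hj => by
      fin_cases j
      exacts [absurd rfl hj, hc, hu]
    exact ⟨this.1 2 (by decide), this.1 1 (by decide), this.2⟩

end hyperbolic

/-! ### Lifting central vectors in a chart and integrating them. -/

section lift
open Filter Metric
variable {n : ℕ} {M : Type*} [TopologicalSpace M] [ChartedSpace (EuclideanSpace ℝ (Fin n)) M]
  [IsManifold (𝓡 n) ∞ M] {ι : Type*} [Fintype ι] [DecidableEq ι]

/-- The projection to the `i`-th subbundle in the chart at `p`. -/
noncomputable def chartProj (pr : ι → (x : M) → TangentSpace (𝓡 n) x →L[ℝ] TangentSpace (𝓡 n) x)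
    (i : ι) (p x : M) : EuclideanSpace ℝ (Fin n) →L[ℝ] EuclideanSpace ℝ (Fin n) :=
  (chartTo p x) ∘L (pr i x) ∘L (chartFrom p x)

/-- The map sending a vector of the `i`-th subspace at `p` to the vector of the `i`-th subspace at
`x` that projects to it, in the chart at `p`. -/
noncomputable def chartLift (pr : ι → (x : M) → TangentSpace (𝓡 n) x →L[ℝ] TangentSpace (𝓡 n) x)
    (i : ι) (p x : M) : EuclideanSpace ℝ (Fin n) →L[ℝ] EuclideanSpace ℝ (Fin n) :=
  chartProj pr i p x * chartProj pr i p p *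
    Ring.inverse (chartProj pr i p p * chartProj pr i p x * chartProj pr i p p +
      (1 - chartProj pr i p p))

variable {E : ι → (x : M) → Submodule ℝ (TangentSpace (𝓡 n) x)}
  {pr : ι → (x : M) → TangentSpace (𝓡 n) x →L[ℝ] TangentSpace (𝓡 n) x}

namespace IsProjectionFamily

theorem chartFrom_chartProj {i : ι} {p x : M}
    (hx : x ∈ (extChartAt (𝓡 n) p).source) (w : EuclideanSpace ℝ (Fin n)) :
    chartFrom p x (chartProj pr i p x w) = pr i x (chartFrom p x w) :=
  chartFrom_chartTo hx _

theorem chartProj_apply_of_mem (h : IsProjectionFamily E pr) {i : ι} {p x : M}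
    (hx : x ∈ (extChartAt (𝓡 n) p).source) {w : EuclideanSpace ℝ (Fin n)}
    (hw : chartFrom p x w ∈ E i x) : chartProj pr i p x w = w := by
  change chartTo p x (pr i x (chartFrom p x w)) = w
  rw [h.apply_of_mem i x _ hw, chartTo_chartFrom hx]

theorem chartFrom_chartProj_mem (h : IsProjectionFamily E pr) {i : ι} {p x : M}
    (hx : x ∈ (extChartAt (𝓡 n) p).source) (w : EuclideanSpace ℝ (Fin n)) :
    chartFrom p x (chartProj pr i p x w) ∈ E i x := by
  rw [chartFrom_chartProj hx]; exact h.mem i x _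

theorem chartProj_chartProj (h : IsProjectionFamily E pr) {i : ι} {p x : M}
    (hx : x ∈ (extChartAt (𝓡 n) p).source) (w : EuclideanSpace ℝ (Fin n)) :
    chartProj pr i p x (chartProj pr i p x w) = chartProj pr i p x w :=
  h.chartProj_apply_of_mem hx (h.chartFrom_chartProj_mem hx w)

end IsProjectionFamily

/-- A ball in the chart at `p` on which the `i`-th subbundle is a graph over the `i`-th subspace
at `p`. -/
structure IsLiftBall [RiemannianBundle (fun x : M => TangentSpace (𝓡 n) x)]
    (E : ι → (x : M) → Submodule ℝ (TangentSpace (𝓡 n) x))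
    (pr : ι → (x : M) → TangentSpace (𝓡 n) x →L[ℝ] TangentSpace (𝓡 n) x) (i : ι) (p : M)
    (R K : ℝ) : Prop where
  pos : 0 < R
  K_pos : 0 < K
  subset : closedBall (extChartAt (𝓡 n) p p) R ⊆ (extChartAt (𝓡 n) p).target
  continuousOn : ContinuousOn (fun z => chartLift pr i p ((extChartAt (𝓡 n) p).symm z))
    (closedBall (extChartAt (𝓡 n) p p) R)
  norm_lift_le : ∀ z ∈ closedBall (extChartAt (𝓡 n) p p) R,
    ‖chartLift pr i p ((extChartAt (𝓡 n) p).symm z)‖ ≤ K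
  norm_chartFrom_le : ∀ z ∈ closedBall (extChartAt (𝓡 n) p p) R, ∀ w : EuclideanSpace ℝ (Fin n),
    ‖chartFrom p ((extChartAt (𝓡 n) p).symm z) w‖ ≤ K * ‖w‖
  proj_lift : ∀ z ∈ closedBall (extChartAt (𝓡 n) p p) R, ∀ v : EuclideanSpace ℝ (Fin n),
    chartProj pr i p p v = v → chartProj pr i p p (chartLift pr i p ((extChartAt (𝓡 n) p).symm z) v) = v
  lift_mem : ∀ z ∈ closedBall (extChartAt (𝓡 n) p p) R, ∀ v : EuclideanSpace ℝ (Fin n),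
    chartFrom p ((extChartAt (𝓡 n) p).symm z)
      (chartLift pr i p ((extChartAt (𝓡 n) p).symm z) v) ∈ E i ((extChartAt (𝓡 n) p).symm z)
  lift_proj : ∀ z ∈ closedBall (extChartAt (𝓡 n) p p) R, ∀ w : EuclideanSpace ℝ (Fin n),
    chartFrom p ((extChartAt (𝓡 n) p).symm z) w ∈ E i ((extChartAt (𝓡 n) p).symm z) →
    chartLift pr i p ((extChartAt (𝓡 n) p).symm z) (chartProj pr i p p w) = w

variable [RiemannianBundle (fun x : M => TangentSpace (𝓡 n) x)]

variable [IsContinuousRiemannianBundle (EuclideanSpace ℝ (Fin n))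
  (fun x : M => TangentSpace (𝓡 n) x)]

/-- `Q x` acts as `A p * A x` on the range of `A p` and as the identity on its kernel. As `Q p = 1`,
it is invertible near `p`, and `A x * A p * (Q x)⁻¹` is a section of `A p` with values in the range
of `A x`. -/
theorem IsProjectionFamily.exists_isLiftBall (h : IsProjectionFamily E pr) (i : ι) {p : M}
    {U : Set M} (hU : U ∈ 𝓝 p) : ∃ R K, IsLiftBall E pr i p R K ∧
      ∀ z ∈ closedBall (extChartAt (𝓡 n) p p) R, (extChartAt (𝓡 n) p).symm z ∈ U := by
  set φ := extChartAt (𝓡 n) p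
  set A := chartProj pr i p with hA
  set Q : M → EuclideanSpace ℝ (Fin n) →L[ℝ] EuclideanSpace ℝ (Fin n) :=
    fun x => A p * A x * A p + (1 - A p) with hQ
  have hp : p ∈ φ.source := mem_extChartAt_source p
  have hsrc : φ.source ∈ 𝓝 p := extChartAt_source_mem_nhds p
  have hopen : IsOpen φ.source := isOpen_extChartAt_source p
  have hAA : A p * A p = A p := by ext1 w; exact h.chartProj_chartProj hp w
  have hAc : ContinuousOn A φ.source := h.continuousOn i p
  have hQc : ContinuousOn Q φ.source :=
    ((continuousOn_const.mul hAc).mul continuousOn_const).add continuousOn_const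
  have hQp : Q p = 1 := by simp only [hQ, hAA, add_sub_cancel]
  have hunit : ∀ᶠ x in 𝓝 p, IsUnit (Q x) := by
    refine (hQc.continuousAt hsrc).eventually (Units.isOpen.mem_nhds ?_)
    rw [hQp]; exact isUnit_one
  have hSc : ∀ x ∈ φ.source, IsUnit (Q x) → ContinuousAt (chartLift pr i p) x := by
    intro x hx ⟨q, hq⟩
    have h1 := hopen.mem_nhds hx
    refine ((hAc.continuousAt h1).mul continuousAt_const).mul ?_
    have h2 : ContinuousAt Ring.inverse (Q x) := hq ▸ NormedRing.inverse_continuousAt q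
    exact ContinuousAt.comp (f := Q) h2 (hQc.continuousAt h1)
  have hAn : ∀ᶠ x in 𝓝 p, ‖A x - A p‖ < 1 / 2 := by
    have := (hAc.continuousAt hsrc).eventually (ball_mem_nhds _ (half_pos one_pos))
    simpa only [mem_ball, dist_eq_norm] using this
  have hSn := (hSc p hp (hQp ▸ isUnit_one)).norm.eventually (gt_mem_nhds (lt_add_one _))
  obtain ⟨C, hC, hCe⟩ := eventually_norm_chart_le (n := n) p
  have hall : ∀ᶠ x in 𝓝 p, x ∈ U ∧ x ∈ φ.source ∧ IsUnit (Q x) ∧ ‖A x - A p‖ < 1 / 2 ∧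
      ‖chartLift pr i p x‖ < ‖chartLift pr i p p‖ + 1 ∧
      ∀ w : EuclideanSpace ℝ (Fin n), ‖chartFrom p x w‖ ≤ C * ‖w‖ := by
    filter_upwards [hU, hsrc, hunit, hAn, hSn, hCe] with x h1 h2 h3 h4 h5 h6
    exact ⟨h1, h2, h3, h4, h5, h6.2⟩
  have hsymm : Tendsto φ.symm (𝓝 (φ p)) (𝓝 p) := by
    have := continuousAt_extChartAt_symm (I := 𝓡 n) p
    rw [ContinuousAt, extChartAt_to_inv] at this
    exact this
  obtain ⟨R, hR, H⟩ := nhds_basis_closedBall.mem_iff.1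
    ((hsymm.eventually hall).and (extChartAt_target_mem_nhds p))
  set K := max C (‖chartLift pr i p p‖ + 1)
  have hlift : ∀ x, IsUnit (Q x) → ∀ v, A p v = v → A p (chartLift pr i p x v) = v := by
    intro x ⟨q, hq⟩ v hv
    set w := Ring.inverse (Q x) v with hw
    have h1 : Q x w = v := by
      have : Q x * Ring.inverse (Q x) = 1 := by rw [← hq]; simp
      exact congrArg (fun B => B v) this
    have h2 : A p (A x (A p w)) + (w - A p w) = v := h1
    have h3 := congrArg (A p) h2
    have hAA' : ∀ w, A p (A p w) = A p w := fun w => h.chartProj_chartProj hp w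
    rw [map_add, map_sub, hAA', hAA', hv, sub_self, add_zero] at h3
    exact h3
  refine ⟨R, K, ⟨hR, lt_max_of_lt_left hC, fun z hz => (H hz).2, fun z hz => ?_, fun z hz => ?_,
    fun z hz w => ?_, fun z hz v hv => ?_, fun z hz v => ?_, fun z hz w hw => ?_⟩,
    fun z hz => (H hz).1.1⟩
  · have h1 := hSc _ (H hz).1.2.1 (H hz).1.2.2.1
    have h2 : ContinuousWithinAt φ.symm (closedBall (φ p) R) z :=
      ((continuousOn_extChartAt_symm p) z (H hz).2).mono fun z hz => (H hz).2
    exact ContinuousAt.comp_continuousWithinAt (f := φ.symm) h1 h2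
  · exact (H hz).1.2.2.2.2.1.le.trans (le_max_right _ _)
  · exact ((H hz).1.2.2.2.2.2 w).trans (mul_le_mul_of_nonneg_right (le_max_left _ _)
      (norm_nonneg _))
  · exact hlift _ (H hz).1.2.2.1 v hv
  · exact h.chartFrom_chartProj_mem (H hz).1.2.1 _
  · have hx := (H hz).1.2.1
    set x := φ.symm z
    have h1 := hlift x (H hz).1.2.2.1 (A p w) (h.chartProj_chartProj hp w)
    set w' := chartLift pr i p x (A p w)
    have h2 : A x w' = w' :=
      h.chartProj_apply_of_mem hx (h.chartFrom_chartProj_mem (i := i) hx _)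
    have h3 : A x w = w := h.chartProj_apply_of_mem hx hw
    -- Both vectors are fixed by `A x` and have the same image under `A p`; since `A x - A p` has
    -- norm below `1 / 2`, they agree.
    have h4 : w' - w = (A x - A p) (w' - w) := by
      rw [sub_apply, map_sub, map_sub, h1, h2, h3, sub_self, sub_zero]
    have h5 := ContinuousLinearMap.le_of_opNorm_le _ (H hz).1.2.2.2.1.le (w' - w)
    rw [← h4] at h5
    have h6 : ‖w' - w‖ ≤ 0 := by linarith
    exact sub_eq_zero.1 (norm_le_zero_iff.1 h6)

namespace IsLiftBall
variable {i : ι} {p : M} {R K : ℝ}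

/-- Integral curves of a lifted vector. -/
theorem exists_curve (hB : IsLiftBall E pr i p R K) {y v : EuclideanSpace ℝ (Fin n)}
    (hv : chartProj pr i p p v = v) (hy : ‖y - extChartAt (𝓡 n) p p‖ + K * ‖v‖ < R) :
    ∃ c c' : ℝ → EuclideanSpace ℝ (Fin n), Continuous c' ∧ (∀ t, HasDerivAt c (c' t) t) ∧ c 0 = y ∧
      ∀ t ∈ Icc (0 : ℝ) 1, c t ∈ closedBall (extChartAt (𝓡 n) p p) R ∧
        c' t = chartLift pr i p ((extChartAt (𝓡 n) p).symm (c t)) v ∧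
        chartProj pr i p p (c t) = chartProj pr i p p y + t • v ∧ ‖c t - y‖ ≤ K * ‖v‖ := by
  set z₀ := extChartAt (𝓡 n) p p
  have hK := hB.K_pos
  have hsub : closedBall y (R - ‖y - z₀‖) ⊆ closedBall z₀ R := by
    refine closedBall_subset_closedBall' ?_
    rw [dist_eq_norm]; linarith
  obtain ⟨c, c', hc', hd, hc0, H⟩ := exists_integralCurve_of_continuousOn
    (X := fun z => chartLift pr i p ((extChartAt (𝓡 n) p).symm z) v) (y₀ := y)
    (R := R - ‖y - z₀‖) (C := K * ‖v‖)
    ((hB.continuousOn.clm_apply continuousOn_const).mono hsub)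
    (fun z hz => ContinuousLinearMap.le_of_opNorm_le _ (hB.norm_lift_le z (hsub hz)) v)
    (by positivity) (by linarith)
  refine ⟨c, c', hc', hd, hc0, fun t ht => ⟨hsub (H t ht).1, (H t ht).2, ?_, ?_⟩⟩
  -- The lift of `v` projects back to `v`, so the central coordinate moves exactly along `t • v`.
  · have h1 : ∀ t ∈ Ico (0 : ℝ) 1,
        HasDerivWithinAt (fun t => chartProj pr i p p (c t) - t • v) 0 (Ici t) t := by
      intro t ht
      have h2 := ((chartProj pr i p p).hasFDerivAt.comp_hasDerivAt t (hd t)).sub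
        ((hasDerivAt_id t).smul_const v)
      rw [(H t ⟨ht.1, ht.2.le⟩).2, hB.proj_lift _ (hsub (H t ⟨ht.1, ht.2.le⟩).1) v hv, one_smul,
        sub_self] at h2
      exact h2.hasDerivWithinAt
    have hcc : Continuous c := continuous_iff_continuousAt.2 fun t => (hd t).continuousAt
    have h3 := constant_of_has_deriv_right_zero (by fun_prop) h1 t ht
    rw [zero_smul, sub_zero, hc0] at h3
    rw [← h3, sub_add_cancel]
  · have h1 := norm_image_sub_le_of_norm_deriv_le_segment' (f := c) (f' := c') (a := 0) (b := 1)
      (C := K * ‖v‖) (fun t _ => (hd t).hasDerivWithinAt) (fun t ht => by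
        rw [(H t ⟨ht.1, ht.2.le⟩).2]
        exact ContinuousLinearMap.le_of_opNorm_le _
          (hB.norm_lift_le _ (hsub (H t ⟨ht.1, ht.2.le⟩).1)) v) t ht
    rw [hc0, sub_zero] at h1
    exact h1.trans (mul_le_of_le_one_right (by positivity) ht.2)

/-- One factor `K` bounds the lifted vector in the chart; the other compares the chart norm with the
Riemannian norm. -/
theorem isTangentCurve (hB : IsLiftBall E pr i p R K) {v : EuclideanSpace ℝ (Fin n)}
    {c c' : ℝ → EuclideanSpace ℝ (Fin n)} (hc' : Continuous c') (hd : ∀ t, HasDerivAt c (c' t) t)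
    (H : ∀ t ∈ Icc (0 : ℝ) 1, c t ∈ closedBall (extChartAt (𝓡 n) p p) R ∧
        c' t = chartLift pr i p ((extChartAt (𝓡 n) p).symm (c t)) v) :
    IsTangentCurve (E i) (fun t => (extChartAt (𝓡 n) p).symm (c t)) ∧
      pathELength (𝓡 n) (fun t => (extChartAt (𝓡 n) p).symm (c t)) 0 1 ≤
        ENNReal.ofReal (K * (K * ‖v‖)) := by
  have hct : ∀ t ∈ Icc (0 : ℝ) 1, c t ∈ (extChartAt (𝓡 n) p).target :=
    fun t ht => hB.subset (H t ht).1
  have hK := hB.K_pos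
  refine ⟨⟨contMDiffOn_chart_symm_comp hc' hd hct, fun t ht => ?_⟩, ?_⟩
  · rw [mfderivWithin_chart_symm_comp ht (hd t) (hct t ht), (H t ht).2]
    exact hB.lift_mem _ (H t ht).1 v
  · rw [pathELength_eq_lintegral_mfderivWithin_Icc]
    calc _ ≤ ∫⁻ _ in Icc (0 : ℝ) 1, ENNReal.ofReal (K * (K * ‖v‖)) := by
          refine MeasureTheory.setLIntegral_mono measurable_const fun t ht => ?_
          change ‖mfderivWithin 𝓘(ℝ, ℝ) (𝓡 n) (fun t => (extChartAt (𝓡 n) p).symm (c t)) (Icc 0 1) t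
            (1 : ℝ)‖ₑ ≤ _
          rw [mfderivWithin_chart_symm_comp ht (hd t) (hct t ht), (H t ht).2,
            ← ofReal_norm]
          refine ENNReal.ofReal_le_ofReal ((hB.norm_chartFrom_le _ (H t ht).1 _).trans ?_)
          exact mul_le_mul_of_nonneg_left (ContinuousLinearMap.le_of_opNorm_le _
            (hB.norm_lift_le _ (H t ht).1) v) hK.le
      _ = _ := by simp

end IsLiftBall
end lift

theorem ContMDiff.iterate_self {𝕜 E H M : Type*} [NontriviallyNormedField 𝕜] [NormedAddCommGroup E]
    [NormedSpace 𝕜 E] [TopologicalSpace H] {I : ModelWithCorners 𝕜 E H} [TopologicalSpace M]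
    [ChartedSpace H M] {m : WithTop ℕ∞} {f : M → M} (hf : ContMDiff I I m f) (k : ℕ) :
    ContMDiff I I m f^[k] := by
  induction k with
  | zero => exact contMDiff_id
  | succ k ih => rw [Function.iterate_succ]; exact ih.comp hf

/-! ### Cancelling the central component by sliding. -/

section slide
open Filter Metric

theorem exists_nhds_of_eventually_diagonal {X : Type*} [TopologicalSpace X] {p : X}
    {P : X → X → X → Prop} (h : ∀ᶠ q : X × X × X in 𝓝 (p, p, p), P q.1 q.2.1 q.2.2) :
    ∃ U ∈ 𝓝 p, ∀ x ∈ U, ∀ y ∈ U, ∀ z ∈ U, P x y z := by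
  rw [nhds_prod_eq, nhds_prod_eq] at h
  obtain ⟨A, hA, B, hB, hAB⟩ := mem_prod_iff.1 h
  obtain ⟨B₁, hB₁, B₂, hB₂, hB'⟩ := mem_prod_iff.1 hB
  exact ⟨A ∩ (B₁ ∩ B₂), inter_mem hA (inter_mem hB₁ hB₂), fun x hx y hy z hz =>
    hAB (show (x, y, z) ∈ A ×ˢ B from ⟨hx.1, hB' ⟨hy.2.1, hz.2.2⟩⟩)⟩

variable {n : ℕ} {M : Type*} [TopologicalSpace M] [ChartedSpace (EuclideanSpace ℝ (Fin n)) M]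
  [IsManifold (𝓡 n) ∞ M] [RiemannianBundle (fun x : M => TangentSpace (𝓡 n) x)]
  [IsContinuousRiemannianBundle (EuclideanSpace ℝ (Fin n)) (fun x : M => TangentSpace (𝓡 n) x)]
  {V : Type*} [NormedAddCommGroup V] [InnerProductSpace ℝ V] [FiniteDimensional ℝ V]
  {e : M → V} {L : (x : M) → V →ₗ[ℝ] TangentSpace (𝓡 n) x} {C : ℝ}
  {E : Fin 3 → (x : M) → Submodule ℝ (TangentSpace (𝓡 n) x)}
  {pr : Fin 3 → (x : M) → TangentSpace (𝓡 n) x →L[ℝ] TangentSpace (𝓡 n) x}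

/-- A difference of points that has no central component in the chart at `p` is mostly transversal
to the central direction, seen from any point near `p`. -/
theorem IsProjectionFamily.eventually_splitDist_le [CompactSpace M] (h : IsProjectionFamily E pr)
    (hL : IsLeftInverseFamily e L C) (p : M) : ∀ᶠ q : M × M × M in 𝓝 (p, p, p),
      chartProj pr 1 p p (extChartAt (𝓡 n) p q.2.2 - extChartAt (𝓡 n) p q.2.1) = 0 →
      splitDist e L pr 1 q.1 q.2.1 q.2.2 ≤
        1 / 2 * max (splitDist e L pr 0 q.1 q.2.1 q.2.2) (splitDist e L pr 2 q.1 q.2.1 q.2.2) := by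
  have hsrc : (extChartAt (𝓡 n) p).source ∈ 𝓝 p := extChartAt_source_mem_nhds p
  obtain ⟨C₁, hC₁, H₁⟩ := eventually_norm_chart_le (n := n) p
  obtain ⟨D, hD, HD⟩ := h.exists_norm_le 1
  -- The factor `12` is `2 * 6`: the target ratio `1 / 2`, the factor `2` in `hw` and the three
  -- components of `v`. The `+ 1` also yields `C₁ * ε ≤ 1 / 2`.
  set ε := 1 / (12 * (C₁ + D + 1) * C₁) with hε
  have hε0 : 0 < ε := by positivity
  have e1 : Tendsto (fun q : M × M × M => q.1) (𝓝 (p, p, p)) (𝓝 p) := continuous_fst.tendsto _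
  have hA : ∀ᶠ x in 𝓝 p, ‖chartProj pr 1 p x - chartProj pr 1 p p‖ < ε := by
    have hc : ContinuousOn (chartProj pr 1 p) (extChartAt (𝓡 n) p).source := h.continuousOn 1 p
    simpa only [mem_ball, dist_eq_norm] using
      (hc.continuousAt hsrc).eventually (ball_mem_nhds _ hε0)
  filter_upwards [e1.eventually hsrc, e1.eventually H₁, e1.eventually hA,
    hL.eventually_sub_chartFrom_le p hε0] with ⟨x, y, z⟩ hx h1 h2 h3 h0
  simp only at hx h1 h2 h3 h0 ⊢
  set w := extChartAt (𝓡 n) p z - extChartAt (𝓡 n) p y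
  unfold splitDist
  set v := L x (e z - e y)
  have hC₁ε : C₁ * ε ≤ 1 / 2 := by
    rw [hε]
    field_simp
    linarith
  have hcoef : 6 * ((C₁ + D) * ε) * C₁ ≤ 1 / 2 := by
    rw [hε]
    field_simp
    linarith
  have hw : ‖w‖ ≤ 2 * C₁ * ‖v‖ := by
    have a1 : ‖w‖ ≤ C₁ * ‖chartFrom p x w‖ := by
      conv_lhs => rw [← chartTo_chartFrom hx w]
      exact h1.1 _
    have a2 : ‖chartFrom p x w‖ ≤ ‖v‖ + ε * ‖w‖ := by
      have := norm_sub_norm_le (chartFrom p x w) v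
      rw [norm_sub_rev] at this
      linarith
    have a3 := a1.trans (mul_le_mul_of_nonneg_left a2 hC₁.le)
    have a4 := mul_le_mul_of_nonneg_right hC₁ε (norm_nonneg w)
    linarith
  have hc : ‖pr 1 x v‖ ≤ (C₁ + D) * ε * ‖w‖ := by
    have a1 : ‖pr 1 x (chartFrom p x w)‖ ≤ C₁ * (ε * ‖w‖) := by
      rw [← IsProjectionFamily.chartFrom_chartProj hx]
      refine (h1.2 _).trans (mul_le_mul_of_nonneg_left ?_ hC₁.le)
      have := ContinuousLinearMap.le_of_opNorm_le _ h2.le w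
      rwa [sub_apply, h0, sub_zero] at this
    have a2 : ‖pr 1 x (v - chartFrom p x w)‖ ≤ D * (ε * ‖w‖) :=
      (HD _ _).trans (mul_le_mul_of_nonneg_left h3 hD.le)
    rw [map_sub] at a2
    have := norm_sub_norm_le (pr 1 x v) (pr 1 x (chartFrom p x w))
    linarith
  set m := max ‖pr 0 x v‖ ‖pr 2 x v‖ with hm
  have hv : ‖v‖ ≤ Fintype.card (Fin 3) * max ‖pr 1 x v‖ m := h.norm_le_card_mul fun i => by
    fin_cases i
    · exact (le_max_left _ _).trans (le_max_right _ _)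
    · exact le_max_left _ _
    · exact (le_max_right _ _).trans (le_max_right _ _)
  rw [Fintype.card_fin, Nat.cast_ofNat] at hv
  have hm0 : 0 ≤ max ‖pr 1 x v‖ m := le_max_of_le_left (norm_nonneg _)
  have hfin : ‖pr 1 x v‖ ≤ 1 / 2 * max ‖pr 1 x v‖ m := by
    calc _ ≤ (C₁ + D) * ε * (2 * C₁ * (3 * max ‖pr 1 x v‖ m)) := hc.trans
          (mul_le_mul_of_nonneg_left (hw.trans (mul_le_mul_of_nonneg_left hv (by positivity)))
            (by positivity))
      _ = 6 * ((C₁ + D) * ε) * C₁ * max ‖pr 1 x v‖ m := by ring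
      _ ≤ _ := mul_le_mul_of_nonneg_right hcoef hm0
  rcases le_total ‖pr 1 x v‖ m with hle | hle
  · rwa [max_eq_right hle] at hfin
  · rw [max_eq_left hle] at hfin
    have := norm_nonneg (pr 1 x v)
    have : 0 ≤ m := le_max_of_le_left (norm_nonneg _)
    linarith

/-- `x` and `y` are joined by a curve tangent to `E` of length less than `η`. -/
def TangentJoined (E : (x : M) → Submodule ℝ (TangentSpace (𝓡 n) x)) (η : ℝ) (x y : M) : Prop :=
  ∃ γ : ℝ → M, IsTangentCurve E γ ∧ γ 0 = x ∧ γ 1 = y ∧ pathELength (𝓡 n) γ 0 1 < ENNReal.ofReal η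

theorem TangentJoined.mono {E : (x : M) → Submodule ℝ (TangentSpace (𝓡 n) x)} {η η' : ℝ} {x y : M}
    (h : TangentJoined E η x y) (hη : η ≤ η') : TangentJoined E η' x y := by
  obtain ⟨γ, h1, h2, h3, h4⟩ := h
  exact ⟨γ, h1, h2, h3, h4.trans_le (ENNReal.ofReal_le_ofReal hη)⟩

/-- Follow a Peano curve whose central displacement in the chart is that from `x` to `y`. Its
endpoint has the same central coordinate as `y`, so what remains is transversal. No dynamics is
involved. -/
theorem IsProjectionFamily.exists_tangentJoined [CompactSpace M] (h : IsProjectionFamily E pr)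
    (hL : IsLeftInverseFamily e L C) {η : ℝ} (hη : 0 < η) :
    ∃ δ > 0, ∀ x y, ‖e y - e x‖ ≤ δ → ∃ x', TangentJoined (E 1) η x x' ∧
      splitDist e L pr 1 x x' y ≤
        1 / 2 * max (splitDist e L pr 0 x x' y) (splitDist e L pr 2 x x' y) := by
  obtain ⟨δ, hδ, H⟩ := exists_forall_of_eventually_diagonal hL.contMDiff.continuous hL.inj
    (P := fun x y _ => ∃ x', TangentJoined (E 1) η x x' ∧
      splitDist e L pr 1 x x' y ≤
        1 / 2 * max (splitDist e L pr 0 x x' y) (splitDist e L pr 2 x x' y)) fun p => by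
    obtain ⟨U, hU, HU⟩ := exists_nhds_of_eventually_diagonal
      (P := fun x y z => chartProj pr 1 p p (extChartAt (𝓡 n) p z - extChartAt (𝓡 n) p y) = 0 →
        splitDist e L pr 1 x y z ≤
        1 / 2 * max (splitDist e L pr 0 x y z) (splitDist e L pr 2 x y z))
      (h.eventually_splitDist_le hL p)
    obtain ⟨R, K, hB, hBU⟩ := h.exists_isLiftBall 1 hU
    set φ := extChartAt (𝓡 n) p
    have hsrc : φ.source ∈ 𝓝 p := extChartAt_source_mem_nhds p
    have hp : p ∈ φ.source := mem_extChartAt_source p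
    have e1 : Tendsto (fun q : M × M × M => q.1) (𝓝 (p, p, p)) (𝓝 p) := continuous_fst.tendsto _
    have e2 : Tendsto (fun q : M × M × M => q.2.1) (𝓝 (p, p, p)) (𝓝 p) :=
      (continuous_fst.comp continuous_snd).tendsto _
    have hφ : ContinuousAt φ p := continuousAt_extChartAt p
    have c1 : Tendsto (fun q : M × M × M => φ q.1) (𝓝 (p, p, p)) (𝓝 (φ p)) := hφ.tendsto.comp e1
    have c2 : Tendsto (fun q : M × M × M => φ q.2.1) (𝓝 (p, p, p)) (𝓝 (φ p)) := hφ.tendsto.comp e2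
    have c3 : Tendsto (fun q : M × M × M => ‖chartProj pr 1 p p (φ q.2.1 - φ q.1)‖)
        (𝓝 (p, p, p)) (𝓝 0) := by
      have := ((chartProj pr 1 p p).continuous.norm.tendsto _).comp (c2.sub c1)
      rwa [sub_self, map_zero, norm_zero] at this
    have c4 : Tendsto (fun q : M × M × M => ‖φ q.1 - φ p‖ +
        K * ‖chartProj pr 1 p p (φ q.2.1 - φ q.1)‖) (𝓝 (p, p, p)) (𝓝 0) := by
      have := (c1.sub_const (φ p)).norm.add (c3.const_mul K)
      rwa [sub_self, norm_zero, mul_zero, add_zero] at this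
    have c5 : Tendsto (fun q : M × M × M => K * (K * ‖chartProj pr 1 p p (φ q.2.1 - φ q.1)‖))
        (𝓝 (p, p, p)) (𝓝 0) := by
      have := (c3.const_mul K).const_mul K
      rwa [mul_zero, mul_zero] at this
    filter_upwards [e1.eventually hsrc, e1.eventually hU, e2.eventually hU,
      c4.eventually (gt_mem_nhds hB.pos), c5.eventually (gt_mem_nhds hη)]
      with ⟨x, y, z⟩ hx hxU hyU h4 h5
    simp only at hx hxU hyU h4 h5
    have hv := h.chartProj_chartProj (i := 1) hp (φ y - φ x)
    obtain ⟨c, c', hc', hd, hc0, Hc⟩ := hB.exists_curve hv h4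
    obtain ⟨ht, hl⟩ := hB.isTangentCurve hc' hd fun t ht => ⟨(Hc t ht).1, (Hc t ht).2.1⟩
    have Hc1 := Hc 1 (right_mem_Icc.2 zero_le_one)
    refine ⟨φ.symm (c 1), ⟨_, ht, ?_, rfl, hl.trans_lt ((ENNReal.ofReal_lt_ofReal_iff hη).2 h5)⟩,
      HU x hxU _ (hBU _ Hc1.1) y hyU ?_⟩
    · change φ.symm (c 0) = x
      rw [hc0, φ.left_inv hx]
    · rw [φ.right_inv (hB.subset Hc1.1), map_sub, Hc1.2.2.1, one_smul, map_sub]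
      abel
  exact ⟨δ, hδ, fun x y hxy => H x y y hxy hxy⟩

theorem IsLeftInverseFamily.exists_uniform [CompactSpace M] (hL : IsLeftInverseFamily e L C)
    {f : M → M} (hf : Continuous f) {β : ℝ} (hβ : 0 < β) :
    ∃ δ > 0, ∀ x y, ‖e y - e x‖ ≤ δ → ‖e (f y) - e (f x)‖ ≤ β := by
  have he := hL.contMDiff.continuous
  obtain ⟨δ, hδ, H⟩ := exists_forall_of_eventually_diagonal he hL.inj
    (P := fun x y _ => ‖e (f y) - e (f x)‖ ≤ β) fun p => by
    have : Continuous fun q : M × M × M => ‖e (f q.2.1) - e (f q.1)‖ := by fun_prop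
    have h0 : ‖e (f p) - e (f p)‖ < β := by rwa [sub_self, norm_zero]
    exact (this.continuousAt.eventually (gt_mem_nhds h0)).mono fun q hq => hq.le
  exact ⟨δ, hδ, fun x y hxy => H x y y hxy hxy⟩

end slide

/-! ### Lyapunov stability as a plaque system. -/

section plaques
open Filter Metric
variable {n : ℕ} {M : Type*} [EMetricSpace M] [CompactSpace M]
  [ChartedSpace (EuclideanSpace ℝ (Fin n)) M]
  [IsManifold (𝓡 n) ∞ M] [RiemannianBundle (fun x : M => TangentSpace (𝓡 n) x)]
  [IsContinuousRiemannianBundle (EuclideanSpace ℝ (Fin n)) (fun x : M => TangentSpace (𝓡 n) x)]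
  [IsRiemannianManifold (𝓡 n) M]
  {V : Type*} [NormedAddCommGroup V] [InnerProductSpace ℝ V] [FiniteDimensional ℝ V]
  {e : M → V} {L : (x : M) → V →ₗ[ℝ] TangentSpace (𝓡 n) x} {C : ℝ}

theorem edist_le_pathELength {γ : ℝ → M} (hγ : ContMDiffOn 𝓘(ℝ, ℝ) (𝓡 n) 1 γ (Icc 0 1)) {t : ℝ}
    (ht : t ∈ Icc (0 : ℝ) 1) : edist (γ 0) (γ t) ≤ pathELength (𝓡 n) γ 0 1 := by
  rw [IsRiemannianManifold.out (I := 𝓡 n)]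
  exact (riemannianEDist_le_pathELength (hγ.mono (Icc_subset_Icc_right ht.2)) rfl rfl ht.1).trans
    (pathELength_mono le_rfl ht.2)

theorem exists_forall_edist_lt {e : M → V} (he : Continuous e) {β : ℝ} (hβ : 0 < β) :
    ∃ ε : ℝ, 0 < ε ∧ ∀ x y : M, edist x y < ENNReal.ofReal ε → ‖e y - e x‖ ≤ β := by
  obtain ⟨ε, hε, H⟩ := EMetric.uniformContinuous_iff.1
    (CompactSpace.uniformContinuous_of_continuous he) (ENNReal.ofReal β) (ENNReal.ofReal_pos.2 hβ)
  obtain ⟨ε', hε', hlt⟩ := ENNReal.lt_iff_exists_real_btwn.1 hε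
  refine ⟨ε', ENNReal.ofReal_pos.1 hlt.1, fun x y hxy => ?_⟩
  have := H (hxy.trans hlt.2)
  rw [edist_dist, ENNReal.ofReal_lt_ofReal_iff hβ, dist_comm, dist_eq_norm] at this
  exact this.le

theorem LyapunovStable.exists_forall_iterate {E : (x : M) → Submodule ℝ (TangentSpace (𝓡 n) x)}
    {f : M → M} (h : LyapunovStable f E) (hf : ContMDiff (𝓡 n) (𝓡 n) 1 f) {e : M → V}
    (he : Continuous e) {β : ℝ} (hβ : 0 < β) : ∃ δ > 0, ∀ x y, TangentJoined E δ x y →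
      ∀ k : ℕ, ‖e (f^[k] y) - e (f^[k] x)‖ ≤ β := by
  obtain ⟨ε, hε, H⟩ := exists_forall_edist_lt he hβ
  obtain ⟨δ, hδ, H'⟩ := h ε hε
  refine ⟨δ, hδ, ?_⟩
  rintro x y ⟨γ, ⟨hγ, hγE⟩, rfl, rfl, hl⟩ k
  exact H _ _ ((edist_le_pathELength ((hf.iterate_self k).comp_contMDiffOn hγ)
    (right_mem_Icc.2 zero_le_one)).trans_lt (H' γ hγ hγE hl k))

variable {f : M ≃ₘ^1⟮𝓡 n, 𝓡 n⟯ M} {Es Ec Eu : (x : M) → Submodule ℝ (TangentSpace (𝓡 n) x)}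
  {pr : Fin 3 → (x : M) → TangentSpace (𝓡 n) x →L[ℝ] TangentSpace (𝓡 n) x}

/-- Distance is bounded by length, so stability of `f` controls the future of the endpoints of a
short tangent curve and stability of `f.symm` their past. -/
theorem plaqueSystem_of_lyapunovStable (h1 : LyapunovStable f Ec) (h2 : LyapunovStable f.symm Ec)
    (hL : IsLeftInverseFamily e L C)
    (h : IsProjectionFamily (hyperbolicSplitting Es Ec Eu) pr) :
    PlaqueSystem f.toEquiv (fun x y => ‖e y - e x‖) (splitDist e L pr 0)
      (splitDist e L pr 1) (splitDist e L pr 2) (TangentJoined Ec) where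
  mono η η' x y hη hxy := hxy.mono hη
  stable β hβ := by
    obtain ⟨δ₁, hδ₁, H₁⟩ :=
      h1.exists_forall_iterate f.contMDiff_toFun hL.contMDiff.continuous hβ
    obtain ⟨δ₂, hδ₂, H₂⟩ :=
      h2.exists_forall_iterate f.symm.contMDiff_toFun hL.contMDiff.continuous hβ
    refine ⟨min δ₁ δ₂, lt_min hδ₁ hδ₂, fun x y hxy k => ?_⟩
    have hpow : ∀ (F : Equiv.Perm M) (k : ℕ) (x : M), (F ^ k) x = F^[k] x := fun F k x => by
      rw [Equiv.Perm.iterate_eq_pow]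
    obtain ⟨m, rfl | rfl⟩ := k.eq_nat_or_neg
    · rw [zpow_natCast, hpow, hpow]
      exact H₁ x y (hxy.mono (min_le_left _ _)) m
    · rw [zpow_neg, zpow_natCast, ← inv_pow, hpow, hpow]
      exact H₂ x y (hxy.mono (min_le_right _ _)) m
  slide η hη := h.exists_tangentJoined hL hη
  uniform β hβ := hL.exists_uniform f.contMDiff_toFun.continuous hβ
  uniform_inv β hβ := hL.exists_uniform f.symm.contMDiff_toFun.continuous hβ

end plaques

/-! ### Countability of chains of orbit-close points. -/

section orbits
variable {M : Type*} {F : Equiv.Perm M} {ρ : M → M → ℝ} {s c u : M → M → M → ℝ} {r κ C : ℝ}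
  {P : ℝ → M → M → Prop}

theorem ConeSystem.orbitClose_symm (h : ConeSystem F ρ s c u r κ C) {β : ℝ} {x y : M}
    (hxy : OrbitClose F ρ β x y) : OrbitClose F ρ β y x := fun k =>
  (h.ρ_comm _ _).trans_le (hxy k)

theorem ConeSystem.orbitClose_trans (h : ConeSystem F ρ s c u r κ C) {β β' : ℝ} {x y z : M}
    (hxy : OrbitClose F ρ β x y) (hyz : OrbitClose F ρ β' y z) : OrbitClose F ρ (β + β') x z :=
  fun k => (h.ρ_triangle _ _ _).trans (add_le_add (hxy k) (hyz k))

theorem ConeSystem.orbitClose_refl (h : ConeSystem F ρ s c u r κ C) {β : ℝ} (hβ : 0 ≤ β) (x : M) :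
    OrbitClose F ρ β x x := fun _ => (h.ρ_self _).trans_le hβ

/-- A chain of orbit-close points starting at `q` stays orbit-close to countably many points. -/
theorem PlaqueSystem.exists_countable (h : ConeSystem F ρ s c u r κ C)
    (hP : PlaqueSystem F ρ s c u P)
    (hsep : ∀ A : Set M, ∃ t ⊆ A, t.Countable ∧ ∀ x ∈ A, ∀ δ > 0, ∃ y ∈ t, ρ y x ≤ δ) {β : ℝ}
    (hβ : 0 < β) (hβr : 4 * β ≤ r) (q : M) :
    ∃ D : Set M, D.Countable ∧ ∀ z, Relation.EqvGen (OrbitClose F ρ β) q z →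
      ∃ d ∈ D, OrbitClose F ρ β d z := by
  choose t ht htc htd using hsep
  obtain ⟨δ, hδ, Hδ⟩ := hP.orbitClose_of_orbitClose h hβ
  let T : M → Set M := fun d => t {z | OrbitClose F ρ (2 * β) d z}
  -- Each generation adds, for every earlier point `d`, a countable dense set of points that are `2
  -- * β`-close to `d` along orbits.
  let D : ℕ → Set M := fun k => Nat.rec {q} (fun _ A => ⋃ d ∈ A, T d) k
  have hD : ∀ k, (D k).Countable := by
    intro k
    induction k with
    | zero => exact countable_singleton q
    | succ k ih => exact ih.biUnion fun d _ => htc _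
  let I : M → Prop := fun z => ∃ d ∈ ⋃ k, D k, OrbitClose F ρ β d z
  have step : ∀ z z', OrbitClose F ρ β z z' → I z → I z' := by
    rintro z z' hzz' ⟨d, hd, hdz⟩
    obtain ⟨k, hk⟩ := mem_iUnion.1 hd
    have h1 : OrbitClose F ρ (2 * β) d z' := (h.orbitClose_trans hdz hzz').mono (by linarith)
    obtain ⟨d', hd', hρ⟩ := htd {z | OrbitClose F ρ (2 * β) d z} z' h1 δ hδ
    have h2 : OrbitClose F ρ (2 * β) d d' := ht _ hd'
    -- Both `d'` and `z'` shadow `d` at scale `2 * β`, hence one another at scale `4 * β ≤ r`; their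
    -- closeness at time `0` improves this to `β`, so the scale does not deteriorate along the
    -- chain.
    refine ⟨d', mem_iUnion.2 ⟨k + 1, mem_iUnion₂.2 ⟨d, hk, hd'⟩⟩, Hδ d' z' ?_ hρ⟩
    exact (h.orbitClose_trans (h.orbitClose_symm h2) h1).mono (by linarith)
  have key : ∀ z z', Relation.EqvGen (OrbitClose F ρ β) z z' → (I z ↔ I z') := by
    intro z z' hz
    induction hz with
    | rel z z' hz => exact ⟨step z z' hz, step z' z (h.orbitClose_symm hz)⟩
    | refl z => exact Iff.rfl
    | symm z z' _ ih => exact ih.symm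
    | trans z z' z'' _ _ ih ih' => exact ih.trans ih'
  refine ⟨⋃ k, D k, countable_iUnion hD, fun z hz => (key q z hz).1 ⟨q, mem_iUnion.2 ⟨0, rfl⟩,
    h.orbitClose_refl hβ.le q⟩⟩

end orbits

/-! ### Tangent curves: segments, subarcs and subdivision. -/

section curves
open Filter Metric
variable {n : ℕ} {M : Type*} [TopologicalSpace M] [ChartedSpace (EuclideanSpace ℝ (Fin n)) M]
  [IsManifold (𝓡 n) ∞ M] [RiemannianBundle (fun x : M => TangentSpace (𝓡 n) x)]
  {E : (x : M) → Submodule ℝ (TangentSpace (𝓡 n) x)}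
  {G : Type*} [NormedAddCommGroup G] [NormedSpace ℝ G]

/-- The image of a segment under a `C¹` map tangent to `E`. -/
theorem isTangentCurve_segment {g : G → M} {A : Set G} (hA : Convex ℝ A)
    (hg : ContMDiffOn 𝓘(ℝ, G) (𝓡 n) 1 g A)
    (hgE : ∀ u ∈ A, ∀ v : G, mfderivWithin 𝓘(ℝ, G) (𝓡 n) g A u v ∈ E (g u)) {u u' : G}
    (hu : u ∈ A) (hu' : u' ∈ A) : IsTangentCurve E (fun t : ℝ => g (u + t • (u' - u))) ∧
    ∀ B, (∀ u ∈ A, ∀ v : G, ‖mfderivWithin 𝓘(ℝ, G) (𝓡 n) g A u v‖ ≤ B * ‖v‖) →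
      pathELength (𝓡 n) (fun t : ℝ => g (u + t • (u' - u))) 0 1 ≤ ENNReal.ofReal (B * ‖u' - u‖) := by
  set ℓ : ℝ → G := fun t => u + t • (u' - u) with hℓ
  have hmaps : MapsTo ℓ (Icc 0 1) A := fun t ht => hA.add_smul_sub_mem hu hu' ht
  have hℓd : ∀ t, HasDerivAt ℓ (u' - u) t := fun t => by
    have := ((hasDerivAt_id t).smul_const (u' - u)).const_add u
    rwa [one_smul] at this
  have hd : ∀ t ∈ Icc (0 : ℝ) 1, mfderivWithin 𝓘(ℝ, ℝ) (𝓡 n) (g ∘ ℓ) (Icc 0 1) t (1 : ℝ) =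
      mfderivWithin 𝓘(ℝ, G) (𝓡 n) g A (ℓ t) (u' - u) := by
    intro t ht
    have h1 := ((hg (ℓ t) (hmaps ht)).mdifferentiableWithinAt one_ne_zero).hasMFDerivWithinAt
    have h2 := h1.comp t (hℓd t).hasFDerivAt.hasMFDerivAt.hasMFDerivWithinAt
      (fun t ht => hmaps ht : Icc (0 : ℝ) 1 ⊆ ℓ ⁻¹' A)
    rw [h2.mfderivWithin
      ((uniqueMDiffWithinAt_iff_uniqueDiffWithinAt).2 (uniqueDiffOn_Icc zero_lt_one t ht))]
    exact congrArg (mfderivWithin 𝓘(ℝ, G) (𝓡 n) g A (ℓ t)) (one_smul ℝ (u' - u))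
  have hℓs : ContMDiff 𝓘(ℝ, ℝ) 𝓘(ℝ, G) 1 ℓ :=
    (contDiff_const.add (contDiff_id.smul contDiff_const)).contMDiff
  refine ⟨⟨hg.comp hℓs.contMDiffOn hmaps, fun t ht => ?_⟩, fun B hB => ?_⟩
  · change mfderivWithin 𝓘(ℝ, ℝ) (𝓡 n) (g ∘ ℓ) (Icc 0 1) t (1 : ℝ) ∈ E (g (ℓ t))
    rw [hd t ht]
    exact hgE _ (hmaps ht) _
  · rw [pathELength_eq_lintegral_mfderivWithin_Icc]
    calc _ ≤ ∫⁻ _ in Icc (0 : ℝ) 1, ENNReal.ofReal (B * ‖u' - u‖) := by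
          refine MeasureTheory.setLIntegral_mono measurable_const fun t ht => ?_
          change ‖mfderivWithin 𝓘(ℝ, ℝ) (𝓡 n) (g ∘ ℓ) (Icc 0 1) t (1 : ℝ)‖ₑ ≤ _
          rw [hd t ht, ← ofReal_norm]
          exact ENNReal.ofReal_le_ofReal (hB _ (hmaps ht) _)
      _ = _ := by simp

variable [IsContinuousRiemannianBundle (EuclideanSpace ℝ (Fin n))
  (fun x : M => TangentSpace (𝓡 n) x)]

/-- Continuity of the norm of the tangent map at the zero vector over `u₀` bounds small vectors by
`1`; homogeneity extends this to all vectors without operator norms on varying tangent spaces. -/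
theorem eventually_norm_mfderivWithin_le {g : G → M} {A : Set G}
    (hA : UniqueDiffOn ℝ A) (hg : ContMDiffOn 𝓘(ℝ, G) (𝓡 n) 1 g A) {u₀ : G} (hu₀ : u₀ ∈ A) :
    ∃ B > 0, ∀ᶠ u in 𝓝[A] u₀, ∀ v : G, ‖mfderivWithin 𝓘(ℝ, G) (𝓡 n) g A u v‖ ≤ B * ‖v‖ := by
  have h1 : ContinuousOn (fun q : G × G => (⟨q.1, q.2⟩ : TangentBundle 𝓘(ℝ, G) G)) (A ×ˢ univ) :=
    (tangentBundleModelSpaceHomeomorph 𝓘(ℝ, G)).symm.continuous.continuousOn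
  have h2 := (hg.continuousOn_tangentMapWithin le_rfl hA.uniqueMDiffOn).comp h1
    fun q hq => hq.1
  have h3 : ContinuousOn (fun q : G × G => ‖mfderivWithin 𝓘(ℝ, G) (𝓡 n) g A q.1 q.2‖)
      (A ×ˢ univ) := by
    have hn : Continuous fun v : TangentBundle (𝓡 n) M => ‖v.2‖ := continuous_norm_tangentBundle
    have := hn.comp_continuousOn h2
    exact this
  have h4 := h3 (u₀, 0) ⟨hu₀, trivial⟩
  have h0 : ‖mfderivWithin 𝓘(ℝ, G) (𝓡 n) g A u₀ (0 : G)‖ < 1 := by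
    have : mfderivWithin 𝓘(ℝ, G) (𝓡 n) g A u₀ (0 : G) = 0 :=
      map_zero (mfderivWithin 𝓘(ℝ, G) (𝓡 n) g A u₀)
    rw [this, norm_zero]
    exact one_pos
  have h5 := h4.eventually (gt_mem_nhds h0)
  rw [nhdsWithin_prod_eq, nhdsWithin_univ] at h5
  obtain ⟨Q1, hQ1, Q2, hQ2, H⟩ := eventually_prod_iff.1 h5
  obtain ⟨ε, hε, Hε⟩ := Metric.eventually_nhds_iff.1 hQ2
  refine ⟨2 / ε, by positivity, hQ1.mono fun u hu v => ?_⟩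
  by_cases hv : v = 0
  · have : mfderivWithin 𝓘(ℝ, G) (𝓡 n) g A u (0 : G) = 0 :=
      map_zero (mfderivWithin 𝓘(ℝ, G) (𝓡 n) g A u)
    rw [hv, this, norm_zero, norm_zero, mul_zero]
  have hv0 : 0 < ‖v‖ := norm_pos_iff.2 hv
  have h6 := H hu (y := (ε / 2 / ‖v‖) • v) (Hε (by
    rw [dist_zero_right, norm_smul, norm_div, norm_norm, div_mul_cancel₀ _ hv0.ne',
      Real.norm_of_nonneg (by positivity)]
    exact half_lt_self hε))
  have h7 : mfderivWithin 𝓘(ℝ, G) (𝓡 n) g A u ((ε / 2 / ‖v‖) • v) =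
      (ε / 2 / ‖v‖) • mfderivWithin 𝓘(ℝ, G) (𝓡 n) g A u v :=
    map_smul (mfderivWithin 𝓘(ℝ, G) (𝓡 n) g A u) _ v
  simp only at h6
  rw [h7, norm_smul, Real.norm_of_nonneg (by positivity), div_div, div_mul_eq_mul_div,
    div_lt_one (by positivity)] at h6
  rw [div_mul_eq_mul_div, le_div_iff₀ hε]
  linarith

/-- The speed is bounded on `[0, 1]`, and any subarc, possibly reversed, is an affine
reparametrisation of `γ`. -/
theorem IsTangentCurve.exists_tangentJoined {γ : ℝ → M} (hγ : IsTangentCurve E γ) :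
    ∃ B > 0, ∀ a ∈ Icc (0 : ℝ) 1, ∀ b ∈ Icc (0 : ℝ) 1, ∀ η, B * |b - a| < η →
      TangentJoined E η (γ a) (γ b) := by
  have hu := uniqueDiffOn_Icc (zero_lt_one' ℝ)
  obtain ⟨B, hB⟩ : ∃ B, ∀ t ∈ Icc (0 : ℝ) 1, ∀ v : ℝ,
      ‖mfderivWithin 𝓘(ℝ, ℝ) (𝓡 n) γ (Icc 0 1) t v‖ ≤ B * ‖v‖ := by
    refine isCompact_Icc.induction_on (p := fun A => ∃ B, ∀ t ∈ A, ∀ v : ℝ,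
      ‖mfderivWithin 𝓘(ℝ, ℝ) (𝓡 n) γ (Icc 0 1) t v‖ ≤ B * ‖v‖) ⟨0, by simp⟩
      (fun A A' hAA' ⟨B, hB⟩ => ⟨B, fun t ht => hB t (hAA' ht)⟩)
      (fun A A' ⟨B, hB⟩ ⟨B', hB'⟩ => ⟨max B B', fun t ht v => ?_⟩) fun t ht => ?_
    · rcases ht with ht | ht
      · exact (hB t ht v).trans (mul_le_mul_of_nonneg_right (le_max_left _ _) (norm_nonneg _))
      · exact (hB' t ht v).trans (mul_le_mul_of_nonneg_right (le_max_right _ _) (norm_nonneg _))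
    · obtain ⟨B, -, hB⟩ := eventually_norm_mfderivWithin_le hu hγ.1 ht
      exact ⟨_, hB, B, fun t ht => ht⟩
  refine ⟨max B 1, by positivity, fun a ha b hb η hη => ?_⟩
  have hE : ∀ t ∈ Icc (0 : ℝ) 1, ∀ v : ℝ,
      mfderivWithin 𝓘(ℝ, ℝ) (𝓡 n) γ (Icc 0 1) t v ∈ E (γ t) := by
    intro t ht v
    have h1 : mfderivWithin 𝓘(ℝ, ℝ) (𝓡 n) γ (Icc 0 1) t v =
        v • mfderivWithin 𝓘(ℝ, ℝ) (𝓡 n) γ (Icc 0 1) t (1 : ℝ) := by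
      have := map_smul (mfderivWithin 𝓘(ℝ, ℝ) (𝓡 n) γ (Icc 0 1) t) v (1 : ℝ)
      refine Eq.trans ?_ this
      exact congrArg (mfderivWithin 𝓘(ℝ, ℝ) (𝓡 n) γ (Icc 0 1) t) (mul_one v).symm
    rw [h1]
    exact (E (γ t)).smul_mem v (hγ.2 t ht)
  obtain ⟨h1, h2⟩ := isTangentCurve_segment (convex_Icc 0 1) hγ.1 hE ha hb
  refine ⟨_, h1, by simp, by simp, (h2 B hB).trans_lt ?_⟩
  have h3 : B * |b - a| ≤ max B 1 * |b - a| :=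
    mul_le_mul_of_nonneg_right (le_max_left _ _) (abs_nonneg _)
  have h4 : 0 ≤ max B 1 * |b - a| := by positivity
  exact (ENNReal.ofReal_lt_ofReal_iff (h4.trans_lt hη)).2 (h3.trans_lt hη)

/-- A tangent curve is a chain of short tangent curves. -/
theorem IsTangentCurve.eqvGen {γ : ℝ → M} (hγ : IsTangentCurve E γ) {δ : ℝ} (hδ : 0 < δ)
    {S : M → M → Prop} (hS : ∀ x y, TangentJoined E δ x y → S x y) :
    Relation.EqvGen S (γ 0) (γ 1) := by
  obtain ⟨B, hB, H⟩ := hγ.exists_tangentJoined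
  obtain ⟨N, hN⟩ := exists_nat_gt (B / δ)
  have hN0 : (0 : ℝ) < N := (by positivity : 0 ≤ B / δ).trans_lt hN
  have key : ∀ k : ℕ, k ≤ N → Relation.EqvGen S (γ 0) (γ (k / N)) := by
    intro k
    induction k with
    | zero => intro _; rw [Nat.cast_zero, zero_div]; exact .refl _
    | succ k ih =>
      intro hk
      have hk' : ((k + 1 : ℕ) : ℝ) ≤ N := by exact_mod_cast hk
      push_cast at hk' ⊢
      refine .trans _ _ _ (ih (by omega)) (.rel _ _ (hS _ _ (H _ ⟨by positivity, ?_⟩ _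
        ⟨by positivity, ?_⟩ _ ?_)))
      · rw [div_le_one hN0]; linarith
      · rwa [div_le_one hN0]
      · rw [← sub_div, add_sub_cancel_left, abs_of_pos (by positivity), mul_one_div, div_lt_iff₀ hN0]
        rwa [div_lt_iff₀' hδ] at hN
  have := key N le_rfl
  rwa [div_self hN0.ne'] at this

end curves

/-! ### Leaves as classes of tangent chains. -/

section leaves
open Filter Metric
variable {n : ℕ} {M : Type*} [TopologicalSpace M] [ChartedSpace (EuclideanSpace ℝ (Fin n)) M]
  [IsManifold (𝓡 n) ∞ M] {E : (x : M) → Submodule ℝ (TangentSpace (𝓡 n) x)}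

theorem leaf_eq {W : Setoid M} {x y : M} (h : W.r x y) : leaf W x = leaf W y :=
  Set.ext fun _ => ⟨fun hz => W.trans hz h, fun hz => W.trans hz (W.symm h)⟩

theorem mem_leaf_self (W : Setoid M) (x : M) : x ∈ leaf W x := W.refl x

/-- The partition of `M` into the sets of points that can be joined by piecewise `C¹` curves tangent
to `E`. -/
def tangentSetoid (E : (x : M) → Submodule ℝ (TangentSpace (𝓡 n) x)) : Setoid M :=
  Relation.EqvGen.setoid fun x y => ∃ γ : ℝ → M, IsTangentCurve E γ ∧ γ 0 = x ∧ γ 1 = y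

variable [RiemannianBundle (fun x : M => TangentSpace (𝓡 n) x)]

theorem TangentJoined.tangentSetoid {η : ℝ} {x y : M} (h : TangentJoined E η x y) :
    (tangentSetoid E).r x y := by
  obtain ⟨γ, h1, h2, h3, -⟩ := h
  exact .rel _ _ ⟨γ, h1, h2, h3⟩

variable [IsContinuousRiemannianBundle (EuclideanSpace ℝ (Fin n))
  (fun x : M => TangentSpace (𝓡 n) x)]

theorem IsTangentCurve.tangentSetoid {γ : ℝ → M} (hγ : IsTangentCurve E γ) {a b : ℝ}
    (ha : a ∈ Icc (0 : ℝ) 1) (hb : b ∈ Icc (0 : ℝ) 1) : (tangentSetoid E).r (γ a) (γ b) := by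
  obtain ⟨B, -, H⟩ := hγ.exists_tangentJoined
  exact (H a ha b hb _ (lt_add_one _)).tangentSetoid

theorem isPathConnected_leaf_tangentSetoid (x : M) :
    IsPathConnected (leaf (tangentSetoid E) x) := by
  refine ⟨x, mem_leaf_self _ x, fun {y} hy => ?_⟩
  have hy' := (tangentSetoid E).symm hy
  change Relation.EqvGen _ x y at hy'
  have key : (_root_.tangentSetoid E).r x y ∧ JoinedIn (leaf (_root_.tangentSetoid E) x) x y := by
    clear hy
    induction hy' with
    | rel x y h =>
      refine ⟨.rel _ _ h, ?_⟩
      obtain ⟨γ, hγ, rfl, rfl⟩ := h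
      refine JoinedIn.ofLine (f := γ) hγ.1.continuousOn rfl rfl ?_
      rintro _ ⟨t, ht, rfl⟩
      exact hγ.tangentSetoid ht (left_mem_Icc.2 zero_le_one)
    | refl x => exact ⟨.refl _, JoinedIn.refl (mem_leaf_self _ x)⟩
    | symm x y _ ih =>
      exact ⟨(_root_.tangentSetoid E).symm ih.1, leaf_eq ih.1 ▸ ih.2.symm⟩
    | trans x y z _ _ ih ih' =>
      refine ⟨(_root_.tangentSetoid E).trans ih.1 ih'.1, ih.2.trans ?_⟩
      rw [leaf_eq ih.1]
      exact ih'.2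
  exact key.2

end leaves

/-! ### Coordinates along and across the central direction. -/

section coordinates
open Metric

/-- Orthonormal coordinates on the range of an idempotent. Applied to the central projection and to
its complement, they give the two factors of a box. -/
theorem ContinuousLinearMap.exists_isometric_coords {F : Type*} [NormedAddCommGroup F]
    [InnerProductSpace ℝ F] [FiniteDimensional ℝ F] (B : F →L[ℝ] F) (hB : ∀ w, B (B w) = B w) :
    ∃ (k : ℕ) (a : EuclideanSpace ℝ (Fin k) →ₗᵢ[ℝ] F) (a' : F →L[ℝ] EuclideanSpace ℝ (Fin k)),
      (∀ u, B (a u) = a u) ∧ ∀ w, a (a' w) = B w := by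
  let S := LinearMap.range B.toLinearMap
  let b := (stdOrthonormalBasis ℝ S).repr
  refine ⟨_, S.subtypeₗᵢ.comp b.symm.toLinearIsometry,
    b.toContinuousLinearEquiv.toContinuousLinearMap ∘L
      (B.codRestrict S fun w => LinearMap.mem_range_self _ w), fun u => ?_, fun w => ?_⟩
  · obtain ⟨w, hw⟩ := (b.symm u).2
    change B (b.symm u : F) = (b.symm u : F)
    rw [← hw]
    exact hB w
  · change ((b.symm (b (B.codRestrict S _ w)) : S) : F) = B w
    rw [b.symm_apply_apply]
    rfl

end coordinates

/-! ### Sliding in a chart: uniqueness, continuity and straightened plaques. -/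

section chartbox
open Filter Metric
variable {n : ℕ} {M : Type*} [TopologicalSpace M] [ChartedSpace (EuclideanSpace ℝ (Fin n)) M]
  [IsManifold (𝓡 n) ∞ M] [RiemannianBundle (fun x : M => TangentSpace (𝓡 n) x)]
  [IsContinuousRiemannianBundle (EuclideanSpace ℝ (Fin n)) (fun x : M => TangentSpace (𝓡 n) x)]

/-- The last clause is the mean value inequality for `c t - t • S v`. It identifies the derivative
of sliding, at zero displacement, with the lift. -/
theorem IsLiftBall.exists_slide {ι : Type*} [Fintype ι] [DecidableEq ι]
    {E : ι → (x : M) → Submodule ℝ (TangentSpace (𝓡 n) x)}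
    {pr : ι → (x : M) → TangentSpace (𝓡 n) x →L[ℝ] TangentSpace (𝓡 n) x}
    {i : ι} {p : M} {R K : ℝ} (hB : IsLiftBall E pr i p R K) {w v : EuclideanSpace ℝ (Fin n)}
    (hv : chartProj pr i p p v = v) (hw : ‖w - extChartAt (𝓡 n) p p‖ + K * ‖v‖ < R) {δ : ℝ}
    (hδ : K * (K * ‖v‖) < δ) :
    ∃ w', ‖w' - w‖ ≤ K * ‖v‖ ∧ chartProj pr i p p w' = chartProj pr i p p w + v ∧
      TangentJoined (E i) δ ((extChartAt (𝓡 n) p).symm w) ((extChartAt (𝓡 n) p).symm w') ∧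
      ∀ ε, (∀ z, ‖z - w‖ ≤ K * ‖v‖ → ‖chartLift pr i p ((extChartAt (𝓡 n) p).symm z) -
        chartLift pr i p ((extChartAt (𝓡 n) p).symm w)‖ ≤ ε) →
        ‖w' - w - chartLift pr i p ((extChartAt (𝓡 n) p).symm w) v‖ ≤ ε * ‖v‖ := by
  obtain ⟨c, c', hc', hd, hc0, Hc⟩ := hB.exists_curve hv hw
  obtain ⟨ht, hl⟩ := hB.isTangentCurve hc' hd fun t ht => ⟨(Hc t ht).1, (Hc t ht).2.1⟩
  have h1 : (1 : ℝ) ∈ Icc (0 : ℝ) 1 := right_mem_Icc.2 zero_le_one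
  have hK := hB.K_pos
  refine ⟨c 1, (Hc 1 h1).2.2.2, ?_, ⟨_, ht, by rw [hc0], rfl, hl.trans_lt
    ((ENNReal.ofReal_lt_ofReal_iff ((by positivity : (0 : ℝ) ≤ K * (K * ‖v‖)).trans_lt hδ)).2 hδ)⟩,
    fun ε hε => ?_⟩
  · rw [(Hc 1 h1).2.2.1, one_smul]
  · set S := chartLift pr i p ((extChartAt (𝓡 n) p).symm w)
    have h2 := norm_image_sub_le_of_norm_deriv_le_segment' (f := fun t => c t - t • S v)
      (f' := fun t => c' t - S v) (a := 0) (b := 1) (C := ε * ‖v‖)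
      (fun t _ => by
        have := (hd t).sub ((hasDerivAt_id t).smul_const (S v))
        rw [one_smul] at this
        exact this.hasDerivWithinAt) (fun t ht => by
        have ht' : t ∈ Icc (0 : ℝ) 1 := ⟨ht.1, ht.2.le⟩
        rw [(Hc t ht').2.1, ← sub_apply]
        exact ContinuousLinearMap.le_of_opNorm_le _ (hε _ (Hc t ht').2.2.2) v) 1 h1
    rw [one_smul, zero_smul, sub_zero, hc0, sub_zero, mul_one] at h2
    rwa [sub_right_comm]

/-- The data used to construct flow boxes. -/
structure IsCentralSystem {V : Type*} [NormedAddCommGroup V] [InnerProductSpace ℝ V]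
    [FiniteDimensional ℝ V] (E : Fin 3 → (x : M) → Submodule ℝ (TangentSpace (𝓡 n) x))
    (pr : Fin 3 → (x : M) → TangentSpace (𝓡 n) x →L[ℝ] TangentSpace (𝓡 n) x)
    (e : M → V) (L : (x : M) → V →ₗ[ℝ] TangentSpace (𝓡 n) x) (C : ℝ) (F : Equiv.Perm M)
    (r κ C' : ℝ) : Prop where
  proj : IsProjectionFamily E pr
  left_inv : IsLeftInverseFamily e L C
  cone : ConeSystem F (fun x y => ‖e y - e x‖) (splitDist e L pr 0) (splitDist e L pr 1)
    (splitDist e L pr 2) r κ C'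
  plaque : PlaqueSystem F (fun x y => ‖e y - e x‖) (splitDist e L pr 0) (splitDist e L pr 1)
    (splitDist e L pr 2) (TangentJoined (E 1))
  continuous_zpow : ∀ k : ℤ, Continuous ⇑(F ^ k)

variable {V : Type*} [NormedAddCommGroup V] [InnerProductSpace ℝ V] [FiniteDimensional ℝ V]
  {E : Fin 3 → (x : M) → Submodule ℝ (TangentSpace (𝓡 n) x)}
  {pr : Fin 3 → (x : M) → TangentSpace (𝓡 n) x →L[ℝ] TangentSpace (𝓡 n) x}
  {e : M → V} {L : (x : M) → V →ₗ[ℝ] TangentSpace (𝓡 n) x} {C : ℝ} {F : Equiv.Perm M}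
  {r κ C' : ℝ}

/-- Orbit-closeness, in the chart at `p`. -/
def ChartClose (F : Equiv.Perm M) (e : M → V) (p : M) (β : ℝ) (w w' : EuclideanSpace ℝ (Fin n)) :
    Prop :=
  OrbitClose F (fun x y => ‖e y - e x‖) β ((extChartAt (𝓡 n) p).symm w)
    ((extChartAt (𝓡 n) p).symm w')

/-- A ball in the chart at `p` in which orbit-close points with the same central coordinates are
equal. -/
structure IsPlaqueBall (E : Fin 3 → (x : M) → Submodule ℝ (TangentSpace (𝓡 n) x))
    (pr : Fin 3 → (x : M) → TangentSpace (𝓡 n) x →L[ℝ] TangentSpace (𝓡 n) x)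
    (e : M → V) (F : Equiv.Perm M) (r : ℝ) (p : M) (R K : ℝ) : Prop
    extends IsLiftBall E pr 1 p R K where
  eq_of_close : ∀ w ∈ closedBall (extChartAt (𝓡 n) p p) R,
    ∀ w₁ ∈ closedBall (extChartAt (𝓡 n) p p) R, ∀ w₂ ∈ closedBall (extChartAt (𝓡 n) p p) R,
    ChartClose F e p r w w₁ → ChartClose F e p r w w₂ →
    chartProj pr 1 p p w₁ = chartProj pr 1 p p w₂ → w₁ = w₂

theorem IsCentralSystem.exists_isPlaqueBall [CompactSpace M]
    (h : IsCentralSystem E pr e L C F r κ C') {p : M} {U : Set M} (hU : U ∈ 𝓝 p) :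
    ∃ R K, IsPlaqueBall E pr e F r p R K ∧
      ∀ z ∈ closedBall (extChartAt (𝓡 n) p p) R, (extChartAt (𝓡 n) p).symm z ∈ U := by
  obtain ⟨U', hU', HU'⟩ := exists_nhds_of_eventually_diagonal
    (P := fun x y z => chartProj pr 1 p p (extChartAt (𝓡 n) p z - extChartAt (𝓡 n) p y) = 0 →
      splitDist e L pr 1 x y z ≤
      1 / 2 * max (splitDist e L pr 0 x y z) (splitDist e L pr 2 x y z))
    (h.proj.eventually_splitDist_le h.left_inv p)
  obtain ⟨R, K, hB, hBU⟩ := h.proj.exists_isLiftBall 1 (inter_mem hU hU')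
  refine ⟨R, K, ⟨hB, fun w hw w₁ hw₁ w₂ hw₂ h1 h2 h12 => ?_⟩, fun z hz => (hBU z hz).1⟩
  have h3 := h.cone.eq_of_c_small h1 h2 (HU' _ (hBU w hw).2 _ (hBU w₁ hw₁).2 _ (hBU w₂ hw₂).2 (by
    rw [(extChartAt (𝓡 n) p).right_inv (hB.subset hw₁),
      (extChartAt (𝓡 n) p).right_inv (hB.subset hw₂), map_sub, h12, sub_self]))
  rw [← (extChartAt (𝓡 n) p).right_inv (hB.subset hw₁), h3,
    (extChartAt (𝓡 n) p).right_inv (hB.subset hw₂)]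

/-- Sliding along plaques, as a function. -/
structure IsSlide (E : Fin 3 → (x : M) → Submodule ℝ (TangentSpace (𝓡 n) x))
    (pr : Fin 3 → (x : M) → TangentSpace (𝓡 n) x →L[ℝ] TangentSpace (𝓡 n) x)
    (e : M → V) (F : Equiv.Perm M) (p : M) (R K δ β : ℝ)
    (Γ : EuclideanSpace ℝ (Fin n) × EuclideanSpace ℝ (Fin n) → EuclideanSpace ℝ (Fin n))
    (D : Set (EuclideanSpace ℝ (Fin n) × EuclideanSpace ℝ (Fin n))) : Prop where
  mem_iff : ∀ q, q ∈ D ↔ chartProj pr 1 p p q.2 = q.2 ∧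
    ‖q.1 - extChartAt (𝓡 n) p p‖ + K * ‖q.2‖ < R ∧ K * (K * ‖q.2‖) < δ
  norm_sub_le : ∀ q ∈ D, ‖Γ q - q.1‖ ≤ K * ‖q.2‖
  proj_eq : ∀ q ∈ D, chartProj pr 1 p p (Γ q) = chartProj pr 1 p p q.1 + q.2
  tangent : ∀ q ∈ D, (tangentSetoid (E 1)).r ((extChartAt (𝓡 n) p).symm q.1)
    ((extChartAt (𝓡 n) p).symm (Γ q))
  close : ∀ q ∈ D, ChartClose F e p β q.1 (Γ q)
  approx : ∀ q ∈ D, ∀ ε, (∀ z, ‖z - q.1‖ ≤ K * ‖q.2‖ →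
      ‖chartLift pr 1 p ((extChartAt (𝓡 n) p).symm z) -
        chartLift pr 1 p ((extChartAt (𝓡 n) p).symm q.1)‖ ≤ ε) →
      ‖Γ q - q.1 - chartLift pr 1 p ((extChartAt (𝓡 n) p).symm q.1) q.2‖ ≤ ε * ‖q.2‖

namespace IsPlaqueBall
variable {p : M} {R K β : ℝ}

theorem exists_isSlide (h : IsCentralSystem E pr e L C F r κ C')
    (hB : IsPlaqueBall E pr e F r p R K) (hβ : 0 < β) :
    ∃ δ > 0, ∃ Γ D, IsSlide E pr e F p R K δ β Γ D := by
  obtain ⟨δ, hδ, Hδ⟩ := h.plaque.stable β hβ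
  let D : Set (EuclideanSpace ℝ (Fin n) × EuclideanSpace ℝ (Fin n)) :=
    {q | chartProj pr 1 p p q.2 = q.2 ∧
    ‖q.1 - extChartAt (𝓡 n) p p‖ + K * ‖q.2‖ < R ∧ K * (K * ‖q.2‖) < δ}
  have : ∀ q, ∃ w', q ∈ D → _ := fun q => by
    by_cases hq : q ∈ D
    · obtain ⟨w', hw'⟩ := hB.exists_slide hq.1 hq.2.1 hq.2.2
      exact ⟨w', fun _ => hw'⟩
    -- The value outside `D` is irrelevant. Inside `D`, `Γ` is an arbitrary choice of endpoints,
    -- since Peano curves are not unique.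
    · exact ⟨0, fun hq' => absurd hq' hq⟩
  choose Γ hΓ using this
  exact ⟨δ, hδ, Γ, D, fun q => Iff.rfl, fun q hq => (hΓ q hq).1, fun q hq => (hΓ q hq).2.1,
    fun q hq => (hΓ q hq).2.2.1.tangentSetoid, fun q hq => Hδ _ _ (hΓ q hq).2.2.1,
    fun q hq => (hΓ q hq).2.2.2⟩

variable {δ : ℝ}
  {Γ : EuclideanSpace ℝ (Fin n) × EuclideanSpace ℝ (Fin n) → EuclideanSpace ℝ (Fin n)}
  {D : Set (EuclideanSpace ℝ (Fin n) × EuclideanSpace ℝ (Fin n))}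

theorem _root_.IsSlide.mem_closedBall (hΓ : IsSlide E pr e F p R K δ β Γ D)
    (hK : 0 < K) {q : EuclideanSpace ℝ (Fin n) × EuclideanSpace ℝ (Fin n)} (hq : q ∈ D) :
    q.1 ∈ closedBall (extChartAt (𝓡 n) p p) R ∧ Γ q ∈ closedBall (extChartAt (𝓡 n) p p) R := by
  have h1 := ((hΓ.mem_iff q).1 hq).2.1
  have h2 : 0 ≤ K * ‖q.2‖ := by positivity
  have h3 := norm_sub_le_norm_sub_add_norm_sub (Γ q) q.1 (extChartAt (𝓡 n) p p)
  have h4 := hΓ.norm_sub_le q hq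
  exact ⟨mem_closedBall_iff_norm.2 (by linarith), mem_closedBall_iff_norm.2 (by linarith)⟩

/-- By compactness it suffices to identify limits along ultrafilters. A limit of values of `Γ` is
still orbit-close to the starting point and has the prescribed central coordinate; uniqueness in the
ball leaves only `Γ q₀`. -/
theorem continuousOn_slide (h : IsCentralSystem E pr e L C F r κ C')
    (hB : IsPlaqueBall E pr e F r p R K) (hΓ : IsSlide E pr e F p R K δ β Γ D) (hβr : β ≤ r) :
    ContinuousOn Γ D := by
  intro q₀ hq₀
  rw [ContinuousWithinAt, tendsto_iff_ultrafilter]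
  intro 𝒰 h𝒰
  have hD : D ∈ (𝒰 : Filter _) := h𝒰 self_mem_nhdsWithin
  set Bl := closedBall (extChartAt (𝓡 n) p p) R
  have hBl : IsCompact Bl := isCompact_closedBall _ _
  have hmem : ∀ q ∈ D, q.1 ∈ Bl ∧ Γ q ∈ Bl := fun q hq => hΓ.mem_closedBall hB.K_pos hq
  obtain ⟨w', hw', hlim⟩ := hBl.ultrafilter_le_nhds (𝒰.map Γ)
    (le_principal_iff.2 (show Γ ⁻¹' Bl ∈ (𝒰 : Filter _) from
      mem_of_superset hD fun q hq => (hmem q hq).2))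
  have t1 : Tendsto Γ 𝒰 (𝓝[Bl] w') := tendsto_nhdsWithin_iff.2
    ⟨hlim, mem_of_superset hD fun q hq => (hmem q hq).2⟩
  have t2 : Tendsto Prod.fst (𝒰 : Filter _) (𝓝[Bl] q₀.1) := tendsto_nhdsWithin_iff.2
    ⟨(continuous_fst.tendsto q₀).mono_left (h𝒰.trans nhdsWithin_le_nhds),
      mem_of_superset hD fun q hq => (hmem q hq).1⟩
  have t3 : Tendsto Prod.snd (𝒰 : Filter _) (𝓝 q₀.2) :=
    (continuous_snd.tendsto q₀).mono_left (h𝒰.trans nhdsWithin_le_nhds)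
  have hψ : ContinuousOn (extChartAt (𝓡 n) p).symm Bl :=
    (continuousOn_extChartAt_symm p).mono hB.subset
  have hclose : ChartClose F e p β q₀.1 w' := fun k => by
    have hc : ContinuousOn (fun w => e ((F ^ k) ((extChartAt (𝓡 n) p).symm w))) Bl :=
      (h.left_inv.contMDiff.continuous.comp (h.continuous_zpow k)).comp_continuousOn hψ
    have s1 := (hc w' hw').tendsto.comp t1
    have s2 := (hc q₀.1 (hmem q₀ hq₀).1).tendsto.comp t2
    exact le_of_tendsto (s1.sub s2).norm (mem_of_superset hD fun q hq => hΓ.close q hq k)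
  have hproj : chartProj pr 1 p p w' = chartProj pr 1 p p q₀.1 + q₀.2 := by
    have s1 := ((chartProj pr 1 p p).continuous.tendsto w').comp hlim
    have s2 := (((chartProj pr 1 p p).continuous.tendsto q₀.1).comp
      (t2.mono_right nhdsWithin_le_nhds)).add t3
    refine tendsto_nhds_unique (s1.congr' (mem_of_superset hD fun q hq => ?_)) s2
    exact hΓ.proj_eq q hq
  have heq : Γ q₀ = w' := hB.eq_of_close q₀.1 (hmem q₀ hq₀).1 _ (hmem q₀ hq₀).2 _ hw'
    ((hΓ.close q₀ hq₀).mono hβr) (hclose.mono hβr) ((hΓ.proj_eq q₀ hq₀).trans hproj.symm)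
  rw [heq]
  exact hlim

end IsPlaqueBall
end chartbox

section chartbox
open Filter Metric
variable {n : ℕ} {M : Type*} [TopologicalSpace M] [ChartedSpace (EuclideanSpace ℝ (Fin n)) M]
  [IsManifold (𝓡 n) ∞ M] [RiemannianBundle (fun x : M => TangentSpace (𝓡 n) x)]
  [IsContinuousRiemannianBundle (EuclideanSpace ℝ (Fin n)) (fun x : M => TangentSpace (𝓡 n) x)]
  {V : Type*} [NormedAddCommGroup V] [InnerProductSpace ℝ V] [FiniteDimensional ℝ V]
  {E : Fin 3 → (x : M) → Submodule ℝ (TangentSpace (𝓡 n) x)}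
  {pr : Fin 3 → (x : M) → TangentSpace (𝓡 n) x →L[ℝ] TangentSpace (𝓡 n) x}
  {e : M → V} {L : (x : M) → V →ₗ[ℝ] TangentSpace (𝓡 n) x} {C : ℝ} {F : Equiv.Perm M}
  {r κ C' : ℝ} {p : M} {R K β : ℝ} {k m : ℕ}

/-- Coordinates, in the chart at `p`, that straighten the plaques. -/
structure IsChartBox (E : Fin 3 → (x : M) → Submodule ℝ (TangentSpace (𝓡 n) x))
    (pr : Fin 3 → (x : M) → TangentSpace (𝓡 n) x →L[ℝ] TangentSpace (𝓡 n) x)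
    (e : M → V) (F : Equiv.Perm M) (r : ℝ) (p : M) (R β : ℝ)
    (φ : OpenPartialHomeomorph (EuclideanSpace ℝ (Fin n))
      (EuclideanSpace ℝ (Fin k) × EuclideanSpace ℝ (Fin m)))
    (a : EuclideanSpace ℝ (Fin k) →L[ℝ] EuclideanSpace ℝ (Fin n)) : Prop where
  target_eq : φ.target = ball 0 1 ×ˢ ball 0 1
  mem_source : extChartAt (𝓡 n) p p ∈ φ.source
  source_subset : φ.source ⊆ closedBall (extChartAt (𝓡 n) p p) R
  injective : Function.Injective a
  proj_apply : ∀ u, chartProj pr 1 p p (a u) = a u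
  exists_apply : ∀ w, ∃ u, a u = chartProj pr 1 p p w
  close : ∀ w ∈ φ.source, ∀ w' ∈ φ.source, (φ w).2 = (φ w').2 → ChartClose F e p (2 * β) w w'
  tangent : ∀ w ∈ φ.source, ∀ w' ∈ φ.source, (φ w).2 = (φ w').2 →
    (tangentSetoid (E 1)).r ((extChartAt (𝓡 n) p).symm w) ((extChartAt (𝓡 n) p).symm w')
  eq_of_close : ∀ w ∈ φ.source, ∀ w' ∈ φ.source, ChartClose F e p (r - β) w w' →
    (φ w).2 = (φ w').2
  hasFDerivAt : ∀ z ∈ φ.target, HasFDerivAt (fun u => φ.symm (u, z.2))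
    ((chartLift pr 1 p ((extChartAt (𝓡 n) p).symm (φ.symm z))) ∘L a) z.1

/-- A point is described by its central coordinate and by the point `T w` where its plaque meets the
transversal `A w = A z₀`. The inverse `Ψ` slides a transversal point by a given central
displacement. Both maps are continuous because sliding is, and they are mutually inverse by
uniqueness of orbit-close points with a given central coordinate. -/
theorem IsPlaqueBall.exists_isChartBox (h : IsCentralSystem E pr e L C F r κ C')
    (hB : IsPlaqueBall E pr e F r p R K) (hβ : 0 < β) (hβr : 2 * β ≤ r) :
    ∃ (k m : ℕ) (φ : OpenPartialHomeomorph (EuclideanSpace ℝ (Fin n))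
      (EuclideanSpace ℝ (Fin k) × EuclideanSpace ℝ (Fin m)))
      (a : EuclideanSpace ℝ (Fin k) →L[ℝ] EuclideanSpace ℝ (Fin n)),
      IsChartBox E pr e F r p R β φ a := by
  obtain ⟨δ, hδ, Γ, D, hΓ⟩ := hB.exists_isSlide h hβ
  have hΓc := hB.continuousOn_slide h hΓ (by linarith)
  set A := chartProj pr 1 p p with hA
  set z₀ := extChartAt (𝓡 n) p p
  have hK := hB.K_pos
  have hR := hB.pos
  have hAA : ∀ w, A (A w) = A w :=
    fun w => h.proj.chartProj_chartProj (mem_extChartAt_source p) w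
  obtain ⟨k, a, a', ha, ha'⟩ := A.exists_isometric_coords hAA
  obtain ⟨m, b, b', hb, hb'⟩ := (1 - A).exists_isometric_coords fun w => by
    simp only [sub_apply, one_apply_eq_self, map_sub, hAA]; abel
  replace hb : ∀ u, A (b u) = 0 := fun u => by
    have := hb u
    rw [sub_apply, one_apply_eq_self, sub_eq_self] at this
    exact this
  replace hb' : ∀ w, b (b' w) = w - A w := hb'
  have ha'a : ∀ u, a' (a u) = u := fun u => a.injective (by rw [ha', ha])
  have hb'b : ∀ u, b' (b u) = u := fun u => b.injective (by rw [hb', hb, sub_zero])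
  have hsymm : ∀ {β : ℝ} {w w' : EuclideanSpace ℝ (Fin n)}, ChartClose F e p β w w' → ChartClose F e p β w' w :=
    fun hw => h.cone.orbitClose_symm hw
  have htrans : ∀ {β β' : ℝ} {w w' w'' : EuclideanSpace ℝ (Fin n)}, ChartClose F e p β w w' →
      ChartClose F e p β' w' w'' → ChartClose F e p (β + β') w w'' := fun hw hw' => h.cone.orbitClose_trans hw hw'
  -- radii
  set N := K * (‖A‖ + 1) with hN
  have hN0 : 0 < N := by positivity
  obtain ⟨ρ, hρ, hρR, hρδ⟩ : ∃ ρ > 0, ρ + N * ρ < R ∧ K * (N * ρ) < δ := by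
    have h1 : Tendsto (fun ρ : ℝ => ρ + N * ρ) (𝓝[>] 0) (𝓝 0) := by
      have : Tendsto (fun ρ : ℝ => ρ + N * ρ) (𝓝 0) (𝓝 (0 + N * 0)) :=
        Continuous.tendsto (by fun_prop) 0
      rw [mul_zero, add_zero] at this
      exact this.mono_left nhdsWithin_le_nhds
    have h2 : Tendsto (fun ρ : ℝ => K * (N * ρ)) (𝓝[>] 0) (𝓝 0) := by
      have : Tendsto (fun ρ : ℝ => K * (N * ρ)) (𝓝 0) (𝓝 (K * (N * 0))) :=
        Continuous.tendsto (by fun_prop) 0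
      rw [mul_zero, mul_zero] at this
      exact this.mono_left nhdsWithin_le_nhds
    obtain ⟨ρ, ⟨h3, h4⟩, h5⟩ := ((h1.eventually (gt_mem_nhds hR)).and
      (h2.eventually (gt_mem_nhds hδ))).and self_mem_nhdsWithin |>.exists
    exact ⟨ρ, h5, h3, h4⟩
  -- Starting within `σ` of the centre and sliding by at most `σ` ends within `σ + K * σ = ρ`, where
  -- `T` is defined.
  set σ := ρ / (1 + K) with hσ
  have hσ0 : 0 < σ := by positivity
  have hσρ : σ + K * σ = ρ := by rw [hσ]; field_simp
  -- the slide to the transversal through the centre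
  obtain ⟨T, hT⟩ : ∃ T : EuclideanSpace ℝ (Fin n) → EuclideanSpace ℝ (Fin n),
    ∀ w, T w = Γ (w, -A (w - z₀)) := ⟨_, fun _ => rfl⟩
  have hTD : ∀ w ∈ ball z₀ ρ, (w, -A (w - z₀)) ∈ D := fun w hw => by
    rw [mem_ball_iff_norm] at hw
    have h1 : K * ‖-A (w - z₀)‖ ≤ N * ρ := by
      rw [norm_neg, hN, mul_assoc]
      refine mul_le_mul_of_nonneg_left ((A.le_opNorm _).trans ?_) hK.le
      exact mul_le_mul (by linarith) hw.le (norm_nonneg _) (by positivity)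
    refine (hΓ.mem_iff _).2 ⟨by simp only [map_neg, hAA, ← hA], by simp only; linarith, ?_⟩
    exact (mul_le_mul_of_nonneg_left h1 hK.le).trans_lt hρδ
  have hTA : ∀ w ∈ ball z₀ ρ, A (T w) = A z₀ := fun w hw => by
    have := hΓ.proj_eq _ (hTD w hw)
    simp only [← hA] at this
    rw [hT, this, map_sub]; abel
  have hTclose : ∀ w ∈ ball z₀ ρ, ChartClose F e p β w (T w) := fun w hw => by
    rw [hT]
    exact hΓ.close _ (hTD w hw)
  have hTmem : ∀ w ∈ ball z₀ ρ, w ∈ closedBall z₀ R ∧ T w ∈ closedBall z₀ R := fun w hw => by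
    have h1 := hΓ.mem_closedBall hK (hTD w hw)
    rw [hT]
    exact h1
  -- `T w` is the only point of the transversal that shadows `w`, however it was reached; hence `T`
  -- is constant on plaques.
  have hTeq : ∀ w ∈ ball z₀ ρ, ∀ w' ∈ closedBall z₀ R, ChartClose F e p r w w' → A w' = A z₀ →
      T w = w' := fun w hw w' hw' hc hAw => hB.eq_of_close w (hTmem w hw).1 _ (hTmem w hw).2 _ hw'
    ((hTclose w hw).mono (by linarith)) hc ((hTA w hw).trans hAw.symm)
  -- the inverse
  obtain ⟨y, hy⟩ : ∃ y : EuclideanSpace ℝ (Fin m) → EuclideanSpace ℝ (Fin n),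
    ∀ v, y v = z₀ + σ • b v := ⟨_, fun _ => rfl⟩
  obtain ⟨Ψ, hΨ⟩ : ∃ Ψ : EuclideanSpace ℝ (Fin k) × EuclideanSpace ℝ (Fin m) →
    EuclideanSpace ℝ (Fin n), ∀ q, Ψ q = Γ (y q.2, σ • a q.1) := ⟨_, fun _ => rfl⟩
  have hyA : ∀ v, A (y v) = A z₀ := fun v => by rw [hy, map_add, map_smul, hb, smul_zero, add_zero]
  have hyn : ∀ v ∈ ball (0 : EuclideanSpace ℝ (Fin m)) 1, ‖y v - z₀‖ < σ := fun v hv => by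
    rw [mem_ball_zero_iff] at hv
    rw [hy, add_sub_cancel_left, norm_smul, b.norm_map, Real.norm_of_nonneg hσ0.le]
    exact mul_lt_of_lt_one_right hσ0 hv
  have hun : ∀ u ∈ ball (0 : EuclideanSpace ℝ (Fin k)) 1, ‖σ • a u‖ ≤ σ := fun u hu => by
    rw [mem_ball_zero_iff] at hu
    rw [norm_smul, a.norm_map, Real.norm_of_nonneg hσ0.le]
    exact mul_le_of_le_one_right hσ0.le hu.le
  have hΨD : ∀ q ∈ ball (0 : EuclideanSpace ℝ (Fin k)) 1 ×ˢ ball (0 : EuclideanSpace ℝ (Fin m)) 1,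
      (y q.2, σ • a q.1) ∈ D := fun q hq => by
    have h1 : K * ‖σ • a q.1‖ ≤ K * σ := mul_le_mul_of_nonneg_left (hun _ hq.1) hK.le
    have h2 := hyn _ hq.2
    have h3 : K * σ ≤ N * ρ := by
      rw [hN]
      have : σ ≤ ρ := by rw [← hσρ]; linarith [mul_pos hK hσ0]
      have h4 : K ≤ K * (‖A‖ + 1) := le_mul_of_one_le_right hK.le (by linarith [norm_nonneg A])
      exact mul_le_mul h4 this hσ0.le (by positivity)
    refine (hΓ.mem_iff _).2 ⟨by simp only [map_smul, ← hA, ha], ?_, ?_⟩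
    · simp only
      have : 0 < N * ρ := by positivity
      linarith
    · exact (mul_le_mul_of_nonneg_left (h1.trans h3) hK.le).trans_lt hρδ
  have hΨball : ∀ q ∈ ball (0 : EuclideanSpace ℝ (Fin k)) 1 ×ˢ
      ball (0 : EuclideanSpace ℝ (Fin m)) 1, Ψ q ∈ ball z₀ ρ := fun q hq => by
    have h1 : K * ‖σ • a q.1‖ ≤ K * σ := mul_le_mul_of_nonneg_left (hun _ hq.1) hK.le
    have h2 := hyn _ hq.2
    have h3 := hΓ.norm_sub_le _ (hΨD q hq)
    have h4 := norm_sub_le_norm_sub_add_norm_sub (Ψ q) (y q.2) z₀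
    rw [mem_ball_iff_norm]
    rw [← hΨ] at h3
    simp only at h3
    linarith
  have hΨA : ∀ q ∈ ball (0 : EuclideanSpace ℝ (Fin k)) 1 ×ˢ ball (0 : EuclideanSpace ℝ (Fin m)) 1,
      A (Ψ q) = A z₀ + σ • a q.1 := fun q hq => by
    rw [← hyA q.2, hΨ]; exact hΓ.proj_eq _ (hΨD q hq)
  have hΨclose : ∀ q ∈ ball (0 : EuclideanSpace ℝ (Fin k)) 1 ×ˢ
      ball (0 : EuclideanSpace ℝ (Fin m)) 1, ChartClose F e p β (y q.2) (Ψ q) :=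
    fun q hq => by
      rw [hΨ]
      exact hΓ.close _ (hΨD q hq)
  have hymem : ∀ v ∈ ball (0 : EuclideanSpace ℝ (Fin m)) 1, y v ∈ closedBall z₀ R := fun v hv =>
    (hΓ.mem_closedBall hK (hΨD (0, v) ⟨mem_ball_self one_pos, hv⟩)).1
  have hΨT : ∀ q ∈ ball (0 : EuclideanSpace ℝ (Fin k)) 1 ×ˢ ball (0 : EuclideanSpace ℝ (Fin m)) 1,
      T (Ψ q) = y q.2 := fun q hq =>
    hTeq _ (hΨball q hq) _ (hymem _ hq.2) ((hsymm (hΨclose q hq)).mono (by linarith)) (hyA _)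
  -- the box
  let Φ : EuclideanSpace ℝ (Fin n) → EuclideanSpace ℝ (Fin k) × EuclideanSpace ℝ (Fin m) :=
    fun w => (σ⁻¹ • a' (w - z₀), σ⁻¹ • b' (T w - z₀))
  have hTc : ContinuousOn T (ball z₀ ρ) := by
    refine (hΓc.comp (f := fun w => (w, -A (w - z₀))) ?_ fun w hw => hTD w hw).congr fun w _ => hT w
    fun_prop
  have hΦc : ContinuousOn Φ (ball z₀ ρ) := by
    have h1 : ContinuousOn (fun w => a' (w - z₀)) (ball z₀ ρ) :=
      (a'.continuous.comp (continuous_id.sub continuous_const)).continuousOn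
    have h2 : ContinuousOn (fun w => b' (T w - z₀)) (ball z₀ ρ) :=
      b'.continuous.comp_continuousOn (hTc.sub continuousOn_const)
    exact (h1.const_smul σ⁻¹).prodMk (h2.const_smul σ⁻¹)
  have hΦT : ∀ w ∈ ball z₀ ρ, y (Φ w).2 = T w := fun w hw => by
    simp only [hy, Φ, map_smul, smul_inv_smul₀ hσ0.ne', hb', map_sub, hTA w hw]
    abel
  have hΦa : ∀ w, σ • a (Φ w).1 = A (w - z₀) := fun w => by
    simp only [Φ, map_smul, smul_inv_smul₀ hσ0.ne', ha']
  let S : Set (EuclideanSpace ℝ (Fin n)) := ball z₀ ρ ∩ Φ ⁻¹' (ball 0 1 ×ˢ ball 0 1)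
  have hΨΦ : ∀ w ∈ S, Ψ (Φ w) = w := fun w hw => by
    have h1 := hΨclose _ hw.2
    rw [hΦT w hw.1] at h1
    have h2 := hΓ.mem_closedBall hK (hΨD _ hw.2)
    rw [← hΨ] at h2
    refine hB.eq_of_close (T w) (hTmem w hw.1).2 _ h2.2 _ (hTmem w hw.1).1 (h1.mono (by linarith))
      ((hsymm (hTclose w hw.1)).mono (by linarith)) ?_
    change A (Ψ (Φ w)) = A w
    rw [hΨA _ hw.2, hΦa, map_sub, add_sub_cancel]
  have hΦΨ : ∀ q ∈ ball (0 : EuclideanSpace ℝ (Fin k)) 1 ×ˢ ball (0 : EuclideanSpace ℝ (Fin m)) 1,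
      Φ (Ψ q) = q := fun q hq => by
    refine Prod.ext (a.injective ?_) ?_
    · refine smul_right_injective _ hσ0.ne' ?_
      simp only
      rw [hΦa, map_sub, hΨA q hq, add_sub_cancel_left]
    · change σ⁻¹ • b' (T (Ψ q) - z₀) = q.2
      rw [hΨT q hq, hy, add_sub_cancel_left, map_smul, hb'b, inv_smul_smul₀ hσ0.ne']
  let φ : OpenPartialHomeomorph (EuclideanSpace ℝ (Fin n))
      (EuclideanSpace ℝ (Fin k) × EuclideanSpace ℝ (Fin m)) :=
    { toFun := Φ
      invFun := Ψ
      source := S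
      target := ball 0 1 ×ˢ ball 0 1
      map_source' := fun w hw => hw.2
      map_target' := fun q hq => ⟨hΨball q hq, by rw [mem_preimage, hΦΨ q hq]; exact hq⟩
      left_inv' := hΨΦ
      right_inv' := hΦΨ
      open_source := hΦc.isOpen_inter_preimage isOpen_ball (isOpen_ball.prod isOpen_ball)
      open_target := isOpen_ball.prod isOpen_ball
      continuousOn_toFun := hΦc.mono inter_subset_left
      continuousOn_invFun := by
        refine (hΓc.comp (f := fun q : EuclideanSpace ℝ (Fin k) ×
          EuclideanSpace ℝ (Fin m) => (y q.2, σ • a q.1)) ?_ hΨD).congr fun q _ => hΨ q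
        simp only [hy]
        exact Continuous.continuousOn ((continuous_const.add ((b.continuous.comp
          continuous_snd).const_smul σ)).prodMk ((a.continuous.comp continuous_fst).const_smul σ)) }
  have hT2 : ∀ w ∈ S, ∀ w' ∈ S, (Φ w).2 = (Φ w').2 → T w = T w' := fun w hw w' hw' hww' => by
    rw [← hΦT w hw.1, hww', hΦT w' hw'.1]
  refine ⟨k, m, φ, σ • a.toContinuousLinearMap, rfl, ?_, fun w hw => (hTmem w hw.1).1, ?_, ?_, ?_,
    fun w hw w' hw' hww' => ?_, fun w hw w' hw' hww' => ?_, fun w hw w' hw' hc => ?_,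
    fun z hz => ?_⟩
  · have h0 : z₀ ∈ ball z₀ ρ := mem_ball_self hρ
    have h1 : T z₀ = z₀ := hTeq _ h0 _ (hTmem _ h0).1
      (h.cone.orbitClose_refl (by linarith) _) rfl
    refine ⟨h0, ?_⟩
    have h2 : Φ z₀ = 0 := by
      change (σ⁻¹ • a' (z₀ - z₀), σ⁻¹ • b' (T z₀ - z₀)) = 0
      rw [h1, sub_self, map_zero, map_zero, smul_zero, smul_zero, Prod.mk_zero_zero]
    change Φ z₀ ∈ ball 0 1 ×ˢ ball 0 1
    rw [h2]
    exact ⟨mem_ball_self one_pos, mem_ball_self one_pos⟩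
  · exact fun u u' huu' => a.injective (smul_right_injective _ hσ0.ne' huu')
  · intro u
    change A (σ • a u) = σ • a u
    rw [map_smul, ha]
  · intro w
    refine ⟨σ⁻¹ • a' w, ?_⟩
    change σ • a (σ⁻¹ • a' w) = A w
    rw [map_smul, smul_inv_smul₀ hσ0.ne', ha']
  · have h1 := htrans (hTclose w hw.1) (hsymm (hT2 w hw w' hw' hww' ▸ hTclose w' hw'.1))
    exact h1.mono (by linarith)
  · have h1 := hΓ.tangent _ (hTD w hw.1)
    have h2 := hΓ.tangent _ (hTD w' hw'.1)
    rw [← hT] at h1 h2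
    rw [hT2 w hw w' hw' hww'] at h1
    exact (tangentSetoid (E 1)).trans h1 ((tangentSetoid (E 1)).symm h2)
  · have h1 : T w = T w' := hTeq w hw.1 _ (hTmem w' hw'.1).2
      ((htrans hc (hTclose w' hw'.1)).mono (by linarith)) (hTA w' hw'.1)
    change σ⁻¹ • b' (T w - z₀) = σ⁻¹ • b' (T w' - z₀)
    rw [h1]
  · obtain ⟨u₀, v₀⟩ := z
    change (u₀, v₀) ∈ ball (0 : EuclideanSpace ℝ (Fin k)) 1 ×ˢ
      ball (0 : EuclideanSpace ℝ (Fin m)) 1 at hz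
    change HasFDerivAt (fun u => Ψ (u, v₀)) ((chartLift pr 1 p
      ((extChartAt (𝓡 n) p).symm (Ψ (u₀, v₀)))) ∘L (σ • a.toContinuousLinearMap)) u₀
    set w₀ := Ψ (u₀, v₀) with hw₀
    have hw₀R : w₀ ∈ ball z₀ R :=
      ball_subset_ball (by linarith [mul_pos hN0 hρ]) (hΨball _ hz)
    have hnear : ∀ᶠ u in 𝓝 u₀, u ∈ ball (0 : EuclideanSpace ℝ (Fin k)) 1 :=
      isOpen_ball.mem_nhds hz.1
    have ht : Tendsto (fun u => K * ‖σ • a (u - u₀)‖) (𝓝 u₀) (𝓝 0) := by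
      have : Continuous fun u => K * ‖σ • a (u - u₀)‖ := by
        have := a.continuous
        fun_prop
      have h0 := this.tendsto u₀
      rwa [sub_self, map_zero, smul_zero, norm_zero, mul_zero] at h0
    have hD : ∀ᶠ u in 𝓝 u₀, (w₀, σ • a (u - u₀)) ∈ D := by
      have h1 : 0 < R - ‖w₀ - z₀‖ := by rw [mem_ball_iff_norm] at hw₀R; linarith
      have ht' := ht.const_mul K
      rw [mul_zero] at ht'
      filter_upwards [ht.eventually (gt_mem_nhds h1), ht'.eventually (gt_mem_nhds hδ)] with u h2 h3
      exact (hΓ.mem_iff _).2 ⟨by simp only [map_smul, ← hA, ha], by simp only; linarith, h3⟩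
    -- Sliding from the transversal to `u` agrees with sliding first to `u₀` and then by the
    -- remainder, again by uniqueness. Differentiating at `u₀` thus reduces to the first-order
    -- clause of `IsSlide` at zero displacement.
    have heq : ∀ᶠ u in 𝓝 u₀, Ψ (u, v₀) = Γ (w₀, σ • a (u - u₀)) := by
      filter_upwards [hnear, hD] with u hu huD
      have hq : (u, v₀) ∈ ball (0 : EuclideanSpace ℝ (Fin k)) 1 ×ˢ
        ball (0 : EuclideanSpace ℝ (Fin m)) 1 := ⟨hu, hz.2⟩
      have h1 := hΓ.mem_closedBall hK (hΨD _ hq)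
      rw [← hΨ] at h1
      refine hB.eq_of_close (y v₀) (hymem _ hz.2) _ h1.2 _ (hΓ.mem_closedBall hK huD).2 ((hΨclose _ hq).mono (by linarith))
        ((htrans (hΨclose _ hz) (hΓ.close _ huD)).mono (by linarith)) ?_
      change A (Ψ (u, v₀)) = _
      rw [hΓ.proj_eq _ huD, hΨA _ hq]
      change _ = A w₀ + _
      rw [hw₀, hΨA _ hz, map_sub, smul_sub]
      simp only
      abel
    have hval : Γ (w₀, σ • a (u₀ - u₀)) = w₀ := (heq.self_of_nhds).symm
    refine HasFDerivAt.of_isLittleO (Asymptotics.isLittleO_iff.2 fun ε hε => ?_)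
    have hSc : ∀ᶠ z in 𝓝 w₀, ‖chartLift pr 1 p ((extChartAt (𝓡 n) p).symm z) -
        chartLift pr 1 p ((extChartAt (𝓡 n) p).symm w₀)‖ ≤ ε / σ := by
      have h1 := hB.continuousOn.continuousAt (mem_of_superset (isOpen_ball.mem_nhds hw₀R)
        ball_subset_closedBall)
      have h2 := h1.eventually (ball_mem_nhds _ (div_pos hε hσ0))
      exact h2.mono fun z hz => (mem_ball_iff_norm.1 hz).le
    obtain ⟨η, hη, Hη⟩ := Metric.eventually_nhds_iff.1 hSc
    filter_upwards [heq, hD, ht.eventually (gt_mem_nhds hη)] with u h1 h2 h3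
    have h4 := hΓ.approx _ h2 (ε / σ) fun z hz => Hη (by
      rw [dist_eq_norm]; exact hz.trans_lt h3)
    rw [h1]
    change ‖Γ (w₀, σ • a (u - u₀)) - w₀ - _‖ ≤ _
    refine h4.trans_eq ?_
    simp only
    rw [norm_smul, a.norm_map, Real.norm_of_nonneg hσ0.le]
    field_simp

end chartbox

/-! ### Flow boxes for the partition into tangent chains. -/

section flowbox
open Filter Metric
variable {n : ℕ} {M : Type*} [TopologicalSpace M] [ChartedSpace (EuclideanSpace ℝ (Fin n)) M]
  [IsManifold (𝓡 n) ∞ M] [RiemannianBundle (fun x : M => TangentSpace (𝓡 n) x)]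
  [IsContinuousRiemannianBundle (EuclideanSpace ℝ (Fin n)) (fun x : M => TangentSpace (𝓡 n) x)]
  {V : Type*} [NormedAddCommGroup V] [InnerProductSpace ℝ V] [FiniteDimensional ℝ V]
  {E : Fin 3 → (x : M) → Submodule ℝ (TangentSpace (𝓡 n) x)}
  {pr : Fin 3 → (x : M) → TangentSpace (𝓡 n) x →L[ℝ] TangentSpace (𝓡 n) x}
  {e : M → V} {L : (x : M) → V →ₗ[ℝ] TangentSpace (𝓡 n) x} {C : ℝ} {F : Equiv.Perm M}
  {r κ C' : ℝ} {p : M} {R K β : ℝ} {k m : ℕ}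

theorem eqvGen_of_tangentSetoid {E : (x : M) → Submodule ℝ (TangentSpace (𝓡 n) x)} {δ : ℝ}
    (hδ : 0 < δ) {S : M → M → Prop} (hS : ∀ x y, TangentJoined E δ x y → S x y) {x y : M}
    (h : (tangentSetoid E).r x y) : Relation.EqvGen S x y := by
  change Relation.EqvGen _ x y at h
  induction h with
  | rel x y h => obtain ⟨γ, hγ, rfl, rfl⟩ := h; exact hγ.eqvGen hδ hS
  | refl x => exact .refl x
  | symm x y _ ih => exact .symm _ _ ih
  | trans x y z _ _ ih ih' => exact .trans _ _ _ ih ih'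

theorem exists_countable_dense_of_embedding (e : M → V) (A : Set M) :
    ∃ t ⊆ A, t.Countable ∧ ∀ x ∈ A, ∀ δ > 0, ∃ y ∈ t, ‖e x - e y‖ ≤ δ := by
  obtain ⟨t, htA, htc, htd⟩ := (TopologicalSpace.IsSeparable.of_separableSpace
    (e '' A)).exists_countable_dense_subset
  obtain ⟨t', ht'A, rfl⟩ := subset_image_iff.1 htA
  obtain ⟨t'', ht''1, ht''2⟩ : ∃ t'' ⊆ t', t''.Countable ∧ e '' t'' = e '' t' := by
    obtain ⟨t'', h1, h2⟩ := (surjOn_image e t').exists_bijOn_subset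
    exact ⟨t'', h1, Set.countable_of_injective_of_countable_image h2.injOn (h2.image_eq ▸ htc), h2.image_eq⟩
  refine ⟨t'', ht''1.trans ht'A, ht''2.1, fun x hx δ hδ => ?_⟩
  obtain ⟨b, hb, hlt⟩ := Metric.mem_closure_iff.1 (htd (mem_image_of_mem e hx)) δ hδ
  rw [← ht''2.2] at hb
  obtain ⟨y, hy, rfl⟩ := hb
  exact ⟨y, hy, (dist_eq_norm (e x) (e y) ▸ hlt).le⟩

/-- Short tangent curves have orbit-close endpoints, so a leaf lies in one chain class of
orbit-close points. -/
theorem IsCentralSystem.exists_countable (h : IsCentralSystem E pr e L C F r κ C') {β : ℝ}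
    (hβ : 0 < β) (hβr : 4 * β ≤ r) (q : M) : ∃ D : Set M, D.Countable ∧
      ∀ z ∈ leaf (tangentSetoid (E 1)) q, ∃ d ∈ D,
        OrbitClose F (fun x y => ‖e y - e x‖) β d z := by
  obtain ⟨D, hD, H⟩ := h.plaque.exists_countable h.cone (exists_countable_dense_of_embedding e)
    hβ hβr q
  obtain ⟨δ, hδ, Hδ⟩ := h.plaque.stable β hβ
  exact ⟨D, hD, fun z hz => H z (.symm _ _ (eqvGen_of_tangentSetoid hδ Hδ hz))⟩

/-- The map straightening the plaques near `p`. -/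
noncomputable def chartBoxMap (p : M) (φ : OpenPartialHomeomorph (EuclideanSpace ℝ (Fin n))
      (EuclideanSpace ℝ (Fin k) × EuclideanSpace ℝ (Fin m))) :
    OpenPartialHomeomorph M (EuclideanSpace ℝ (Fin k) × EuclideanSpace ℝ (Fin m)) :=
  (chartAt (EuclideanSpace ℝ (Fin n)) p).trans φ

variable {φ : OpenPartialHomeomorph (EuclideanSpace ℝ (Fin n))
      (EuclideanSpace ℝ (Fin k) × EuclideanSpace ℝ (Fin m))}
  {a : EuclideanSpace ℝ (Fin k) →L[ℝ] EuclideanSpace ℝ (Fin n)}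

theorem chartBoxMap_apply (x : M) : chartBoxMap p φ x = φ (extChartAt (𝓡 n) p x) := rfl

theorem chartBoxMap_symm_apply (z : EuclideanSpace ℝ (Fin k) × EuclideanSpace ℝ (Fin m)) :
    (chartBoxMap p φ).symm z = (extChartAt (𝓡 n) p).symm (φ.symm z) := rfl

theorem mem_chartBoxMap_source {x : M} : x ∈ (chartBoxMap p φ).source ↔
    x ∈ (extChartAt (𝓡 n) p).source ∧ extChartAt (𝓡 n) p x ∈ φ.source := by
  rw [extChartAt_source]; exact Iff.rfl

namespace IsChartBox

theorem chartBoxMap_target (hφ : IsChartBox E pr e F r p R β φ a)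
    (hB : IsPlaqueBall E pr e F r p R K) : (chartBoxMap p φ).target = ball 0 1 ×ˢ ball 0 1 := by
  rw [← hφ.target_eq]
  refine inter_eq_left.2 fun z hz => ?_
  have := hB.subset (hφ.source_subset (φ.map_target hz))
  simpa [extChartAt_target] using this

theorem hasMFDerivAt (hφ : IsChartBox E pr e F r p R β φ a)
    (hB : IsPlaqueBall E pr e F r p R K)
    {z : EuclideanSpace ℝ (Fin k) × EuclideanSpace ℝ (Fin m)} (hz : z ∈ φ.target) :
    HasMFDerivAt (𝓡 k) (𝓡 n) (fun u => (chartBoxMap p φ).symm (u, z.2)) z.1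
      ((chartFrom p ((chartBoxMap p φ).symm z)) ∘L
        ((chartLift pr 1 p ((chartBoxMap p φ).symm z)) ∘L a)) :=
  HasMFDerivAt.comp (f := fun u => φ.symm (u, z.2)) (g := (extChartAt (𝓡 n) p).symm) z.1
    (hasMFDerivAt_chart_symm (hB.subset (hφ.source_subset (φ.map_target hz))))
    (hφ.hasFDerivAt z hz).hasMFDerivAt

theorem contMDiffOn (hφ : IsChartBox E pr e F r p R β φ a)
    (hB : IsPlaqueBall E pr e F r p R K) {v : EuclideanSpace ℝ (Fin m)} (hv : v ∈ ball 0 1) :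
    ContMDiffOn (𝓡 k) (𝓡 n) 1 (fun u => (chartBoxMap p φ).symm (u, v)) (ball 0 1) := by
  have hmem : ∀ u ∈ ball (0 : EuclideanSpace ℝ (Fin k)) 1, (u, v) ∈ φ.target := fun u hu => by
    rw [hφ.target_eq]; exact ⟨hu, hv⟩
  have hcl : ∀ u ∈ ball (0 : EuclideanSpace ℝ (Fin k)) 1,
      φ.symm (u, v) ∈ closedBall (extChartAt (𝓡 n) p p) R :=
    fun u hu => hφ.source_subset (φ.map_target (hmem u hu))
  have hc : ContinuousOn (fun u => φ.symm (u, v)) (ball 0 1) :=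
    φ.continuousOn_symm.comp (by fun_prop) hmem
  have h1 : ContDiffOn ℝ 1 (fun u => φ.symm (u, v)) (ball 0 1) := by
    rw [show (1 : WithTop ℕ∞) = 0 + 1 from (zero_add 1).symm,
      contDiffOn_succ_iff_fderiv_of_isOpen isOpen_ball]
    refine ⟨fun u hu => (hφ.hasFDerivAt _ (hmem u hu)).differentiableAt.differentiableWithinAt,
      by simp, ?_⟩
    rw [contDiffOn_zero]
    refine ContinuousOn.congr (f := fun u => (chartLift pr 1 p ((extChartAt (𝓡 n) p).symm
      (φ.symm (u, v)))) ∘L a) ?_ fun u hu => (hφ.hasFDerivAt _ (hmem u hu)).fderiv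
    exact (hB.continuousOn.comp hc hcl).clm_comp continuousOn_const
  exact (contMDiffOn_extChartAt_symm (n := 1) p).comp h1.contMDiffOn
    fun u hu => hB.subset (hcl u hu)

/-- For the plaque condition, the transverse coordinate along a path in a leaf takes countably many
values, hence is constant. The tangent space is `E 1` because `chartLift` is a bijection between
central vectors at `p` and those at the nearby point. -/
theorem isFlowBox (h : IsCentralSystem E pr e L C F r κ C')
    (hφ : IsChartBox E pr e F r p R β φ a) (hB : IsPlaqueBall E pr e F r p R K)
    (hβr : 2 * β ≤ r) : IsFlowBox (E 1) (tangentSetoid (E 1)) (chartBoxMap p φ) := by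
  have htar := hφ.chartBoxMap_target hB
  have hmem : ∀ z ∈ (chartBoxMap p φ).target, z ∈ φ.target := fun z hz => by
    rw [hφ.target_eq, ← htar]; exact hz
  have hcl : ∀ z ∈ (chartBoxMap p φ).target,
      φ.symm z ∈ closedBall (extChartAt (𝓡 n) p p) R :=
    fun z hz => hφ.source_subset (φ.map_target (hmem z hz))
  have hr := h.cone.r_pos
  refine ⟨htar, fun q hq q' hq' => ⟨fun hJ => ?_, fun heq => ?_⟩,
    fun v hv => hφ.contMDiffOn hB hv, fun z hz => ?_, fun z hz => ?_, fun v => ?_⟩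
  · obtain ⟨g, hg⟩ := hJ
    obtain ⟨D, hD, H⟩ := h.exists_countable (β := r / 4) (by linarith) (by linarith) q
    have hgc : Continuous fun t => (chartBoxMap p φ (g t)).2 :=
      continuous_snd.comp ((chartBoxMap p φ).continuousOn.comp_continuous g.continuous
        fun t => (hg t).2)
    have hsub : range (fun t => (chartBoxMap p φ (g t)).2) ⊆ ⋃ d ∈ D, {b | ∃ z ∈
        (chartBoxMap p φ).source, OrbitClose F (fun x y => ‖e y - e x‖) (r / 4) d z ∧
        (chartBoxMap p φ z).2 = b} := by
      rintro _ ⟨t, rfl⟩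
      obtain ⟨d, hd, hdz⟩ := H (g t) (hg t).1
      exact mem_iUnion₂.2 ⟨d, hd, g t, (hg t).2, hdz, rfl⟩
    -- Two points of the box shadowing the same `d` shadow each other, hence have equal transverse
    -- coordinates: each `d` accounts for at most one plaque.
    have hcount := (hD.biUnion (t := fun d _ => {b | ∃ z ∈ (chartBoxMap p φ).source,
        OrbitClose F (fun x y => ‖e y - e x‖) (r / 4) d z ∧ (chartBoxMap p φ z).2 = b})
        fun d hd => by
      refine Set.Subsingleton.countable ?_
      rintro _ ⟨z, hz, hdz, rfl⟩ _ ⟨z', hz', hdz', rfl⟩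
      rw [mem_chartBoxMap_source] at hz hz'
      refine hφ.eq_of_close (extChartAt (𝓡 n) p z) hz.2 (extChartAt (𝓡 n) p z') hz'.2 ?_
      rw [ChartClose, (extChartAt (𝓡 n) p).left_inv hz.1, (extChartAt (𝓡 n) p).left_inv hz'.1]
      exact (h.cone.orbitClose_trans (h.cone.orbitClose_symm hdz) hdz').mono (by linarith)).mono
      hsub
    have := hcount.isTotallyDisconnected _ subset_rfl (isPreconnected_range hgc)
      (mem_range_self 0) (mem_range_self 1)
    simpa only [g.source, g.target] using this
  · set u := (chartBoxMap p φ q).1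
    set u' := (chartBoxMap p φ q').1
    set b := (chartBoxMap p φ q).2 with hb
    have hqt := (chartBoxMap p φ).map_source hq
    have hqt' := (chartBoxMap p φ).map_source hq'
    have hseg : ∀ t ∈ Icc (0 : ℝ) 1, (u + t • (u' - u), b) ∈ (chartBoxMap p φ).target := by
      rw [htar] at hqt hqt' ⊢
      exact fun t ht => ⟨(convex_ball 0 1).add_smul_sub_mem hqt.1 hqt'.1 ht, hqt.2⟩
    refine JoinedIn.ofLine (f := fun t : ℝ => (chartBoxMap p φ).symm (u + t • (u' - u), b))
      ((chartBoxMap p φ).continuousOn_symm.comp (by fun_prop) hseg) ?_ ?_ ?_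
    · simp only [zero_smul, add_zero]
      exact (chartBoxMap p φ).left_inv hq
    · simp only [one_smul, add_sub_cancel]
      rw [heq]
      exact (chartBoxMap p φ).left_inv hq'
    · rintro _ ⟨t, ht, rfl⟩
      have h1 := (chartBoxMap p φ).map_target (hseg t ht)
      refine ⟨?_, h1⟩
      have h2 := (chartBoxMap p φ).right_inv (hseg t ht)
      have h1' := mem_chartBoxMap_source.1 h1
      have hq1 := mem_chartBoxMap_source.1 hq
      have h3 := hφ.tangent _ h1'.2 _ hq1.2 (by
        rw [← chartBoxMap_apply, ← chartBoxMap_apply, h2])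
      rwa [(extChartAt (𝓡 n) p).left_inv h1'.1, (extChartAt (𝓡 n) p).left_inv hq1.1] at h3
  · rw [(hφ.hasMFDerivAt hB (hmem z hz)).mfderiv]
    intro w w' hww'
    have hx := (mem_chartBoxMap_source.1 ((chartBoxMap p φ).map_target hz)).1
    have h1 : chartLift pr 1 p ((chartBoxMap p φ).symm z) (a w) =
        chartLift pr 1 p ((chartBoxMap p φ).symm z) (a w') := by
      rw [← chartTo_chartFrom hx (chartLift pr 1 p ((chartBoxMap p φ).symm z) (a w)),
        ← chartTo_chartFrom hx (chartLift pr 1 p ((chartBoxMap p φ).symm z) (a w'))]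
      exact congrArg (chartTo p _) hww'
    -- The central projection at `p` is a left inverse of the lift.
    have h2 := congrArg (chartProj pr 1 p p) h1
    rw [chartBoxMap_symm_apply, hB.proj_lift _ (hcl z hz) _ (hφ.proj_apply w),
      hB.proj_lift _ (hcl z hz) _ (hφ.proj_apply w')] at h2
    exact hφ.injective h2
  · obtain ⟨u₀, v₀⟩ := z
    rw [(hφ.hasMFDerivAt hB (hmem _ hz)).mfderiv]
    have hx := (mem_chartBoxMap_source.1 ((chartBoxMap p φ).map_target hz)).1
    refine le_antisymm ?_ fun v hv => ?_
    · rintro _ ⟨w, rfl⟩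
      exact hB.lift_mem _ (hcl _ hz) (a w)
    · obtain ⟨w, hw⟩ := hφ.exists_apply (chartTo p _ v)
      refine ⟨w, ?_⟩
      have h1 := chartFrom_chartTo hx v
      have h2 := hB.lift_proj _ (hcl _ hz) (chartTo p _ v) (h1.symm ▸ hv)
      exact (congrArg (chartFrom p _) ((congrArg (chartLift pr 1 p _) hw).trans h2)).trans h1
  · have h1 : ContinuousOn (fun z => ((chartBoxMap p φ).symm z,
        chartLift pr 1 p ((chartBoxMap p φ).symm z) (a v))) (chartBoxMap p φ).target := by
      refine (chartBoxMap p φ).continuousOn_symm.prodMk (ContinuousOn.clm_apply ?_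
        continuousOn_const)
      exact hB.continuousOn.comp (φ.continuousOn_symm.mono hmem) hcl
    refine ((continuousOn_chartFrom p).comp h1 fun z hz => ⟨(mem_chartBoxMap_source.1
      ((chartBoxMap p φ).map_target hz)).1, trivial⟩).congr fun z hz => ?_
    rw [(hφ.hasMFDerivAt hB (hmem z hz)).mfderiv]
    rfl

end IsChartBox

/-- Flow boxes with orbit-close plaques. -/
theorem IsCentralSystem.exists_isFlowBox [CompactSpace M]
    (h : IsCentralSystem E pr e L C F r κ C') {β : ℝ} (hβ : 0 < β) (p : M) :
    ∃ (k m : ℕ)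
    (χ : OpenPartialHomeomorph M (EuclideanSpace ℝ (Fin k) × EuclideanSpace ℝ (Fin m))),
    p ∈ χ.source ∧ IsFlowBox (E 1) (tangentSetoid (E 1)) χ ∧
    ∀ x ∈ χ.source, ∀ x' ∈ χ.source, (χ x).2 = (χ x').2 →
      OrbitClose F (fun x y => ‖e y - e x‖) β x x' := by
  have hr := h.cone.r_pos
  obtain ⟨R, K, hB, -⟩ := h.exists_isPlaqueBall (p := p) univ_mem
  obtain ⟨k, m, φ, a, hφ⟩ := hB.exists_isChartBox h (β := min (r / 2) (β / 2))
    (lt_min (half_pos hr) (half_pos hβ)) (by linarith [min_le_left (r / 2) (β / 2)])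
  refine ⟨k, m, chartBoxMap p φ, mem_chartBoxMap_source.2 ⟨mem_extChartAt_source p,
    hφ.mem_source⟩, hφ.isFlowBox h hB (by linarith [min_le_left (r / 2) (β / 2)]),
    fun x hx x' hx' hxx' => ?_⟩
  rw [mem_chartBoxMap_source] at hx hx'
  have h1 := hφ.close _ hx.2 _ hx'.2 hxx'
  rw [ChartClose, (extChartAt (𝓡 n) p).left_inv hx.1, (extChartAt (𝓡 n) p).left_inv hx'.1] at h1
  exact h1.mono (by linarith [min_le_right (r / 2) (β / 2)])

theorem IsCentralSystem.isLaminationTangentTo [CompactSpace M]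
    (h : IsCentralSystem E pr e L C F r κ C') :
    IsLaminationTangentTo (E 1) (tangentSetoid (E 1)) :=
  ⟨fun x => isPathConnected_leaf_tangentSetoid x, fun p => by
    obtain ⟨k, m, χ, h1, h2, -⟩ := h.exists_isFlowBox one_pos p
    exact ⟨k, m, χ, h1, h2⟩⟩

end flowbox

/-! ### Uniqueness of the lamination. -/

section uniqueness
open Filter Metric

/-- The equivalence classes induced on `[0, 1]` are relatively open, and the interval is connected.
-/
theorem Setoid.rel_of_eventually {M : Type*} (W : Setoid M) {γ : ℝ → M}
    (h : ∀ t ∈ Icc (0 : ℝ) 1, ∀ᶠ s in 𝓝[Icc 0 1] t, W.r (γ t) (γ s)) : W.r (γ 0) (γ 1) :=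
  isPreconnected_Icc.induction₂ (fun s t => W.r (γ s) (γ t)) h (fun _ _ _ _ _ _ h1 h2 => W.trans h1 h2)
    (fun _ _ _ _ h1 => W.symm h1) (left_mem_Icc.2 zero_le_one) (right_mem_Icc.2 zero_le_one)

theorem eventually_joinedIn {M : Type*} [TopologicalSpace M] {γ : ℝ → M}
    (hγ : ContinuousOn γ (Icc 0 1)) {A U : Set M} (hA : ∀ t ∈ Icc (0 : ℝ) 1, γ t ∈ A) {t₀ : ℝ}
    (ht₀ : t₀ ∈ Icc (0 : ℝ) 1) (hU : U ∈ 𝓝 (γ t₀)) :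
    ∀ᶠ t in 𝓝[Icc 0 1] t₀, JoinedIn (A ∩ U) (γ t₀) (γ t) := by
  obtain ⟨δ, hδ, H⟩ := Metric.mem_nhdsWithin_iff.1 (hγ t₀ ht₀ hU)
  filter_upwards [inter_mem_nhdsWithin _ (ball_mem_nhds t₀ hδ)] with t ht
  have hc : Convex ℝ (ball t₀ δ ∩ Icc 0 1) := (convex_ball _ _).inter (convex_Icc _ _)
  have hmem : ∀ s ∈ Icc (0 : ℝ) 1, t₀ + s • (t - t₀) ∈ ball t₀ δ ∩ Icc 0 1 := fun s hs =>
    hc.add_smul_sub_mem ⟨mem_ball_self hδ, ht₀⟩ ⟨ht.2, ht.1⟩ hs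
  refine JoinedIn.ofLine (f := fun s : ℝ => γ (t₀ + s • (t - t₀)))
    (hγ.comp (by fun_prop) fun s hs => (hmem s hs).2) (by simp) (by simp) ?_
  rintro _ ⟨s, hs, rfl⟩
  exact ⟨hA _ (hmem s hs).2, H (hmem s hs)⟩

variable {n : ℕ} {M : Type*} [TopologicalSpace M] [ChartedSpace (EuclideanSpace ℝ (Fin n)) M]
  [IsManifold (𝓡 n) ∞ M] [RiemannianBundle (fun x : M => TangentSpace (𝓡 n) x)]
  {V : Type*} [NormedAddCommGroup V] [InnerProductSpace ℝ V] [FiniteDimensional ℝ V]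
  {E : Fin 3 → (x : M) → Submodule ℝ (TangentSpace (𝓡 n) x)}
  {pr : Fin 3 → (x : M) → TangentSpace (𝓡 n) x →L[ℝ] TangentSpace (𝓡 n) x}
  {e : M → V} {L : (x : M) → V →ₗ[ℝ] TangentSpace (𝓡 n) x} {C : ℝ} {F : Equiv.Perm M}
  {r κ C' : ℝ} {k m : ℕ} {W : Setoid M}
  {ψ : OpenPartialHomeomorph M (EuclideanSpace ℝ (Fin k) × EuclideanSpace ℝ (Fin m))}

theorem IsFlowBox.mfderivWithin_mem {E : (x : M) → Submodule ℝ (TangentSpace (𝓡 n) x)}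
    (hψ : IsFlowBox E W ψ) {A : Set (EuclideanSpace ℝ (Fin k))} (hA : IsOpen A) (hA' : A ⊆ ball 0 1)
    {y : EuclideanSpace ℝ (Fin m)} (hy : y ∈ ball 0 1) {u : EuclideanSpace ℝ (Fin k)} (hu : u ∈ A)
    (v : EuclideanSpace ℝ (Fin k)) :
    mfderivWithin (𝓡 k) (𝓡 n) (fun u => ψ.symm (u, y)) A u v ∈ E (ψ.symm (u, y)) := by
  have h1 := hψ.tangent (u, y) (hψ.target_eq ▸ ⟨hA' hu, hy⟩)
  rw [mfderivWithin_of_isOpen hA hu, ← h1]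
  exact LinearMap.mem_range_self _ v

variable [IsContinuousRiemannianBundle (EuclideanSpace ℝ (Fin n))
  (fun x : M => TangentSpace (𝓡 n) x)]

theorem IsFlowBox.tangentSetoid {E : (x : M) → Submodule ℝ (TangentSpace (𝓡 n) x)}
    (hψ : IsFlowBox E W ψ) {q q' : M} (hq : q ∈ ψ.source) (hq' : q' ∈ ψ.source)
    (h : (ψ q).2 = (ψ q').2) : (tangentSetoid E).r q q' := by
  have h1 := ψ.map_source hq
  have h2 := ψ.map_source hq'
  rw [hψ.target_eq] at h1 h2
  have h3 := (isTangentCurve_segment (convex_ball 0 1) (hψ.contMDiffOn _ h1.2)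
    (fun u hu v => hψ.mfderivWithin_mem isOpen_ball subset_rfl h1.2 hu v) h1.1 h2.1).1.tangentSetoid
    (left_mem_Icc.2 zero_le_one) (right_mem_Icc.2 zero_le_one)
  simp only [zero_smul, add_zero, one_smul, add_sub_cancel] at h3
  rwa [show ((ψ q').1, (ψ q).2) = ψ q' from Prod.ext rfl h, Prod.mk.eta, ψ.left_inv hq,
    ψ.left_inv hq'] at h3

/-- A path in a leaf is only continuous, but locally it stays in one plaque, where segments of the
flow box provide tangent curves. -/
theorem IsLaminationTangentTo.tangentSetoid {E : (x : M) → Submodule ℝ (TangentSpace (𝓡 n) x)}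
    (hW : IsLaminationTangentTo E W) {x y : M} (hxy : W.r x y) : (tangentSetoid E).r x y := by
  obtain ⟨g, hg⟩ := (hW.1 y).joinedIn x hxy y (mem_leaf_self W y)
  have key := (_root_.tangentSetoid E).rel_of_eventually (γ := g.extend) fun t ht => by
    obtain ⟨k, m, φ, hp, hφ⟩ := hW.2 (g.extend t)
    have hgl : ∀ t, g.extend t ∈ leaf W (g.extend 0) := fun t => by
      obtain ⟨s, hs⟩ : g.extend t ∈ range g := g.extend_range ▸ mem_range_self t
      rw [← hs, g.extend_zero, leaf_eq hxy]
      exact hg s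
    filter_upwards [eventually_joinedIn g.continuous_extend.continuousOn (A := leaf W (g.extend t))
      (U := φ.source) (fun s _ => by
        rw [leaf_eq (hgl t)]; exact hgl s) ht (φ.open_source.mem_nhds hp)] with s hs
    exact hφ.tangentSetoid hp hs.target_mem.2 ((hφ.plaque _ hp _ hs.target_mem.2).1 hs)
  rwa [g.extend_zero, g.extend_one] at key

theorem IsFlowBox.eventually_orbitClose (h : IsCentralSystem E pr e L C F r κ C')
    (hψ : IsFlowBox (E 1) W ψ) {p : M} (hp : p ∈ ψ.source) :
    ∀ᶠ u in 𝓝 (ψ p).1, OrbitClose F (fun x y => ‖e y - e x‖) r p (ψ.symm (u, (ψ p).2)) := by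
  obtain ⟨δ, hδ, Hδ⟩ := h.plaque.stable r h.cone.r_pos
  have h1 := ψ.map_source hp
  rw [hψ.target_eq] at h1
  have hg := hψ.contMDiffOn _ h1.2
  have hb : ball 0 1 ∈ 𝓝 (ψ p).1 := isOpen_ball.mem_nhds h1.1
  obtain ⟨B, hB, HB⟩ := eventually_norm_mfderivWithin_le isOpen_ball.uniqueDiffOn hg h1.1
  rw [isOpen_ball.nhdsWithin_eq h1.1] at HB
  obtain ⟨ε, hε, Hε⟩ := Metric.eventually_nhds_iff_ball.1 (HB.and hb)
  have hsub : ball (ψ p).1 ε ⊆ ball 0 1 := fun u hu => (Hε u hu).2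
  filter_upwards [ball_mem_nhds _ hε, ball_mem_nhds _ (div_pos hδ hB)] with u hu hu'
  obtain ⟨h2, h3⟩ := isTangentCurve_segment (convex_ball _ ε) (hg.mono hsub)
    (fun u hu v => hψ.mfderivWithin_mem isOpen_ball hsub h1.2 hu v) (mem_ball_self hε) hu
  refine Hδ _ _ ⟨_, h2, ?_, ?_, (h3 B fun u hu v => ?_).trans_lt ?_⟩
  · simp only [zero_smul, add_zero, Prod.mk.eta]
    exact ψ.left_inv hp
  · simp only [one_smul, add_sub_cancel]
  · have := (Hε u hu).1 v
    rw [mfderivWithin_of_isOpen isOpen_ball (hsub hu)] at this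
    rwa [mfderivWithin_of_isOpen isOpen_ball hu]
  · rw [mem_ball_iff_norm, lt_div_iff₀ hB, mul_comm] at hu'
    exact (ENNReal.ofReal_lt_ofReal_iff hδ).2 hu'

/-- The plaque of `W` through `p` is tangent to `E 1`, so its central coordinates fill a
neighbourhood. A nearby point `z` shadowing `p` therefore shares its central coordinate with a
plaque point, which also shadows `p`; uniqueness makes them equal. -/
theorem IsFlowBox.eventually_rel [CompactSpace M] (h : IsCentralSystem E pr e L C F r κ C')
    (hψ : IsFlowBox (E 1) W ψ) {p : M} (hp : p ∈ ψ.source) :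
    ∀ᶠ z in 𝓝 p, OrbitClose F (fun x y => ‖e y - e x‖) r p z → W.r p z := by
  obtain ⟨R, K, hB, -⟩ := h.exists_isPlaqueBall (p := p) univ_mem
  have h1 := ψ.map_source hp
  have h1' := h1
  rw [hψ.target_eq] at h1
  set A := chartProj pr 1 p p with hA
  set ext := extChartAt (𝓡 n) p with hext
  have hsrc := mem_extChartAt_source (I := 𝓡 n) p
  have hAA : ∀ w, A (A w) = A w := fun w => h.proj.chartProj_chartProj hsrc w
  set S := LinearMap.range A.toLinearMap with hS
  let AS : EuclideanSpace ℝ (Fin n) →L[ℝ] S := A.codRestrict S fun w => LinearMap.mem_range_self _ w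
  set g : EuclideanSpace ℝ (Fin k) → M := fun u => ψ.symm (u, (ψ p).2) with hg
  set u₀ := (ψ p).1 with hu₀
  have hgp : g u₀ = p := ψ.left_inv hp
  have hgs : ContMDiffAt (𝓡 k) (𝓡 n) 1 g u₀ :=
    (hψ.contMDiffOn _ h1.2).contMDiffAt (isOpen_ball.mem_nhds h1.1)
  have hg1 : HasMFDerivAt (𝓡 k) (𝓡 n) g u₀ (mfderiv (𝓡 k) (𝓡 n) g u₀) :=
    (hgs.mdifferentiableAt one_ne_zero).hasMFDerivAt
  have hsrc' : g u₀ ∈ ext.source := by rw [hgp]; exact hsrc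
  have hd : HasFDerivAt (ext ∘ g) ((chartTo p (g u₀)) ∘L (mfderiv (𝓡 k) (𝓡 n) g u₀)) u₀ :=
    (HasMFDerivAt.comp u₀ (hasMFDerivAt_chart hsrc') hg1).hasFDerivAt
  have hext' : ContMDiffAt (𝓡 n) 𝓘(ℝ, EuclideanSpace ℝ (Fin n)) 1 ext (g u₀) := by
    refine contMDiffAt_extChartAt' ?_
    rwa [← extChartAt_source (𝓡 n)]
  have hcs : ContDiffAt ℝ 1 (ext ∘ g) u₀ := (hext'.comp u₀ hgs).contDiffAt
  have hstrict : HasStrictFDerivAt (AS ∘ ext ∘ g)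
      (AS ∘L ((chartTo p (g u₀)) ∘L (mfderiv (𝓡 k) (𝓡 n) g u₀))) u₀ :=
    AS.hasStrictFDerivAt.comp u₀ (hcs.hasStrictFDerivAt' hd one_ne_zero)
  -- Restricting the codomain to the range of `A` makes the derivative surjective, so the open
  -- mapping property for strictly differentiable maps applies.
  have hsurj : LinearMap.range (AS ∘L ((chartTo p (g u₀)) ∘L
      (mfderiv (𝓡 k) (𝓡 n) g u₀))).toLinearMap = ⊤ := by
    refine LinearMap.range_eq_top.2 ?_
    rintro ⟨_, w, rfl⟩
    have h2 : ∀ q, q = p → chartFrom p q (A w) ∈ E 1 q := by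
      rintro _ rfl; exact h.proj.chartFrom_chartProj_mem hsrc w
    have h3 := h2 (g u₀) hgp
    have h4 := hψ.tangent (ψ p) h1'
    change LinearMap.range (mfderiv (𝓡 k) (𝓡 n) g u₀).toLinearMap = E 1 (g u₀) at h4
    rw [← h4] at h3
    obtain ⟨v, hv⟩ := h3
    refine ⟨v, Subtype.ext ?_⟩
    change A (chartTo p (g u₀) (mfderiv (𝓡 k) (𝓡 n) g u₀ v)) = A w
    exact (congrArg A ((congrArg (chartTo p (g u₀)) hv).trans
      (chartTo_chartFrom hsrc' (A w)))).trans (hAA w)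
  have hmap := hstrict.map_nhds_eq_of_surj hsurj
  have hball : ∀ᶠ z in 𝓝 p, z ∈ ext.source ∧ ext z ∈ closedBall (ext p) R :=
    (show ∀ᶠ z in 𝓝 p, z ∈ ext.source from extChartAt_source_mem_nhds p).and ((continuousAt_extChartAt p).eventually
      (closedBall_mem_nhds _ hB.pos))
  have hgc : Tendsto g (𝓝 u₀) (𝓝 p) := hgp ▸ hgs.continuousAt
  have hN := (hψ.eventually_orbitClose h hp).and ((hgc.eventually hball).and
    (isOpen_ball.mem_nhds h1.1))
  have himg := image_mem_map (m := AS ∘ ext ∘ g) hN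
  rw [hmap] at himg
  have hcont : ContinuousAt (fun z => AS (ext z)) p :=
    AS.continuous.continuousAt.comp (continuousAt_extChartAt p)
  have himg' : ∀ᶠ z in 𝓝 p, AS (ext z) ∈ _ := hcont (by
    simp only [Function.comp_apply, hgp] at himg
    exact himg)
  filter_upwards [himg', hball] with z hz hzb hclose
  obtain ⟨u, ⟨hu1, hu2, hu3⟩, huz⟩ := hz
  have h5 : ext z = ext (g u) := by
    refine hB.eq_of_close (ext p) (mem_closedBall_self hB.pos.le) _ hzb.2 _ hu2.2 ?_ ?_
      (congrArg Subtype.val huz).symm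
    · rw [ChartClose, ext.left_inv hsrc, ext.left_inv hzb.1]; exact hclose
    · rw [ChartClose, ext.left_inv hsrc, ext.left_inv hu2.1]; exact hu1
  have h6 : z = g u := ext.injOn hzb.1 hu2.1 h5
  have h7 : (u, (ψ p).2) ∈ ψ.target := hψ.target_eq ▸ ⟨hu3, h1.2⟩
  have h8 : z ∈ ψ.source := h6 ▸ ψ.map_target h7
  have h9 : (ψ p).2 = (ψ z).2 := by rw [h6, hg, ψ.right_inv h7]
  exact W.symm (((hψ.plaque p hp z h8).2 h9).target_mem.1)

/-- Along a tangent curve nearby points are joined by short tangent arcs, hence are orbit-close and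
locally in the same leaf of `W`. -/
theorem IsCentralSystem.eq_tangentSetoid [CompactSpace M]
    (h : IsCentralSystem E pr e L C F r κ C') (hW : IsLaminationTangentTo (E 1) W) :
    W = tangentSetoid (E 1) := by
  refine Setoid.ext fun x y => ⟨hW.tangentSetoid, fun hxy => ?_⟩
  change Relation.EqvGen _ x y at hxy
  induction hxy with
  | refl x => exact W.refl x
  | symm x y _ ih => exact W.symm ih
  | trans x y z _ _ ih ih' => exact W.trans ih ih'
  | rel x y hxy =>
    obtain ⟨γ, hγ, rfl, rfl⟩ := hxy
    obtain ⟨δ, hδ, Hδ⟩ := h.plaque.stable r h.cone.r_pos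
    obtain ⟨B, hB, H⟩ := hγ.exists_tangentJoined
    refine W.rel_of_eventually fun t ht => ?_
    obtain ⟨k, m, ψ, hp, hψ⟩ := hW.2 (γ t)
    filter_upwards [(hγ.1.continuousOn t ht).eventually (hψ.eventually_rel h hp),
      inter_mem_nhdsWithin _ (ball_mem_nhds t (div_pos hδ hB))] with s hs hst
    refine hs (Hδ _ _ (H t ht s hst.1 δ ?_))
    have := hst.2
    rwa [mem_ball, Real.dist_eq, lt_div_iff₀ hB, mul_comm] at this

end uniqueness

/-! ### Plaque expansiveness and the Lyapunov stable case. -/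

section plaqueExpansive
open Filter Metric
variable {n : ℕ} {M : Type*} [EMetricSpace M] [CompactSpace M]
  [ChartedSpace (EuclideanSpace ℝ (Fin n)) M]
  [IsManifold (𝓡 n) ∞ M] [RiemannianBundle (fun x : M => TangentSpace (𝓡 n) x)]
  [IsContinuousRiemannianBundle (EuclideanSpace ℝ (Fin n)) (fun x : M => TangentSpace (𝓡 n) x)]
  [IsRiemannianManifold (𝓡 n) M]
  {V : Type*} [NormedAddCommGroup V] [InnerProductSpace ℝ V] [FiniteDimensional ℝ V]
  {E : Fin 3 → (x : M) → Submodule ℝ (TangentSpace (𝓡 n) x)}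
  {pr : Fin 3 → (x : M) → TangentSpace (𝓡 n) x →L[ℝ] TangentSpace (𝓡 n) x}
  {e : M → V} {L : (x : M) → V →ₗ[ℝ] TangentSpace (𝓡 n) x} {C : ℝ} {F : Equiv.Perm M}
  {r κ C' : ℝ}

/-- The curves defining `leafBall` lie in a leaf but are not assumed tangent to the bundle, so
Lyapunov stability does not apply directly. A curve shorter than a Lebesgue number stays in one flow
box, hence in one plaque, and plaques of these boxes are orbit-close. -/
theorem IsCentralSystem.orbitClose_of_mem_leafBall (h : IsCentralSystem E pr e L C F r κ C')
    {β : ℝ} (hβ : 0 < β) : ∃ ε : ℝ, 0 < ε ∧ ∀ x, ∀ y ∈ leafBall (n := n) (tangentSetoid (E 1)) x ε,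
      OrbitClose F (fun x y => ‖e y - e x‖) β x y := by
  choose k m χ hp hχ hclose using fun p => h.exists_isFlowBox hβ p
  obtain ⟨δ, hδ, H⟩ := lebesgue_number_lemma_of_emetric isCompact_univ
    (fun p => (χ p).open_source) fun p _ => mem_iUnion.2 ⟨p, hp p⟩
  obtain ⟨ε, hε, hlt⟩ := ENNReal.lt_iff_exists_real_btwn.1 hδ
  refine ⟨ε, ENNReal.ofReal_pos.1 hlt.1, ?_⟩
  rintro x y ⟨γ, hγ, rfl, rfl, hl, hlen⟩
  obtain ⟨p, hpsub⟩ := H (γ 0) (mem_univ _)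
  have hsrc : ∀ t ∈ Icc (0 : ℝ) 1, γ t ∈ (χ p).source := fun t ht => hpsub (by
    rw [mem_eball, edist_comm]
    exact (edist_le_pathELength hγ ht).trans_lt (hlen.trans hlt.2))
  have h0 := hsrc 0 (left_mem_Icc.2 zero_le_one)
  have h1 := hsrc 1 (right_mem_Icc.2 zero_le_one)
  refine hclose p _ h0 _ h1 (((hχ p).plaque _ h0 _ h1).1 (JoinedIn.ofLine hγ.continuousOn rfl rfl ?_))
  rintro _ ⟨t, ht, rfl⟩
  exact ⟨hl t ht, hsrc t ht⟩

theorem IsCentralSystem.plaqueExpansive (h : IsCentralSystem E pr e L C F r κ C') :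
    PlaqueExpansive (n := n) F (tangentSetoid (E 1)) := by
  intro η hη
  obtain ⟨ε₁, hε₁, H⟩ := h.plaque.expansive h.cone hη
  obtain ⟨ε₂, hε₂, H₂⟩ := h.orbitClose_of_mem_leafBall hε₁
  obtain ⟨ε₃, hε₃, H₃⟩ := exists_forall_edist_lt h.left_inv.contMDiff.continuous hε₁
  have hmono : ∀ x, leafBall (n := n) (tangentSetoid (E 1)) x (min ε₂ ε₃) ⊆
      leafBall (n := n) (tangentSetoid (E 1)) x ε₂ := by
    rintro x y ⟨γ, h1, h2, h3, h4, h5⟩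
    exact ⟨γ, h1, h2, h3, h4, h5.trans_le (ENNReal.ofReal_le_ofReal (min_le_left _ _))⟩
  refine ⟨min ε₂ ε₃, lt_min hε₂ hε₃, fun x y hx hy hxy => ?_⟩
  obtain ⟨γ, hγ, h0, h1, hl⟩ := H x y
    (fun m => h.cone.orbitClose_symm (H₂ _ _ (hmono _ (hx m))))
    (fun m => h.cone.orbitClose_symm (H₂ _ _ (hmono _ (hy m))))
    (fun m => H₃ _ _ ((hxy m).trans_le (ENNReal.ofReal_le_ofReal (min_le_right _ _))))
  exact ⟨γ, hγ.1, h0, h1, fun t ht => h0 ▸ hγ.tangentSetoid ht (left_mem_Icc.2 zero_le_one), hl⟩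

variable {f : M ≃ₘ^1⟮𝓡 n, 𝓡 n⟯ M} {Es Ec Eu : (x : M) → Submodule ℝ (TangentSpace (𝓡 n) x)}

theorem continuous_zpow_toEquiv (f : M ≃ₘ^1⟮𝓡 n, 𝓡 n⟯ M) (k : ℤ) :
    Continuous ⇑((f.toEquiv : Equiv.Perm M) ^ k) := by
  cases k with
  | ofNat k =>
    rw [Int.ofNat_eq_natCast, zpow_natCast, ← Equiv.Perm.iterate_eq_pow]
    exact f.continuous.iterate k
  | negSucc k =>
    rw [zpow_negSucc, ← inv_pow, ← Equiv.Perm.iterate_eq_pow]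
    exact f.symm.continuous.iterate (k + 1)

theorem IsPartiallyHyperbolic.uniqueLaminationPlaqueExpansive
    (hf : IsPartiallyHyperbolic f Es Ec Eu) (h1 : LyapunovStable f Ec)
    (h2 : LyapunovStable f.symm Ec) : UniqueLaminationPlaqueExpansive f Ec := by
  -- The embedding puts all differences of points in one vector space and gives a finite distance
  -- even between distinct components.
  obtain ⟨N, e, he, hemb, hinj⟩ := exists_embedding_euclidean_of_compact (M := M) (I := 𝓡 n)
  obtain ⟨L, C, hL⟩ := exists_isLeftInverseFamily (he.of_le (by exact_mod_cast le_top))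
    hemb.injective hinj
  obtain ⟨pr, hpr⟩ := hf.exists_isProjectionFamily
  obtain ⟨r, κ, C', hcone⟩ := hf.exists_coneSystem hL hpr
  have h : IsCentralSystem (hyperbolicSplitting Es Ec Eu) pr e L C f.toEquiv r κ C' :=
    ⟨hpr, hL, hcone, plaqueSystem_of_lyapunovStable h1 h2 hL hpr, continuous_zpow_toEquiv f⟩
  refine ⟨⟨tangentSetoid Ec, h.isLaminationTangentTo, fun W hW => h.eq_tangentSetoid hW⟩,
    fun W hW => ?_⟩
  rw [h.eq_tangentSetoid hW]
  exact h.plaqueExpansive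

end plaqueExpansive

/-! ### Bounded iterates imply Lyapunov stability. -/

section boundedIterates
variable {n : ℕ} {M : Type*} [TopologicalSpace M] [ChartedSpace (EuclideanSpace ℝ (Fin n)) M]
  [IsManifold (𝓡 n) ∞ M] [RiemannianBundle (fun x : M => TangentSpace (𝓡 n) x)]
  {E : (x : M) → Submodule ℝ (TangentSpace (𝓡 n) x)} {f : M → M}

theorem pathELength_comp_le {g : M → M} (hg : ContMDiff (𝓡 n) (𝓡 n) 1 g) {γ : ℝ → M}
    (hγ : IsTangentCurve E γ) {C : ℝ}
    (hC : ∀ x, ∀ v ∈ E x, ‖mfderiv (𝓡 n) (𝓡 n) g x v‖ ≤ C * ‖v‖) :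
    pathELength (𝓡 n) (g ∘ γ) 0 1 ≤ ENNReal.ofReal C * pathELength (𝓡 n) γ 0 1 := by
  rw [pathELength_eq_lintegral_mfderivWithin_Icc, pathELength_eq_lintegral_mfderivWithin_Icc,
    ← MeasureTheory.lintegral_const_mul' _ _ ENNReal.ofReal_ne_top]
  refine MeasureTheory.setLIntegral_mono' measurableSet_Icc fun t ht => ?_
  have h1 := ((hγ.1 t ht).mdifferentiableWithinAt one_ne_zero).hasMFDerivWithinAt
  have h2 := ((hg (γ t)).mdifferentiableAt one_ne_zero).hasMFDerivAt.comp_hasMFDerivWithinAt t h1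
  rw [h2.mfderivWithin
    ((uniqueMDiffWithinAt_iff_uniqueDiffWithinAt).2 (uniqueDiffOn_Icc zero_lt_one t ht))]
  have h3 := hC _ _ (hγ.2 t ht)
  rw [← ofReal_norm, ← ofReal_norm, ← ENNReal.ofReal_mul' (norm_nonneg _)]
  exact ENNReal.ofReal_le_ofReal h3

theorem lyapunovStable_of_norm_mfderiv_le (hf : ContMDiff (𝓡 n) (𝓡 n) 1 f) {C : ℝ} (hC : 0 < C)
    (h : ∀ (k : ℕ) (x : M), ∀ v ∈ E x, ‖mfderiv (𝓡 n) (𝓡 n) f^[k] x v‖ ≤ C * ‖v‖) :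
    LyapunovStable f E := by
  refine fun ε hε => ⟨ε / C, div_pos hε hC, fun γ hγ hγE hl k => ?_⟩
  refine (pathELength_comp_le (hf.iterate_self k) ⟨hγ, hγE⟩ (h k)).trans_lt ?_
  have h1 := ENNReal.mul_lt_mul_right (ENNReal.ofReal_pos.2 hC).ne' ENNReal.ofReal_ne_top hl
  rwa [← ENNReal.ofReal_mul hC.le, mul_div_cancel₀ _ hC.ne'] at h1

theorem norm_mfderiv_iterate_succ (hf : ContMDiff (𝓡 n) (𝓡 n) 1 f) (k : ℕ) (x : M)
    (v : TangentSpace (𝓡 n) x) : ‖mfderiv (𝓡 n) (𝓡 n) f^[k + 1] x v‖ =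
      ‖mfderiv (𝓡 n) (𝓡 n) f^[k] (f x) (mfderiv (𝓡 n) (𝓡 n) f x v)‖ := by
  exact congrArg (fun A : TangentSpace (𝓡 n) x →L[ℝ] TangentSpace (𝓡 n) (f^[k] (f x)) => ‖A v‖)
    (mfderiv_comp x ((hf.iterate_self k (f x)).mdifferentiableAt one_ne_zero)
      ((hf x).mdifferentiableAt one_ne_zero))

theorem mfderiv_iterate_mem (hf : ContMDiff (𝓡 n) (𝓡 n) 1 f)
    (hE : ∀ x, ∀ v ∈ E x, mfderiv (𝓡 n) (𝓡 n) f x v ∈ E (f x)) (k : ℕ) (x : M) :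
    ∀ v ∈ E x, mfderiv (𝓡 n) (𝓡 n) f^[k] x v ∈ E (f^[k] x) := by
  induction k generalizing x with
  | zero =>
    intro v hv
    rw [Function.iterate_zero, mfderiv_id]
    exact hv
  | succ k ih =>
    intro v hv
    have h1 := mfderiv_comp x ((hf.iterate_self k (f x)).mdifferentiableAt one_ne_zero)
      ((hf x).mdifferentiableAt one_ne_zero)
    have h2 := ih (f x) _ (hE x v hv)
    exact (congrArg (fun A : TangentSpace (𝓡 n) x →L[ℝ] TangentSpace (𝓡 n) (f^[k] (f x)) =>
      A v ∈ E (f^[k] (f x))) h1).mpr h2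

theorem IsIsometryAlong.hasBoundedIterates (hf : ContMDiff (𝓡 n) (𝓡 n) 1 f)
    (hE : ∀ x, ∀ v ∈ E x, mfderiv (𝓡 n) (𝓡 n) f x v ∈ E (f x)) (h : IsIsometryAlong f E) :
    HasBoundedIterates f E := by
  have key : ∀ (k : ℕ) (x : M), ∀ v ∈ E x, ‖mfderiv (𝓡 n) (𝓡 n) f^[k] x v‖ = ‖v‖ := by
    intro k
    induction k with
    | zero =>
      intro x v _
      rw [Function.iterate_zero, mfderiv_id]
      rfl
    | succ k ih =>
      intro x v hv
      rw [norm_mfderiv_iterate_succ hf, ih (f x) _ (hE x v hv), h x v hv]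
  refine ⟨1, one_pos, fun k x v hv hv1 => ?_⟩
  rw [key k x v hv, hv1, div_one]
  exact ⟨le_rfl, le_rfl⟩

theorem HasBoundedIterates.exists_norm_le (h : HasBoundedIterates f E) :
    ∃ C > 0, ∀ (k : ℕ) (x : M), ∀ v ∈ E x, ‖mfderiv (𝓡 n) (𝓡 n) f^[k] x v‖ ≤ C * ‖v‖ ∧
      ‖v‖ ≤ C * ‖mfderiv (𝓡 n) (𝓡 n) f^[k] x v‖ := by
  obtain ⟨C, hC, H⟩ := h
  refine ⟨C, hC, fun k x v hv => ?_⟩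
  rcases eq_or_ne v 0 with rfl | hv0
  · rw [map_zero, norm_zero, norm_zero, mul_zero]
    exact ⟨le_rfl, le_rfl⟩
  have hpos : 0 < ‖v‖ := norm_pos_iff.2 hv0
  have h1 := H k x (‖v‖⁻¹ • v) ((E x).smul_mem _ hv) (norm_smul_inv_norm (𝕜 := ℝ) hv0)
  rw [map_smul, norm_smul, norm_inv, norm_norm, inv_mul_eq_div, le_div_iff₀ hpos,
    div_le_iff₀ hpos] at h1
  refine ⟨h1.2, ?_⟩
  have := mul_le_mul_of_nonneg_left h1.1 hC.le
  rwa [← mul_assoc, mul_one_div_cancel hC.ne', one_mul] at this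

theorem HasBoundedIterates.lyapunovStable (hf : ContMDiff (𝓡 n) (𝓡 n) 1 f)
    (h : HasBoundedIterates f E) : LyapunovStable f E := by
  obtain ⟨C, hC, H⟩ := h.exists_norm_le
  exact lyapunovStable_of_norm_mfderiv_le hf hC fun k x v hv => (H k x v hv).1

end boundedIterates

section boundedIterates
variable {n : ℕ} {M : Type*} [EMetricSpace M] [ChartedSpace (EuclideanSpace ℝ (Fin n)) M]
  [IsManifold (𝓡 n) ∞ M] [RiemannianBundle (fun x : M => TangentSpace (𝓡 n) x)]
  {E : (x : M) → Submodule ℝ (TangentSpace (𝓡 n) x)}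

theorem exists_diffeomorph_iterate (f : M ≃ₘ^1⟮𝓡 n, 𝓡 n⟯ M) (k : ℕ) :
    ∃ g : M ≃ₘ^1⟮𝓡 n, 𝓡 n⟯ M, ⇑g = f^[k] ∧ ⇑g.symm = f.symm^[k] := by
  induction k with
  | zero => exact ⟨.refl _ _ _, rfl, rfl⟩
  | succ k ih =>
    obtain ⟨g, hg, hg'⟩ := ih
    refine ⟨f.trans g, ?_, ?_⟩
    · rw [Function.iterate_succ, ← hg]; rfl
    · rw [Function.iterate_succ', ← hg']; rfl

/-- The lower bound for `f ^ k` along `E` is an upper bound for its inverse. Treating the iterate as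
a diffeomorphism makes `norm_mfderiv_mfderiv_symm` applicable to it. -/
theorem HasBoundedIterates.lyapunovStable_symm {f : M ≃ₘ^1⟮𝓡 n, 𝓡 n⟯ M}
    (hE : ∀ x, (E x).map (mfderiv (𝓡 n) (𝓡 n) f x).toLinearMap = E (f x))
    (h : HasBoundedIterates f E) : LyapunovStable f.symm E := by
  obtain ⟨C, hC, H⟩ := h.exists_norm_le
  refine lyapunovStable_of_norm_mfderiv_le f.symm.contMDiff_toFun hC fun k x v hv => ?_
  obtain ⟨g, hg, hg'⟩ := exists_diffeomorph_iterate f k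
  have h1 := norm_mfderiv_mfderiv_symm g x v
  rw [hg, hg'] at h1
  rw [← h1]
  exact (H k _ _ (mfderiv_iterate_mem f.symm.contMDiff_toFun (mfderiv_symm_mem hE) k x v hv)).2

end boundedIterates

/-! ### The main theorem. -/

theorem mainTheorem2 {n : ℕ} {M : Type*} [EMetricSpace M] [CompactSpace M]
    [ChartedSpace (EuclideanSpace ℝ (Fin n)) M] [IsManifold (𝓡 n) ∞ M]
    [RiemannianBundle (fun x : M => TangentSpace (𝓡 n) x)]
    [IsContMDiffRiemannianBundle (𝓡 n) ∞ (EuclideanSpace ℝ (Fin n))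
      (fun x : M => TangentSpace (𝓡 n) x)]
    [IsRiemannianManifold (𝓡 n) M]
    (f : M ≃ₘ^1⟮𝓡 n, 𝓡 n⟯ M)
    (Es Ec Eu : (x : M) → Submodule ℝ (TangentSpace (𝓡 n) x))
    (hf : IsPartiallyHyperbolic f Es Ec Eu) :
    (LyapunovStable f Ec ∧ LyapunovStable f.symm Ec → UniqueLaminationPlaqueExpansive f Ec) ∧
    (HasBoundedIterates f Ec → UniqueLaminationPlaqueExpansive f Ec) ∧
    (IsIsometryAlong f Ec → HasBoundedIterates f Ec ∧ UniqueLaminationPlaqueExpansive f Ec) := by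
  have := isContinuousRiemannianBundle_of_contMDiff (n := n) (M := M)
  have h2 : HasBoundedIterates f Ec → UniqueLaminationPlaqueExpansive f Ec := fun h =>
    hf.uniqueLaminationPlaqueExpansive (h.lyapunovStable f.contMDiff_toFun)
      (h.lyapunovStable_symm hf.invariant_c)
  refine ⟨fun h => hf.uniqueLaminationPlaqueExpansive h.1 h.2, h2, fun h => ?_⟩
  have h3 : HasBoundedIterates f Ec := h.hasBoundedIterates f.contMDiff_toFun fun x v hv =>
    hf.invariant_c x ▸ Submodule.mem_map_of_mem hv
  exact ⟨h3, h2 h3⟩
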